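/- **Conventions.** Let $r>2$ be real, $k\ge 1$ an integer and $\mathbf c=(c_0,\dots,c_{k-1})\in(0,\infty)^k$. (For non-integer $r$, $C^r$ means $C^{\lfloor r\rfloor}$ with $(r-\lfloor r\rfloor)$-Hölder derivative of order $\lfloor r\rfloor$.) *Circle diffeomorphisms with breaks.* A circle $C^r$-diffeomorphism with $k$ breaks of sizes $\mathbf c$ is an orientation-preserving homeomorphism $T$ of $S^1=\mathbb R/\mathbb Z$ for which there are points $0=p_0<p_1<\dots<p_{k-1}<p_k=1$ such that $T$ restricts to a $C^r$-diffeomorphism (with positive derivative) on each segment $[p_i,p_{i+1}]$, and $T'(p_i^+)/T'(p_i^-)=c_i$ for $0\le i<k$. *GIETs.* A $C^r$-GIET with $d$ branches is a bijection $G$ of $[0,1)$ given by two subdivisions $0=u_0<\dots<u_d=1$, $0=v_0<\dots<v_d=1$ and a permutation $\sigma$ of $\{0,\dots,d-1\}$ such that $G$ maps $[u_i,u_{i+1})$ onto $[v_{\sigma(i)},v_{\sigma(i)+1})$ and extends to $[u_i,u_{i+1}]$ as a $C^r$ map with positive derivative. $\sigma$ is circular if $\sigma(i)\equiv i+m \pmod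 d$ for some $0<m<d$. Let $\mathbf P_d$ be the set of GIETs with $d$ branches and circular permutation whose branches are all restrictions of orientation-preserving Möbius maps $x\mapsto\frac{ax+b}{cx+e}$. The $C^1$ distance $d_1(G,H)$ of two GIETs with $d$ branches is $\infty$ if their permutations differ; otherwise it is the supremum over all $i$ and all $t\in(0,1)$ of $|x-y|$, $|G(x)-H(y)|$ and $|G'(x)-H'(y)|$, where $x$ and $y$ are the points of relative position $t$ in the $i$-th interval of $G$ and of $H$. As usual $d_1(G,\mathbf P_d)=\inf_{S\in\mathbf P_d}d_1(G,S)$. *Renormalisation.* Cutting the circle at $0$, a circle homeomorphism $T$ without fixed point at $0$ becomes an exchange of two intervals $f:[0,1)\to[0,1)$ which maps $[0,u)$ increasingly onto $[v,1)$ and $[u,1)$ increasingly onto $[0,v)$. If $u\ne v$, let $E(f)$ be the first return map of $f$ to $[0,\max(u,v))$, rescaled affinely to $[0,1)$; top wins if $u>v$, bottom wins if $v>u$. The renormalisation $\mathcal R(f)$ is obtained by applying $E$ as long as the side that wins the first step keeps winning, and, when the other side eventually wins, applying $E$ once more: $\mathcal R(f)=E^{m+1}(f)$ if the first side wins exactly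 the first $m$ steps, and the other one the next step. **Theorem.** For all $r>2$, $k\ge1$ and $\mathbf c\in(0,\infty)^k$ there is $\rho\in(0,1)$ such that the following holds. Let $T$ be a circle $C^r$-diffeomorphism with $k$ breaks of sizes $\mathbf c$ and irrational rotation number. Then $\mathcal R^nT$ is well defined for all $n\ge0$, and there is $C_T>0$ such that for every $n\ge 0$ the map $\mathcal R^nT$ is a $C^r$-GIET with $k+1$ branches (where, if it has fewer than $k$ singularities, further subdivision points may be added) and $$d_1(\mathcal R^nT,\mathbf P_{k+1})\le C_T\,\rho^n .$$ -/

import Mathlib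

open Set
open scoped ENNReal

noncomputable section

namespace CircleBreaks

/-! ## Regularity of real order -/

/-- `f` is of class `C^r` on `s`, for a real number `r ≥ 0`: it is `⌊r⌋` times continuously
differentiable on `s` and its derivative of order `⌊r⌋` is Hölder of exponent `r - ⌊r⌋` on `s`.
(If `r` is an integer and `s` is a compact segment, the second condition only says that a
continuous function is bounded, so that one gets the usual class `C^r`.) -/
def IsCrOn (r : ℝ) (f : ℝ → ℝ) (s : Set ℝ) : Prop :=
  ContDiffOn ℝ (⌊r⌋₊ : WithTop ℕ∞) f s ∧
    ∃ C, HolderOnWith C (r - ⌊r⌋₊).toNNReal (iteratedDerivWithin ⌊r⌋₊ f s) s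

/-- `0 = u 0 < u 1 < ⋯ < u d = 1`, the end points of a subdivision of `[0,1]` into `d` segments. -/
structure IsSubdivision {d : ℕ} (u : Fin (d + 1) → ℝ) : Prop where
  zero : u 0 = 0
  last : u (Fin.last d) = 1
  strictMono : StrictMono u

/-! ## Circle diffeomorphisms with breaks -/

/-- `F : ℝ → ℝ` is a lift of the circle homeomorphism `T`. Since `F` is an increasing map with
`F (x + 1) = F x + 1`, a homeomorphism has a lift exactly if it preserves the orientation. -/
def IsLift (F : CircleDeg1Lift) (T : UnitAddCircle ≃ₜ UnitAddCircle) : Prop :=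
  Continuous F ∧ ∀ x : ℝ, ((F x : ℝ) : UnitAddCircle) = T (x : UnitAddCircle)

/-- The rotation number of `T`, i.e. the class modulo `1` of the translation number of its lifts,
is irrational. -/
def HasIrrationalRotationNumber (T : UnitAddCircle ≃ₜ UnitAddCircle) : Prop :=
  ∃ F : CircleDeg1Lift, IsLift F T ∧ Irrational F.translationNumber

/-- `T` is a (orientation preserving) circle `C^r`-diffeomorphism with `k` breaks
`0 = p 0 < p 1 < ⋯ < p (k - 1) < 1 = p k` of sizes `c 0, …, c (k - 1)`: it restricts to a
`C^r`-diffeomorphism of every segment `[p i, p (i + 1)]` onto its image, and the right derivative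
at `p i` divided by the left derivative at `p i` is `c i`. -/
def IsBreakDiffeo (r : ℝ) {k : ℕ} (c : Fin k → ℝ) (T : UnitAddCircle ≃ₜ UnitAddCircle) : Prop :=
  ∃ (F : CircleDeg1Lift) (p : Fin (k + 1) → ℝ), IsLift F T ∧ IsSubdivision p ∧
    ∀ i : Fin k,
      IsCrOn r F (Icc (p i.castSucc) (p i.succ)) ∧
      (∀ x ∈ Icc (p i.castSucc) (p i.succ),
        0 < derivWithin F (Icc (p i.castSucc) (p i.succ)) x) ∧
      derivWithin F (Ici (p i.castSucc)) (p i.castSucc) /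
        derivWithin F (Iic (p i.castSucc)) (p i.castSucc) = c i

/-- The map induced by `T` on `[0,1)` when the circle is cut at the break `0`.
Only its values on `[0,1)` matter. -/
def cutMap (T : UnitAddCircle ≃ₜ UnitAddCircle) (x : ℝ) : ℝ :=
  (AddCircle.equivIco (1 : ℝ) 0 (T (x : UnitAddCircle)) : ℝ)

/-! ## Generalised interval exchange transformations -/

/-- A `C^r`-generalised interval exchange transformation of `[0,1)` with `d` branches. The `i`-th
interval `[top i, top (i + 1))` is mapped onto the interval `[bot (perm i), bot (perm i + 1))`, so
`perm` is the permutation `π_b⁻¹ ∘ π_t` of the marked permutation `(π_t, π_b)`.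
The values of `toFun` outside `[0,1)` are irrelevant. -/
structure GIET (r : ℝ) (d : ℕ) where
  perm : Equiv.Perm (Fin d)
  top : Fin (d + 1) → ℝ
  bot : Fin (d + 1) → ℝ
  toFun : ℝ → ℝ
  top_subdivision : IsSubdivision top
  bot_subdivision : IsSubdivision bot
  image_branch : ∀ i : Fin d, toFun '' Ico (top i.castSucc) (top i.succ) =
    Ico (bot (perm i).castSucc) (bot (perm i).succ)
  /-- Every branch extends to the closed interval as a `C^r` map with positive derivative. -/
  regular_branch : ∀ i : Fin d, ∃ g : ℝ → ℝ,
    EqOn toFun g (Ico (top i.castSucc) (top i.succ)) ∧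
    IsCrOn r g (Icc (top i.castSucc) (top i.succ)) ∧
    ∀ x ∈ Icc (top i.castSucc) (top i.succ),
      0 < derivWithin g (Icc (top i.castSucc) (top i.succ)) x

/-- The permutation of a `GIET` is circular: a non-trivial rotation `i ↦ i + m` modulo `d`. -/
def IsCircular {d : ℕ} (σ : Equiv.Perm (Fin d)) : Prop :=
  ∃ m : ℕ, 0 < m ∧ m < d ∧ ∀ i : Fin d, (σ i : ℕ) = (i + m) % d

/-- The set of generalised interval exchange transformations with `d` branches and circular
permutation, all of whose branches are restrictions of orientation preserving Möbius maps. -/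
def moebiusGIET (r : ℝ) (d : ℕ) : Set (GIET r d) :=
  {S | IsCircular S.perm ∧ ∀ i : Fin d, ∃ a b c e : ℝ, 0 < a * e - b * c ∧
    ∀ x ∈ Ico (S.top i.castSucc) (S.top i.succ),
      c * x + e ≠ 0 ∧ S.toFun x = (a * x + b) / (c * x + e)}

/-- The point of the `i`-th interval of `G` with relative position `t ∈ [0,1]`. -/
def GIET.point {r : ℝ} {d : ℕ} (G : GIET r d) (i : Fin d) (t : ℝ) : ℝ :=
  G.top i.castSucc + t * (G.top i.succ - G.top i.castSucc)

/-- The `C^1` distance between two generalised interval exchange transformations. It is infinite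
if the permutations differ. Otherwise corresponding branches are compared by identifying
their domains affinely: it is the supremum of the differences of corresponding points, of the
values and of the derivatives at these points. For two maps with the same intervals it is the
uniform `C^1` distance. -/
def d1 {r : ℝ} {d : ℕ} (G H : GIET r d) : ℝ≥0∞ :=
  if G.perm = H.perm then
    ⨆ (i : Fin d) (t : ℝ) (_ : t ∈ Ioo (0 : ℝ) 1), ENNReal.ofReal
      (max |G.point i t - H.point i t|
        (max |G.toFun (G.point i t) - H.toFun (H.point i t)|
          |deriv G.toFun (G.point i t) - deriv H.toFun (H.point i t)|))
  else ⊤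

/-- The `C^1` distance of `G` to a set. -/
def d1ToSet {r : ℝ} {d : ℕ} (G : GIET r d) (A : Set (GIET r d)) : ℝ≥0∞ :=
  ⨅ S ∈ A, d1 G S

/-! ## Renormalisation

A circle homeomorphism cut at `0` is an exchange `f` of two intervals of `[0,1)`: it maps
`[0, u)` onto `[v, 1)` and `[u, 1)` onto `[0, v)`, increasingly, where `v = f 0` and `u` is the point
with `f u = 0`. -/

/-- The singularity `u` at the top, of an exchange `f` of two intervals. -/
def topSing (f : ℝ → ℝ) : ℝ := sInf {x | x ∈ Ico (0 : ℝ) 1 ∧ f x = 0}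

/-- The singularity `v` at the bottom, of an exchange `f` of two intervals. -/
def botSing (f : ℝ → ℝ) : ℝ := f 0

/-- The first return time `n ≥ 1` of `x` to `[0, l)`. -/
def returnTime (f : ℝ → ℝ) (l x : ℝ) : ℕ := sInf {n | 1 ≤ n ∧ f^[n] x ∈ Ico 0 l}

/-- The first return map to `[0, l)`. -/
def firstReturn (f : ℝ → ℝ) (l x : ℝ) : ℝ := f^[returnTime f l x] x

/-- The elementary step of Rauzy induction: the first return map to `[0, l)`,
`l = max u v`, rescaled to `[0,1)`. -/
def rauzy (f : ℝ → ℝ) (x : ℝ) : ℝ :=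
  firstReturn f (max (topSing f) (botSing f)) (max (topSing f) (botSing f) * x) /
    max (topSing f) (botSing f)

def TopWins (f : ℝ → ℝ) : Prop := botSing f < topSing f

def BotWins (f : ℝ → ℝ) : Prop := topSing f < botSing f

/-- One side wins the steps `0, …, m - 1` of the Rauzy induction of `f`, and the other side wins
the step `m`. There is at most one such `m`, and then `m ≥ 1`. -/
def IsSwitch (f : ℝ → ℝ) (m : ℕ) : Prop :=
  (TopWins f ∧ (∀ j < m, TopWins (rauzy^[j] f)) ∧ BotWins (rauzy^[m] f)) ∨
  (BotWins f ∧ (∀ j < m, BotWins (rauzy^[j] f)) ∧ TopWins (rauzy^[m] f))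

/-- The algorithm that defines the renormalisation of `f` terminates. -/
def IsRenormalisable (f : ℝ → ℝ) : Prop := ∃ m, IsSwitch f m

/-- The renormalisation `R f`: apply the elementary step as long as the first winner keeps winning,
and, when the other side eventually wins, apply it once more.
It is meaningful if `IsRenormalisable f`. -/
def renorm (f : ℝ → ℝ) : ℝ → ℝ := rauzy^[sInf {m | IsSwitch f m} + 1] f

end CircleBreaks

end

open CircleBreaks

/-! The lift `F` orders its orbits as the rotation by its irrational rotation number `θ` does. Hence
Rauzy induction follows the subtractive Euclidean algorithm of `θ`: the induced map consists of `Q =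
F^a - m`, moving right, and `R = F^b - n`, moving left, with inverse `P`, and a step composes one
with the other (`rauzy_eqOn`). The first `a` images of `[x, P x)` and the first `b` images of `[P x,
Q (P x))` tile the circle (`St.Tower`). Three estimates then give the theorem.

Möbius approximation. The cocycle `xr` is additive under composition, vanishes for Möbius maps and
is `O(|y - x|^(1+δ))` on intervals without breaks, where `δ = min 1 (r - 2)`. The levels of a tower
are disjoint and no longer than `D`, a bound of the displacements of `P` and `Q`, so `xr` of a
branch is `O(D^δ)` (`abs_xr_pow_le`). A branch with small `xr` is `C^1`-close to a Möbius map with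
the same end points (`mob_close`). The subdivision points of the branches are `P 0` and the base
points below the `k` breaks; one of the latter is `0`, which leaves `k + 1` branches
(`exists_partition`).

Contraction. If `V` bounds the distortion along the towers, the logarithmic derivative of the winner
is at most `3V` in absolute value. Each change of winner then shrinks a displacement by the factor
`1 / (1 + exp (-3V))`, and two renormalisations contain a change in both directions (`disp_decay`).

Uniformity. The rate may depend on `r` and `c` only, so `V` must eventually be independent of the
map. The logarithm of `F'` is a jump function plus the integral of the nonlinearity, whose mean is
`-∑ log (c i)`. As `F` is ergodic for the Lebesgue measure (`ae_mem_or_ae_notMem`), the nonlinearity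
minus its mean is an `L^1` limit of coboundaries `g - (g ∘ F) F'`. The integral of a coboundary has
telescoping Birkhoff sums, which become negligible over short intervals. What remains is at most `2
∑ |log (c i)| + 1` (`BreakLift.exists_dist_universal`). -/

namespace BreakRenorm

/-! ## The group generated by a lift and the unit translation -/

/-- `F` commutes with the unit translation. -/
def IsDegOne (F : ℝ ≃o ℝ) : Prop := ∀ x, F (x + 1) = F x + 1

/-- The element `F ^ n` followed by the translation by `m`. -/
def gm (F : ℝ ≃o ℝ) (n m : ℤ) (x : ℝ) : ℝ := (F ^ n) x + m

/-- The order of the orbits of `F` is the one of the rotation by the irrational number `θ`. -/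
structure RotOrder (F : ℝ ≃o ℝ) (θ : ℝ) : Prop where
  degOne : IsDegOne F
  irrational : Irrational θ
  lt_gm : ∀ n m : ℤ, 0 < n * θ + m → ∀ x, x < gm F n m x

section Group

variable {F : ℝ ≃o ℝ} {θ : ℝ}

theorem IsDegOne.sub_one (hF : IsDegOne F) (x : ℝ) : F (x - 1) = F x - 1 := by
  have := hF (x - 1)
  rw [sub_add_cancel] at this
  linarith

theorem IsDegOne.add_int (hF : IsDegOne F) (x : ℝ) (m : ℤ) : F (x + m) = F x + m := by
  induction m using Int.induction_on with
  | zero => simp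
  | succ i ih =>
    push_cast at ih ⊢
    rw [← add_assoc, hF, ih, add_assoc]
  | pred i ih =>
    push_cast at ih ⊢
    rw [show x + (-(i : ℝ) - 1) = (x + -(i : ℝ)) - 1 by ring, hF.sub_one, ih]
    ring

theorem IsDegOne.symm_add_int (hF : IsDegOne F) (x : ℝ) (m : ℤ) :
    F.symm (x + m) = F.symm x + m := by
  rw [OrderIso.symm_apply_eq, hF.add_int, OrderIso.apply_symm_apply]

theorem IsDegOne.zpow_add_int (hF : IsDegOne F) (n m : ℤ) (x : ℝ) :
    (F ^ n) (x + m) = (F ^ n) x + m := by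
  induction n using Int.induction_on generalizing x with
  | zero => simp
  | succ i ih =>
    rw [zpow_add_one, RelIso.mul_apply, RelIso.mul_apply, hF.add_int, ih]
  | pred i ih =>
    rw [zpow_sub_one, RelIso.mul_apply, RelIso.mul_apply]
    have : F⁻¹ (x + m) = F⁻¹ x + m := hF.symm_add_int x m
    rw [this, ih]

theorem IsDegOne.pow_add_int (hF : IsDegOne F) (n : ℕ) (m : ℤ) (x : ℝ) :
    (F ^ n) (x + m) = (F ^ n) x + m := by
  have := hF.zpow_add_int n m x
  simpa only [zpow_natCast] using this

theorem IsDegOne.gm_gm (hF : IsDegOne F) (n m n' m' : ℤ) (x : ℝ) :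
    gm F n m (gm F n' m' x) = gm F (n + n') (m + m') x := by
  unfold gm
  rw [hF.zpow_add_int, zpow_add, RelIso.mul_apply]
  push_cast
  ring

@[simp] theorem gm_zero_zero (F : ℝ ≃o ℝ) (x : ℝ) : gm F 0 0 x = x := by simp [gm]

theorem gm_strictMono (F : ℝ ≃o ℝ) (n m : ℤ) : StrictMono (gm F n m) := fun x y h => by
  unfold gm
  have := (F ^ n).strictMono h
  linarith

/-- All the maps `gm` commute, so two of them are compared by applying their quotient at the point
`gm F n m x`. -/
theorem RotOrder.gm_lt_gm (h : RotOrder F θ) {n m n' m' : ℤ}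
    (hn : n * θ + m < n' * θ + m') (x : ℝ) : gm F n m x < gm F n' m' x := by
  have := h.lt_gm (n' - n) (m' - m) (by push_cast; linarith) (gm F n m x)
  rwa [h.degOne.gm_gm, sub_add_cancel, sub_add_cancel] at this

theorem pow_gm (hF : IsDegOne F) (i : ℕ) (n m : ℤ) (x : ℝ) :
    (F ^ i) (gm F n m x) = gm F n m ((F ^ i) x) := by
  have h1 : ∀ y, (F ^ i) y = gm F i 0 y := fun y => by simp [gm]
  rw [h1, h1, hF.gm_gm, hF.gm_gm, add_comm (i : ℤ), add_comm (0 : ℤ)]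

end Group

/-! ## The subtractive algorithm -/

/-- A pair of return maps: `F ^ a - m` moves to the right and `F ^ b - n` moves to the left. -/
structure St where
  a : ℕ
  m : ℤ
  b : ℕ
  n : ℤ

/-- The return map that moves to the right. -/
def St.Q (F : ℝ ≃o ℝ) (s : St) : ℝ → ℝ := gm F s.a (-s.m)

/-- The inverse of the return map that moves to the left. -/
def St.P (F : ℝ ≃o ℝ) (s : St) : ℝ → ℝ := gm F (-s.b) s.n

/-- The return map that moves to the left. -/
def St.R (F : ℝ ≃o ℝ) (s : St) : ℝ → ℝ := gm F s.b (-s.n)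

/-- The top wins. -/
def St.Top (θ : ℝ) (s : St) : Prop := s.a * θ - s.m < s.n - s.b * θ

/-- The winner is the top: the left return map is composed with the right one. -/
def St.stepTop (s : St) : St := ⟨s.a, s.m, s.a + s.b, s.m + s.n⟩

/-- The winner is the bottom: the right return map is composed with the left one. -/
def St.stepBot (s : St) : St := ⟨s.a + s.b, s.m + s.n, s.b, s.n⟩

open Classical in
/-- One step of the subtractive algorithm. -/
noncomputable def St.step (θ : ℝ) (s : St) : St := if s.Top θ then s.stepTop else s.stepBot

theorem St.step_of_top {θ : ℝ} {s : St} (h : s.Top θ) : s.step θ = s.stepTop := if_pos h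

theorem St.step_of_not_top {θ : ℝ} {s : St} (h : ¬ s.Top θ) : s.step θ = s.stepBot := if_neg h

/-- The states of the subtractive algorithm. -/
noncomputable def rst (θ : ℝ) : ℕ → St
  -- For `0 < θ < 1`, `F` moves to the right and `F - 1` to the left.
  | 0 => ⟨1, 0, 1, 1⟩
  | s + 1 => (rst θ s).step θ

/-- The properties of a state that the algorithm preserves. -/
structure St.Valid (θ : ℝ) (s : St) : Prop where
  a_pos : 1 ≤ s.a
  b_pos : 1 ≤ s.b
  q_pos : 0 < s.a * θ - s.m
  p_pos : 0 < s.n - s.b * θ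

section States

variable {F : ℝ ≃o ℝ} {θ : ℝ} {s : St}

/-- A tie would make `θ = (m + n) / (a + b)` rational. -/
theorem St.Valid.not_top (hθ : Irrational θ) (hs : s.Valid θ) (h : ¬ s.Top θ) :
    s.n - s.b * θ < s.a * θ - s.m := by
  refine lt_of_le_of_ne (not_lt.1 h) fun he => ?_
  have h1 : θ = ((s.m + s.n : ℤ) : ℝ) / ((s.a + s.b : ℤ) : ℝ) := by
    have : (0 : ℝ) < s.a := by exact_mod_cast hs.a_pos
    have h2 : (0 : ℝ) < ((s.a + s.b : ℤ) : ℝ) := by push_cast; positivity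
    rw [eq_div_iff h2.ne']
    push_cast
    linarith
  apply hθ
  refine ⟨(s.m + s.n : ℤ) / (s.a + s.b : ℤ), ?_⟩
  rw [h1]; push_cast; ring

theorem St.Valid.step (hθ : Irrational θ) (hs : s.Valid θ) : (s.step θ).Valid θ := by
  obtain ⟨h1, h2, h3, h4⟩ := hs
  by_cases h : s.Top θ
  · rw [St.step_of_top h]
    unfold St.Top at h
    refine ⟨h1, by simp [St.stepTop]; omega, h3, ?_⟩
    simp only [St.stepTop]; push_cast; linarith
  · rw [St.step_of_not_top h]
    have := St.Valid.not_top hθ ⟨h1, h2, h3, h4⟩ h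
    refine ⟨by simp [St.stepBot]; omega, h2, ?_, h4⟩
    simp only [St.stepBot]; push_cast; linarith

theorem rst_valid (hθ : Irrational θ) (h0 : 0 < θ) (h1 : θ < 1) (s : ℕ) : (rst θ s).Valid θ := by
  induction s with
  | zero => exact ⟨le_rfl, le_rfl, by simp [rst, h0], by simp [rst, h1]⟩
  | succ s ih => exact ih.step hθ

end States

section Maps

variable {F : ℝ ≃o ℝ} {θ : ℝ} {s : St}

theorem St.R_P (hF : IsDegOne F) (s : St) (x : ℝ) : s.R F (s.P F x) = x := by
  unfold St.R St.P
  rw [hF.gm_gm]; simp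

theorem St.P_R (hF : IsDegOne F) (s : St) (x : ℝ) : s.P F (s.R F x) = x := by
  unfold St.R St.P
  rw [hF.gm_gm]; simp

theorem St.Q_P (hF : IsDegOne F) (s : St) (x : ℝ) : s.Q F (s.P F x) = s.P F (s.Q F x) := by
  unfold St.Q St.P
  rw [hF.gm_gm, hF.gm_gm, add_comm (s.a : ℤ), add_comm (-s.m)]

theorem St.P_mono (F : ℝ ≃o ℝ) (s : St) : StrictMono (s.P F) := gm_strictMono F _ _

theorem St.Q_mono (F : ℝ ≃o ℝ) (s : St) : StrictMono (s.Q F) := gm_strictMono F _ _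

theorem St.R_mono (F : ℝ ≃o ℝ) (s : St) : StrictMono (s.R F) := gm_strictMono F _ _

theorem St.Valid.lt_P (hs : s.Valid θ) (h : RotOrder F θ) (x : ℝ) : x < s.P F x :=
  h.lt_gm _ _ (by have := hs.p_pos; push_cast; linarith) x

theorem St.Valid.lt_Q (hs : s.Valid θ) (h : RotOrder F θ) (x : ℝ) : x < s.Q F x :=
  h.lt_gm _ _ (by have := hs.q_pos; push_cast; linarith) x

theorem St.Valid.Q_lt_P (_hs : s.Valid θ) (h : RotOrder F θ) (ht : s.Top θ) (x : ℝ) :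
    s.Q F x < s.P F x :=
  h.gm_lt_gm (by unfold St.Top at ht; push_cast; linarith) x

theorem St.Valid.P_lt_Q (hs : s.Valid θ) (h : RotOrder F θ) (ht : ¬ s.Top θ) (x : ℝ) :
    s.P F x < s.Q F x :=
  h.gm_lt_gm (by have := hs.not_top h.irrational ht; push_cast; linarith) x

theorem pow_P (hF : IsDegOne F) (s : St) (i : ℕ) (x : ℝ) :
    (F ^ i) (s.P F x) = s.P F ((F ^ i) x) := pow_gm hF i _ _ x

theorem pow_Q (hF : IsDegOne F) (s : St) (i : ℕ) (x : ℝ) :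
    (F ^ i) (s.Q F x) = s.Q F ((F ^ i) x) := pow_gm hF i _ _ x

theorem pow_a (F : ℝ ≃o ℝ) (s : St) (x : ℝ) : (F ^ s.a) x = s.Q F x + s.m := by
  simp [St.Q, gm]

theorem pow_b (F : ℝ ≃o ℝ) (s : St) (x : ℝ) : (F ^ s.b) x = s.R F x + s.n := by
  simp [St.R, gm]

theorem pow_b_P (hF : IsDegOne F) (s : St) (x : ℝ) : (F ^ s.b) (s.P F x) = x + s.n := by
  rw [pow_b, s.R_P hF]

theorem St.stepTop_Q (F : ℝ ≃o ℝ) (s : St) : s.stepTop.Q F = s.Q F := rfl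

theorem St.stepBot_P (F : ℝ ≃o ℝ) (s : St) : s.stepBot.P F = s.P F := rfl

theorem St.stepBot_R (F : ℝ ≃o ℝ) (s : St) : s.stepBot.R F = s.R F := rfl

/-- The new `P` is `Q⁻¹ ∘ P`. At `0` this says that the new interval has length `P 0`. -/
theorem St.Q_stepTop_P (hF : IsDegOne F) (s : St) (x : ℝ) :
    s.Q F (s.stepTop.P F x) = s.P F x := by
  unfold St.Q St.P St.stepTop
  rw [hF.gm_gm]
  congr 1
  · push_cast; ring
  · ring

theorem St.P_stepBot_Q (hF : IsDegOne F) (s : St) (x : ℝ) :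
    s.P F (s.stepBot.Q F x) = s.Q F x := by
  unfold St.Q St.P St.stepBot
  rw [hF.gm_gm]
  congr 1
  · push_cast; ring
  · ring

theorem St.stepTop_R (hF : IsDegOne F) (s : St) (x : ℝ) :
    s.stepTop.R F x = s.R F (s.Q F x) := by
  unfold St.Q St.R St.stepTop
  rw [hF.gm_gm]
  congr 1
  · push_cast; ring
  · ring

theorem St.stepBot_Q (hF : IsDegOne F) (s : St) (x : ℝ) :
    s.stepBot.Q F x = s.R F (s.Q F x) := by
  unfold St.Q St.R St.stepBot
  rw [hF.gm_gm]
  congr 1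
  · push_cast; ring
  · ring

end Maps

/-! ## Sums along the towers of a state -/

/-- The Birkhoff sum of `ν`. -/
noncomputable def bsum (F : ℝ ≃o ℝ) (ν : ℝ → ℝ) (i : ℕ) (x : ℝ) : ℝ :=
  ∑ j ∈ Finset.range i, ν ((F ^ j) x)

section Towers

variable {F : ℝ ≃o ℝ} {θ : ℝ} {s : St} {ν : ℝ → ℝ} {c : ℝ}

theorem bsum_succ (F : ℝ ≃o ℝ) (ν : ℝ → ℝ) (i : ℕ) (x : ℝ) :
    bsum F ν (i + 1) x = bsum F ν i x + ν ((F ^ i) x) := Finset.sum_range_succ _ _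

theorem bsum_add (F : ℝ ≃o ℝ) (ν : ℝ → ℝ) (i j : ℕ) (x : ℝ) :
    bsum F ν (i + j) x = bsum F ν i x + bsum F ν j ((F ^ i) x) := by
  unfold bsum
  rw [Finset.sum_range_add]
  congr 1
  refine Finset.sum_congr rfl fun k _ => ?_
  rw [add_comm i k, pow_add, RelIso.mul_apply]

theorem add_int_of_add_one {ν : ℝ → ℝ} {c : ℝ} (h : ∀ x, ν (x + 1) = ν x + c) (x : ℝ) (m : ℤ) :
    ν (x + m) = ν x + m * c := by
  induction m using Int.induction_on generalizing x with
  | zero => simp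
  | succ i ih =>
    push_cast at ih ⊢
    rw [← add_assoc, h, ih]; ring
  | pred i ih =>
    push_cast at ih ⊢
    have := h (x + (-(i : ℝ) - 1))
    rw [show x + (-(i : ℝ) - 1) + 1 = x + -(i : ℝ) by ring, ih] at this
    linarith

theorem bsum_add_int (hF : IsDegOne F) (h : ∀ x, ν (x + 1) = ν x + c) (i : ℕ) (x : ℝ) (m : ℤ) :
    bsum F ν i (x + m) = bsum F ν i x + i * (m * c) := by
  unfold bsum
  simp_rw [hF.pow_add_int, add_int_of_add_one h, Finset.sum_add_distrib]
  simp

/-- The towers over `[x, P x)` and `[P x, Q (P x))` cover the circle exactly once. -/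
def St.Tower (F : ℝ ≃o ℝ) (s : St) : Prop :=
  -- A function `ν` of this kind acts as the distribution function of a signed mass `c` on the
  -- circle. The tiling is encoded by the identity for all such `ν`, which passes through the
  -- induction by algebra alone; counting functions then recover covering and disjointness.
  ∀ (ν : ℝ → ℝ) (c : ℝ), (∀ x, ν (x + 1) = ν x + c) → ∀ x,
    (bsum F ν s.a (s.P F x) - bsum F ν s.a x) +
      (bsum F ν s.b (s.Q F (s.P F x)) - bsum F ν s.b (s.P F x)) = c

/-- Cutting and stacking: write `P'` for the new `P`. Over `[P' x, P x)` the tower of height `a + b`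
is split at height `a`, where `F^a`, which is `Q` up to an integer, has moved the base to `[P x, Q
(P x))`. The integer cancels in the increments. -/
theorem St.Tower.stepTop (hF : IsDegOne F) (hs : s.Tower F) : s.stepTop.Tower F := by
  intro ν c hν x
  have key := hs ν c hν x
  have h1 : s.Q F (s.stepTop.P F x) = s.P F x := s.Q_stepTop_P hF x
  rw [St.stepTop_Q, h1]
  change (bsum F ν s.a _ - bsum F ν s.a x) +
    (bsum F ν (s.a + s.b) _ - bsum F ν (s.a + s.b) _) = c
  rw [bsum_add, bsum_add, pow_a, pow_a, h1, bsum_add_int hF hν, bsum_add_int hF hν]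
  linarith

theorem St.Tower.stepBot (hF : IsDegOne F) (hs : s.Tower F) : s.stepBot.Tower F := by
  intro ν c hν x
  -- Based at `R x`, the old intervals are `[R x, x)` and `[x, Q x)`; the second one is cut at `P x`
  -- and its left part is mapped by `R` onto the first.
  have key := hs ν c hν (s.R F x)
  rw [s.P_R hF] at key
  rw [St.stepBot_P]
  have h1 : s.stepBot.Q F (s.P F x) = s.Q F x := by
    rw [s.stepBot_Q hF, s.Q_P hF, s.R_P hF]
  rw [h1]
  change (bsum F ν (s.a + s.b) _ - bsum F ν (s.a + s.b) x) + (bsum F ν s.b _ - bsum F ν s.b _) = c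
  rw [add_comm s.a, bsum_add, bsum_add, pow_b, pow_b, s.R_P hF, bsum_add_int hF hν,
    bsum_add_int hF hν]
  linarith

theorem rst_tower (hF : IsDegOne F) (k : ℕ) : (rst θ k).Tower F := by
  induction k with
  | zero =>
    intro ν c hν x
    have h : St.Q F (rst θ 0) (St.P F (rst θ 0) x) = x + 1 := by
      unfold St.Q St.P
      rw [hF.gm_gm]
      simp [rst, gm]
    rw [h]
    simp [rst, bsum, hν]
  | succ k ih =>
    change ((rst θ k).step θ).Tower F
    by_cases h : (rst θ k).Top θ
    · rw [St.step_of_top h]; exact ih.stepTop hF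
    · rw [St.step_of_not_top h]; exact ih.stepBot hF

theorem bsum_mono (hν : Monotone ν) (i : ℕ) : Monotone (bsum F ν i) := fun _ _ h =>
  Finset.sum_le_sum fun _ _ => hν ((F ^ _).monotone h)

theorem bsum_diff_mono (hν : Monotone ν) {i j : ℕ} (hij : i ≤ j) {x y x' y' : ℝ} (h1 : x' ≤ x)
    (h2 : x ≤ y) (h3 : y ≤ y') :
    bsum F ν i y - bsum F ν i x ≤ bsum F ν j y' - bsum F ν j x' := by
  have h4 : ∀ i, bsum F ν i y - bsum F ν i x ≤ bsum F ν i y' - bsum F ν i x' := fun i =>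
    sub_le_sub (bsum_mono hν i h3) (bsum_mono hν i h1)
  refine (h4 i).trans ?_
  unfold bsum
  rw [← Finset.sum_sub_distrib, ← Finset.sum_sub_distrib]
  refine Finset.sum_le_sum_of_subset_of_nonneg (Finset.range_mono hij) fun k _ _ => ?_
  exact sub_nonneg.2 (hν ((F ^ k).monotone (h1.trans (h2.trans h3))))

/-- The mass of a tower over a part of `[x, P x)`. -/
theorem St.Tower.bsum_sub_le_P (ht : s.Tower F) (hs : s.Valid θ) (h : RotOrder F θ)
    (hν : Monotone ν) (hc : ∀ x, ν (x + 1) = ν x + c) {x y z : ℝ} {i : ℕ} (hi : i ≤ s.a)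
    (h1 : x ≤ y) (h2 : y ≤ z) (h3 : z ≤ s.P F x) :
    bsum F ν i z - bsum F ν i y ≤ c := by
  have key := ht ν c hc x
  have h4 := bsum_diff_mono (F := F) hν hi h1 h2 h3
  have h5 := bsum_mono (F := F) hν s.b (hs.lt_Q h (s.P F x)).le
  linarith

/-- The mass of a tower over a part of `[x, Q x)`. -/
theorem St.Tower.bsum_sub_le_Q (ht : s.Tower F) (hs : s.Valid θ) (h : RotOrder F θ)
    (hν : Monotone ν) (hc : ∀ x, ν (x + 1) = ν x + c) {x y z : ℝ} {i : ℕ} (hi : i ≤ s.b)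
    (h1 : x ≤ y) (h2 : y ≤ z) (h3 : z ≤ s.Q F x) :
    bsum F ν i z - bsum F ν i y ≤ c := by
  have key := ht ν c hc (s.R F x)
  rw [s.P_R h.degOne] at key
  have h4 := bsum_diff_mono (F := F) hν hi h1 h2 h3
  have h5 := bsum_mono (F := F) hν s.a (hs.lt_P h (s.R F x)).le
  rw [s.P_R h.degOne] at h5
  linarith

/-! ### Counting the points of the circle in the towers -/

/-- The number of integers `j` with `j + p < x`, up to a constant. -/
noncomputable def ceilCount (p x : ℝ) : ℝ := ⌈x - p⌉

theorem ceilCount_mono (p : ℝ) : Monotone (ceilCount p) := fun x y h => by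
  unfold ceilCount
  exact_mod_cast Int.ceil_mono (by linarith)

theorem ceilCount_add_one (p x : ℝ) : ceilCount p (x + 1) = ceilCount p x + 1 := by
  unfold ceilCount
  rw [show x + 1 - p = (x - p) + 1 by ring, Int.ceil_add_one]
  push_cast; ring

/-- Increments of the ceiling count the translates of `p` in `[x, y)`, closed at the left and open
at the right as the levels of the towers are. -/
theorem one_le_ceilCount_sub {p x y : ℝ} {n : ℤ} (h1 : x ≤ p + n) (h2 : p + n < y) :
    1 ≤ ceilCount p y - ceilCount p x := by
  unfold ceilCount
  have h3 : ⌈x - p⌉ ≤ n := Int.ceil_le.2 (by linarith)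
  have h4 : n < ⌈y - p⌉ := Int.lt_ceil.2 (by linarith)
  have : (1 : ℤ) ≤ ⌈y - p⌉ - ⌈x - p⌉ := by omega
  exact_mod_cast this

theorem exists_of_ceilCount_lt {p x y : ℝ} (h : ceilCount p x < ceilCount p y) :
    ∃ n : ℤ, x ≤ p + n ∧ p + n < y := by
  unfold ceilCount at h
  have h' : ⌈x - p⌉ < ⌈y - p⌉ := by exact_mod_cast h
  refine ⟨⌈x - p⌉, by linarith [Int.le_ceil (x - p)], ?_⟩
  have := Int.lt_ceil.1 h'
  linarith

/-- Every point of the circle is in one of the towers. -/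
theorem St.Tower.exists_mem (ht : s.Tower F) (x p : ℝ) :
    ∃ (i : ℕ) (n : ℤ), (i < s.a ∧ p + n ∈ Ico ((F ^ i) x) ((F ^ i) (s.P F x))) ∨
      (i < s.b ∧ p + n ∈ Ico ((F ^ i) (s.P F x)) ((F ^ i) (s.Q F (s.P F x)))) := by
  by_contra! hcon
  -- If no level contained a translate of `p`, no increment of the counting function would be
  -- positive, yet the increments add up to `1`.
  have key := ht _ 1 (ceilCount_add_one p) x
  have h1 : bsum F (ceilCount p) s.a (s.P F x) - bsum F (ceilCount p) s.a x ≤ 0 := by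
    unfold bsum
    rw [← Finset.sum_sub_distrib]
    refine Finset.sum_nonpos fun i hi => sub_nonpos.2 (not_lt.1 fun hlt => ?_)
    obtain ⟨n, h1, h2⟩ := exists_of_ceilCount_lt hlt
    exact (hcon i n).1 (Finset.mem_range.1 hi) ⟨h1, h2⟩
  have h2 : bsum F (ceilCount p) s.b (s.Q F (s.P F x)) - bsum F (ceilCount p) s.b (s.P F x)
      ≤ 0 := by
    unfold bsum
    rw [← Finset.sum_sub_distrib]
    refine Finset.sum_nonpos fun i hi => sub_nonpos.2 (not_lt.1 fun hlt => ?_)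
    obtain ⟨n, h1, h2⟩ := exists_of_ceilCount_lt hlt
    exact (hcon i n).2 (Finset.mem_range.1 hi) ⟨h1, h2⟩
  linarith

/-- A point of the circle is only once in the towers. -/
theorem St.Tower.unique (ht : s.Tower F) (hs : s.Valid θ) (h : RotOrder F θ) {x p w w' : ℝ}
    {i i' : ℕ} {n n' : ℤ}
    (hw : (i < s.a ∧ w ∈ Ico x (s.P F x)) ∨ (i < s.b ∧ w ∈ Ico (s.P F x) (s.Q F (s.P F x))))
    (hw' : (i' < s.a ∧ w' ∈ Ico x (s.P F x)) ∨ (i' < s.b ∧ w' ∈ Ico (s.P F x) (s.Q F (s.P F x))))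
    (hp : (F ^ i) w = p + n) (hp' : (F ^ i') w' = p + n') : w = w' := by
  wlog hlt : w ≤ w' generalizing w w' i i' n n'
  · exact (this hw' hw hp' hp (not_le.1 hlt).le).symm
  rcases hlt.eq_or_lt with rfl | hlt
  · rfl
  exfalso
  set ν := ceilCount p
  have hm : Monotone ν := ceilCount_mono p
  have key := ht _ 1 (ceilCount_add_one p) x
  have hx1 : x ≤ s.P F x := (hs.lt_P h x).le
  have hx2 : s.P F x ≤ s.Q F (s.P F x) := (hs.lt_Q h _).le
  -- The hits at `w` and `w'` lie over disjoint parts of the bases (cut at `w'` when both are over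
  -- the same base), and each contributes at least `1` to a total of `1`.
  have one : ∀ {k i : ℕ} {y w z : ℝ} {n : ℤ}, i < k → y ≤ w → w < z → (F ^ i) w = p + n →
      1 ≤ bsum F ν k z - bsum F ν k y := by
    intro k i y w z n hi hy hz hw
    refine (one_le_ceilCount_sub (n := n) ?_ ?_).trans (b := ν ((F ^ i) z) - ν ((F ^ i) y)) ?_
    · rw [← hw]; exact (F ^ i).monotone hy
    · rw [← hw]; exact (F ^ i).strictMono hz
    · unfold bsum
      rw [← Finset.sum_sub_distrib]
      exact Finset.single_le_sum (f := fun j => ν ((F ^ j) z) - ν ((F ^ j) y))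
        (fun j _ => sub_nonneg.2 (hm ((F ^ j).monotone (hy.trans hz.le)))) (Finset.mem_range.2 hi)
  have nna : ∀ {y z}, y ≤ z → ∀ k, 0 ≤ bsum F ν k z - bsum F ν k y := fun hyz k =>
    sub_nonneg.2 (bsum_mono hm k hyz)
  rcases hw with ⟨hi, hw⟩ | ⟨hi, hw⟩ <;> rcases hw' with ⟨hi', hw'⟩ | ⟨hi', hw'⟩
  · have h1 := one hi hw.1 hlt hp
    have h2 := one hi' le_rfl hw'.2 hp'
    have h3 := nna hx2 s.b
    linarith
  · have h1 := one hi hw.1 hw.2 hp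
    have h2 := one hi' hw'.1 hw'.2 hp'
    linarith
  · exact absurd (hlt.trans hw'.2) (not_lt.2 hw.1)
  · have h1 := one hi hw.1 hlt hp
    have h2 := one hi' le_rfl hw'.2 hp'
    have h3 := nna hx1 s.a
    linarith

end Towers

/-! ## Distortion and contraction -/

/-- `φ` is the logarithm of the right derivative of `F`. -/
structure LogDeriv (F : ℝ ≃o ℝ) (φ : ℝ → ℝ) : Prop where
  hasDeriv : ∀ x, HasDerivWithinAt F (Real.exp (φ x)) (Ici x) x
  periodic : ∀ x, φ (x + 1) = φ x

/-- The distortion of the iterates of `F` up to the return times of `s`. -/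
def St.Dist (F : ℝ ≃o ℝ) (φ : ℝ → ℝ) (V : ℝ) (s : St) : Prop :=
  ∀ x w, x ≤ w → (w ≤ s.P F x → ∀ i ≤ s.a, |bsum F φ i w - bsum F φ i x| ≤ V) ∧
    (w ≤ s.Q F x → ∀ i ≤ s.b, |bsum F φ i w - bsum F φ i x| ≤ V)

/-- The oscillation of the logarithmic derivative of the `N`-th iterate is at most `W`. -/
def OscLE (F : ℝ ≃o ℝ) (φ : ℝ → ℝ) (N : ℕ) (W : ℝ) : Prop :=
  ∀ x y, |bsum F φ N y - bsum F φ N x| ≤ W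

/-- The oscillation of the logarithmic derivative of the winner is at most `W`. -/
def St.Win (F : ℝ ≃o ℝ) (φ : ℝ → ℝ) (θ W : ℝ) (s : St) : Prop :=
  (s.Top θ → OscLE F φ s.a W) ∧ (¬ s.Top θ → OscLE F φ s.b W)

section Distortion

variable {F : ℝ ≃o ℝ} {φ : ℝ → ℝ} {θ : ℝ} {s : St}

theorem LogDeriv.bsum_add_int (hφ : LogDeriv F φ) (hF : IsDegOne F) (i : ℕ) (x : ℝ) (m : ℤ) :
    bsum F φ i (x + m) = bsum F φ i x := by
  have := BreakRenorm.bsum_add_int (ν := φ) (c := 0) hF (by simpa using hφ.periodic) i x m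
  simpa using this

theorem LogDeriv.pow (hφ : LogDeriv F φ) (i : ℕ) (x : ℝ) :
    HasDerivWithinAt (F ^ i) (Real.exp (bsum F φ i x)) (Ici x) x := by
  induction i with
  | zero => simpa [bsum] using hasDerivWithinAt_id x (Ici x)
  | succ i ih =>
    have h := (hφ.hasDeriv ((F ^ i) x)).comp x ih (fun y hy => (F ^ i).monotone hy)
    rw [bsum_succ, Real.exp_add, mul_comm, pow_succ']
    exact h

/-- The mean value inequality for right derivatives, since `F ^ i` need not be differentiable at
preimages of breaks. -/
theorem LogDeriv.sub_le (hφ : LogDeriv F φ) {i : ℕ} {x y C : ℝ} (hxy : x ≤ y)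
    (hC : ∀ z ∈ Ico x y, bsum F φ i z ≤ C) :
    (F ^ i) y - (F ^ i) x ≤ Real.exp C * (y - x) := by
  have := image_le_of_deriv_right_le_deriv_boundary (f := fun z => (F ^ i) z)
    (f' := fun z => Real.exp (bsum F φ i z)) (a := x) (b := y) (F ^ i).continuous.continuousOn
    (fun z _ => hφ.pow i z) (B := fun z => (F ^ i) x + Real.exp C * (z - x))
    (B' := fun _ => Real.exp C) (by simp) (by fun_prop)
    (fun z _ => by
      have h := (((hasDerivAt_id z).sub_const x).const_mul (Real.exp C)).const_add ((F ^ i) x)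
      simpa using h.hasDerivWithinAt)
    (fun z hz => Real.exp_le_exp.2 (hC z hz)) (right_mem_Icc.2 hxy)
  linarith

theorem LogDeriv.le_sub (hφ : LogDeriv F φ) {i : ℕ} {x y C : ℝ} (hxy : x ≤ y)
    (hC : ∀ z ∈ Ico x y, C ≤ bsum F φ i z) :
    Real.exp C * (y - x) ≤ (F ^ i) y - (F ^ i) x := by
  have := image_le_of_deriv_right_le_deriv_boundary
    (f := fun z => (F ^ i) x + Real.exp C * (z - x)) (f' := fun _ => Real.exp C)
    (a := x) (b := y) (by fun_prop)
    (fun z _ => by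
      have h := (((hasDerivAt_id z).sub_const x).const_mul (Real.exp C)).const_add ((F ^ i) x)
      simpa using h.hasDerivWithinAt)
    (B := fun z => (F ^ i) z) (B' := fun z => Real.exp (bsum F φ i z))
    (by simp) (F ^ i).continuous.continuousOn
    (fun z _ => hφ.pow i z) (fun z hz => Real.exp_le_exp.2 (hC z hz)) (right_mem_Icc.2 hxy)
  linarith

/-- `F ^ N` commutes with the unit translation, so its derivative has mean `1` over a period and its
logarithm cannot keep one strict sign. An oscillation bound is therefore an absolute bound. -/
theorem OscLE.abs_le {N : ℕ} {W : ℝ} (h : OscLE F φ N W) (hφ : LogDeriv F φ) (hF : IsDegOne F)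
    (y : ℝ) : |bsum F φ N y| ≤ W := by
  have hone : (F ^ N) ((0 : ℝ) + 1) = (F ^ N) 0 + 1 := by
    simpa using hF.pow_add_int N 1 0
  rw [_root_.abs_le]
  constructor
  · by_contra! hlt
    have h1 := hφ.sub_le (i := N) (x := 0) (y := 0 + 1) (C := bsum F φ N y + W) (by simp)
      (fun z _ => by have := (_root_.abs_le.1 (h y z)).2; linarith)
    have h2 : Real.exp (bsum F φ N y + W) < 1 := (Real.exp_lt_exp.2 (by linarith)).trans_eq Real.exp_zero
    linarith
  · by_contra! hlt
    have h1 := hφ.le_sub (i := N) (x := 0) (y := 0 + 1) (C := bsum F φ N y - W) (by simp)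
      (fun z _ => by have := (_root_.abs_le.1 (h z y)).2; linarith)
    have h2 : 1 < Real.exp (bsum F φ N y - W) := Real.one_lt_exp_iff.2 (by linarith)
    linarith

/-- Oscillation from distortion: every orbit can be compared with one over a given base. -/
theorem oscLE_of_cover (hφ : LogDeriv F φ) (hF : IsDegOne F) {g : ℝ → ℝ} {N : ℕ} {V : ℝ}
    (hg : ∀ x w, x ≤ w → w ≤ g x → ∀ i ≤ N, |bsum F φ i w - bsum F φ i x| ≤ V)
    (hid : ∀ x, x ≤ g x)
    (hcov : ∀ x y : ℝ, ∃ i ≤ N, ∃ (n : ℤ) (w : ℝ), (F ^ i) w = y + n ∧ x ≤ w ∧ w ≤ g (g x))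
    (m : ℤ) (hret : ∀ w, (w ≤ (F ^ N) w - m ∧ (F ^ N) w - m ≤ g w) ∨
      ((F ^ N) w - m ≤ w ∧ w ≤ g ((F ^ N) w - m))) :
    OscLE F φ N (3 * V) := by
  intro x y
  -- Up to an integer, `y = F^i w` with `w` in `[x, g (g x)]`. Exchanging the order of `F^i` and
  -- `F^N` compares the sums from `y` and from `w` at the cost of one `V`; moving from `w` to `x`
  -- costs up to two more.
  obtain ⟨i, hi, n, w, hw, h1, h2⟩ := hcov x y
  have e1 : bsum F φ N y = bsum F φ N ((F ^ i) w) := by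
    rw [hw, hφ.bsum_add_int hF]
  have e2 : bsum F φ i ((F ^ N) w) = bsum F φ i ((F ^ N) w - m) := by
    have := hφ.bsum_add_int hF i ((F ^ N) w - m) m
    rwa [sub_add_cancel] at this
  have e3 := bsum_add F φ i N w
  have e4 := bsum_add F φ N i w
  rw [add_comm] at e4
  have b1 : |bsum F φ i ((F ^ N) w - m) - bsum F φ i w| ≤ V := by
    rcases hret w with h | h
    · exact hg _ _ h.1 h.2 i hi
    · rw [abs_sub_comm]; exact hg _ _ h.1 h.2 i hi
  have b2 : |bsum F φ N w - bsum F φ N x| ≤ 2 * V := by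
    have hV : 0 ≤ V := (abs_nonneg _).trans (hg x x le_rfl (hid x) 0 (Nat.zero_le _))
    rcases le_total w (g x) with h | h
    · have := hg x w h1 h N le_rfl
      linarith
    · have a1 := hg x (g x) (hid x) le_rfl N le_rfl
      have a2 := hg (g x) w h h2 N le_rfl
      rw [abs_le] at *
      constructor <;> linarith
  have : bsum F φ N y - bsum F φ N x =
      (bsum F φ i ((F ^ N) w - m) - bsum F φ i w) + (bsum F φ N w - bsum F φ N x) := by
    linarith
  rw [this]
  exact (abs_add_le _ _).trans (by linarith)

theorem St.Tower.exists_pow_eq (ht : s.Tower F) (x y : ℝ) : ∃ (i : ℕ) (n : ℤ) (w : ℝ),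
    (F ^ i) w = y + n ∧
    ((i < s.a ∧ w ∈ Ico x (s.P F x)) ∨ (i < s.b ∧ w ∈ Ico (s.P F x) (s.Q F (s.P F x)))) := by
  obtain ⟨i, n, h⟩ := ht.exists_mem x y
  refine ⟨i, n, (F ^ i).symm (y + n), (F ^ i).apply_symm_apply _, ?_⟩
  have key : ∀ u v, y + n ∈ Ico ((F ^ i) u) ((F ^ i) v) → (F ^ i).symm (y + n) ∈ Ico u v :=
    fun u v h => ⟨(F ^ i).le_symm_apply.2 h.1, (F ^ i).symm_apply_lt.2 h.2⟩
  exact h.imp (fun h => ⟨h.1, key _ _ h.2⟩) (fun h => ⟨h.1, key _ _ h.2⟩)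

/-- As the top wins, `Q < P`, so both bases lie in `[x, P (P x)]`; as `b ≤ a`, the heights of both
towers are within the time `a` of the winner. -/
theorem St.Dist.oscLE_top (hd : s.Dist F φ V) (hφ : LogDeriv F φ) (h : RotOrder F θ)
    (hs : s.Valid θ) (ht : s.Tower F) (htop : s.Top θ) (hab : s.b ≤ s.a) :
    OscLE F φ s.a (3 * V) := by
  have hx1 := fun x => (hs.lt_P h x).le
  have hx2 := fun x => (hs.lt_Q h x).le
  refine oscLE_of_cover hφ h.degOne (g := s.P F) (fun x w h1 h2 => (hd x w h1).1 h2) hx1 ?_ s.m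
    fun w => Or.inl ?_
  · intro x y
    obtain ⟨i, n, w, hw, hc⟩ := ht.exists_pow_eq x y
    have h3 := hs.Q_lt_P h htop (s.P F x)
    rcases hc with ⟨hi, hw1, hw2⟩ | ⟨hi, hw1, hw2⟩
    · exact ⟨i, hi.le, n, w, hw, hw1, hw2.le.trans (hx1 _)⟩
    · exact ⟨i, hi.le.trans hab, n, w, hw, (hx1 x).trans hw1, by linarith⟩
  · rw [pow_a, add_sub_cancel_right]
    exact ⟨hx2 w, (hs.Q_lt_P h htop w).le⟩

theorem St.Dist.oscLE_bot (hd : s.Dist F φ V) (hφ : LogDeriv F φ) (h : RotOrder F θ)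
    (hs : s.Valid θ) (ht : s.Tower F) (htop : ¬ s.Top θ) (hab : s.a ≤ s.b) :
    OscLE F φ s.b (3 * V) := by
  have hx1 := fun x => (hs.lt_P h x).le
  have hx2 := fun x => (hs.lt_Q h x).le
  refine oscLE_of_cover hφ h.degOne (g := s.Q F) (fun x w h1 h2 => (hd x w h1).2 h2) hx2 ?_ s.n
    fun w => Or.inr ?_
  · intro x y
    obtain ⟨i, n, w, hw, hc⟩ := ht.exists_pow_eq x y
    have h3 := hs.P_lt_Q h htop x
    have h4 := (s.Q_mono F) h3
    rcases hc with ⟨hi, hw1, hw2⟩ | ⟨hi, hw1, hw2⟩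
    · exact ⟨i, hi.le.trans hab, n, w, hw, hw1, by linarith [hx2 (s.Q F x)]⟩
    · exact ⟨i, hi.le, n, w, hw, (hx1 x).trans hw1, by linarith⟩
  · rw [pow_b, add_sub_cancel_right]
    have h1 := hx1 (s.R F w)
    rw [s.P_R h.degOne] at h1
    refine ⟨h1, ?_⟩
    have h2 := hs.P_lt_Q h htop (s.R F w)
    rw [s.P_R h.degOne] at h2
    exact h2.le

/-- The bound of the winner passes on to the next state. -/
theorem St.Win.step (hw : s.Win F φ θ (3 * V)) (hd : (s.step θ).Dist F φ V) (hφ : LogDeriv F φ)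
    (h : RotOrder F θ) (hs : s.Valid θ) (ht : (s.step θ).Tower F) :
    (s.step θ).Win F φ θ (3 * V) := by
  have hv := hs.step h.irrational
  by_cases htop : s.Top θ
  · rw [St.step_of_top htop] at *
    -- A winner that keeps winning has the same power as before. If the other side takes over, its
    -- power has just become `a + b`, the larger one, and the covering argument applies afresh.
    refine ⟨fun _ => hw.1 htop, fun h2 => hd.oscLE_bot hφ h hv ht h2 ?_⟩
    simp [St.stepTop]
  · rw [St.step_of_not_top htop] at *
    refine ⟨fun h2 => hd.oscLE_top hφ h hv ht h2 ?_, fun _ => hw.2 htop⟩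
    simp [St.stepBot]

/-- After a change of winner the new winner is the side whose power has just grown, so its tower is
the higher one. No earlier bound is needed, which starts the induction. -/
theorem St.Dist.win_of_switch (hd : (s.step θ).Dist F φ V) (hφ : LogDeriv F φ)
    (h : RotOrder F θ) (hs : s.Valid θ) (ht : (s.step θ).Tower F)
    (hsw : s.Top θ ↔ ¬ (s.step θ).Top θ) : (s.step θ).Win F φ θ (3 * V) := by
  have hv := hs.step h.irrational
  by_cases htop : s.Top θ
  · have h2 := hsw.1 htop
    rw [St.step_of_top htop] at *
    refine ⟨fun h3 => absurd h3 h2, fun h2 => hd.oscLE_bot hφ h hv ht h2 ?_⟩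
    simp [St.stepTop]
  · have h2 := not_not.1 (mt hsw.2 htop)
    rw [St.step_of_not_top htop] at *
    refine ⟨fun h2 => hd.oscLE_top hφ h hv ht h2 ?_, fun h3 => absurd h2 h3⟩
    simp [St.stepBot]

/-! ### Displacements and their contraction -/

/-- The displacements of the return maps of `s`. -/
def St.DispP (F : ℝ ≃o ℝ) (D : ℝ) (s : St) : Prop := ∀ x, s.P F x - x ≤ D

def St.DispQ (F : ℝ ≃o ℝ) (D : ℝ) (s : St) : Prop := ∀ x, s.Q F x - x ≤ D

/-- `P` is either unchanged or replaced by `Q⁻¹ ∘ P`, which is smaller because `Q` moves to the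
right. -/
theorem St.DispP.step {D : ℝ} (hD : s.DispP F D) (h : RotOrder F θ) (hs : s.Valid θ) :
    (s.step θ).DispP F D := by
  by_cases htop : s.Top θ
  · rw [St.step_of_top htop]
    intro x
    have h1 := s.Q_stepTop_P h.degOne x
    have h2 := hs.lt_Q h (s.stepTop.P F x)
    have h3 := hD x
    linarith
  · rw [St.step_of_not_top htop]
    exact hD

theorem St.DispQ.step {D : ℝ} (hD : s.DispQ F D) (h : RotOrder F θ) (hs : s.Valid θ) :
    (s.step θ).DispQ F D := by
  by_cases htop : s.Top θ
  · rw [St.step_of_top htop]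
    exact hD
  · rw [St.step_of_not_top htop]
    intro x
    have h1 := s.P_stepBot_Q h.degOne x
    have h2 := hs.lt_P h (s.stepBot.Q F x)
    have h3 := hD x
    linarith

/-- The factor of contraction that belongs to the distortion `V`. -/
noncomputable def ratio (V : ℝ) : ℝ := (1 + Real.exp (-(3 * V)))⁻¹

theorem ratio_pos (V : ℝ) : 0 < ratio V := by unfold ratio; positivity

theorem ratio_lt_one (V : ℝ) : ratio V < 1 :=
  inv_lt_one_of_one_lt₀ (by linarith [Real.exp_pos (-(3 * V))])

theorem le_ratio_mul {V z D : ℝ} (h : Real.exp (-(3 * V)) * z + z ≤ D) : z ≤ ratio V * D := by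
  unfold ratio
  rw [inv_mul_eq_div, le_div_iff₀ (by positivity)]
  linarith

/-- Let `P'` be the new `P` and `z = P' x - x`. After the switch `P' x < Q x`, while `Q` maps `[x,
P' x)` onto `[Q x, P x)` with derivative at least `exp (-3V)`. Hence `z + exp (-3V) * z ≤ P x - x ≤
D`. -/
theorem St.DispP.contract {D : ℝ} (hD : s.DispP F D) (hφ : LogDeriv F φ) (h : RotOrder F θ)
    (hs : s.Valid θ) (hw : s.Win F φ θ (3 * V)) (htop : s.Top θ) (hnext : ¬ (s.step θ).Top θ) :
    (s.step θ).DispP F (ratio V * D) := by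
  have hv := hs.step h.irrational
  rw [St.step_of_top htop] at *
  intro x
  have h1 := s.Q_stepTop_P h.degOne x
  have h2 := hv.P_lt_Q h hnext x
  rw [St.stepTop_Q] at h2
  have h3 := hv.lt_P h x
  have h4 := hφ.le_sub (i := s.a) (C := -(3 * V)) h3.le
    fun z _ => (abs_le.1 ((hw.1 htop).abs_le hφ h.degOne z)).1
  rw [pow_a, pow_a] at h4
  have h5 := hD x
  exact le_ratio_mul (by linarith)

/-- The mirror image of `St.DispP.contract`. The lower bound of the derivative of `P` comes from the
upper bound for its inverse `R`, a power of `F` up to an integer. -/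
theorem St.DispQ.contract {D : ℝ} (hD : s.DispQ F D) (hφ : LogDeriv F φ) (h : RotOrder F θ)
    (hs : s.Valid θ) (hw : s.Win F φ θ (3 * V)) (htop : ¬ s.Top θ) (hnext : (s.step θ).Top θ) :
    (s.step θ).DispQ F (ratio V * D) := by
  have hv := hs.step h.irrational
  rw [St.step_of_not_top htop] at *
  intro x
  have h1 := s.P_stepBot_Q h.degOne x
  have h2 := hv.Q_lt_P h hnext x
  rw [St.stepBot_P] at h2
  have h3 := hv.lt_Q h x
  have h4 := hφ.sub_le (i := s.b) (C := 3 * V) ((s.P_mono F) h3).le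
    fun z _ => (abs_le.1 ((hw.2 htop).abs_le hφ h.degOne z)).2
  rw [pow_b_P h.degOne, pow_b_P h.degOne] at h4
  have h5 := hD x
  refine le_ratio_mul ?_
  have h6 : Real.exp (-(3 * V)) * (s.stepBot.Q F x - x) ≤
      s.P F (s.stepBot.Q F x) - s.P F x := by
    rw [Real.exp_neg, inv_mul_le_iff₀ (Real.exp_pos _)]
    linarith
  linarith

end Distortion

/-! ## The times of renormalisation -/

/-- One side wins the steps `t, …, t + m - 1` and the other side the step `t + m`. -/
def IsRun (top : ℕ → Prop) (t m : ℕ) : Prop :=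
  (top t ∧ (∀ j < m, top (t + j)) ∧ ¬ top (t + m)) ∨
    (¬ top t ∧ (∀ j < m, ¬ top (t + j)) ∧ top (t + m))

section Runs

variable {top : ℕ → Prop} {t m : ℕ}

theorem IsRun.not (h : IsRun top t m) : IsRun (fun s => ¬ top s) t m := by
  rcases h with ⟨h1, h2, h3⟩ | ⟨h1, h2, h3⟩
  · exact Or.inr ⟨not_not.2 h1, fun j hj => not_not.2 (h2 j hj), h3⟩
  · exact Or.inl ⟨h1, h2, not_not.2 h3⟩

theorem IsRun.pos (h : IsRun top t m) : 1 ≤ m := by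
  rcases Nat.eq_zero_or_pos m with rfl | h0
  · rcases h with ⟨h1, _, h3⟩ | ⟨h1, _, h3⟩
    · exact absurd h1 h3
    · exact absurd h3 h1
  · exact h0

theorem exists_isRun (h1 : ∀ t, ∃ s ≥ t, top s) (h2 : ∀ t, ∃ s ≥ t, ¬ top s) (t : ℕ) :
    ∃ m, IsRun top t m := by
  classical
  by_cases h : top t
  · have hex : ∃ m, ¬ top (t + m) := by
      obtain ⟨s, hs, hs'⟩ := h2 t
      exact ⟨s - t, by rwa [Nat.add_sub_cancel' hs]⟩
    exact ⟨Nat.find hex, Or.inl ⟨h, fun j hj => not_not.1 (Nat.find_min hex hj),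
      Nat.find_spec hex⟩⟩
  · have hex : ∃ m, top (t + m) := by
      obtain ⟨s, hs, hs'⟩ := h1 t
      exact ⟨s - t, by rwa [Nat.add_sub_cancel' hs]⟩
    exact ⟨Nat.find hex, Or.inr ⟨h, fun j hj => Nat.find_min hex hj, Nat.find_spec hex⟩⟩

/-- The switch at the end of a run. -/
theorem IsRun.switch (h : IsRun top t m) :
    t ≤ t + m - 1 ∧ t + m - 1 + 1 = t + m ∧
      ((top t ∧ top (t + m - 1) ∧ ¬ top (t + m)) ∨
        (¬ top t ∧ ¬ top (t + m - 1) ∧ top (t + m))) := by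
  have hm := h.pos
  refine ⟨by omega, by omega, ?_⟩
  rcases h with ⟨h1, h2, h3⟩ | ⟨h1, h2, h3⟩
  · refine Or.inl ⟨h1, ?_, h3⟩
    have := h2 (m - 1) (by omega)
    rwa [← Nat.add_sub_assoc hm] at this
  · refine Or.inr ⟨h1, ?_, h3⟩
    have := h2 (m - 1) (by omega)
    rwa [← Nat.add_sub_assoc hm] at this

/-- Two consecutive runs contain a switch from the top to the bottom. -/
theorem exists_switch_top {τ : ℕ → ℕ} (hτ : ∀ n, ∃ m, IsRun top (τ n) m ∧ τ (n + 1) = τ n + m + 1)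
    (n : ℕ) : ∃ s, τ n ≤ s ∧ s + 1 ≤ τ (n + 2) ∧ top s ∧ ¬ top (s + 1) := by
  obtain ⟨m, hm, h1⟩ := hτ n
  obtain ⟨m', hm', h2⟩ := hτ (n + 1)
  obtain ⟨a1, a2, a3⟩ := hm.switch
  obtain ⟨b1, b2, b3⟩ := hm'.switch
  have h2' : τ (n + 2) = τ (n + 1) + m' + 1 := h2
  rcases a3 with ⟨_, c2, c3⟩ | ⟨_, c2, c3⟩
  · exact ⟨_, a1, by omega, c2, by rwa [a2]⟩
  · rcases b3 with ⟨_, d2, d3⟩ | ⟨d1, d2, d3⟩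
    · exact ⟨_, by omega, by omega, d2, by rwa [b2]⟩
    -- The switch may fall between two renormalisations: the top wins the additional last step `τ n
    -- + m` of the first one and loses the first step of the next.
    · exact ⟨τ n + m, by omega, by omega, c3, by rwa [← h1]⟩

theorem exists_switch_bot {τ : ℕ → ℕ} (hτ : ∀ n, ∃ m, IsRun top (τ n) m ∧ τ (n + 1) = τ n + m + 1)
    (n : ℕ) : ∃ s, τ n ≤ s ∧ s + 1 ≤ τ (n + 2) ∧ ¬ top s ∧ top (s + 1) := by
  obtain ⟨s, h1, h2, h3, h4⟩ := exists_switch_top (top := fun s => ¬ top s) (τ := τ)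
    (fun n => (hτ n).imp fun m hm => ⟨hm.1.not, hm.2⟩) n
  exact ⟨s, h1, h2, h3, not_not.1 h4⟩

end Runs

section Times

variable {F : ℝ ≃o ℝ} {φ : ℝ → ℝ} {θ V : ℝ}

/-- If the top won for ever, the fixed positive number `a θ - m` would be subtracted from `n - b θ`
at every step, and this could not stay positive. -/
theorem exists_ge_not_top (hv : ∀ s, (rst θ s).Valid θ) (t : ℕ) : ∃ s ≥ t, ¬ (rst θ s).Top θ := by
  by_contra! hcon
  have key : ∀ j : ℕ, (rst θ (t + j)).a = (rst θ t).a ∧ (rst θ (t + j)).m = (rst θ t).m ∧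
      (rst θ (t + j)).n - (rst θ (t + j)).b * θ =
        (rst θ t).n - (rst θ t).b * θ - j * ((rst θ t).a * θ - (rst θ t).m) := by
    intro j
    induction j with
    | zero => simp
    | succ j ih =>
      obtain ⟨h1, h2, h3⟩ := ih
      have : rst θ (t + (j + 1)) = (rst θ (t + j)).stepTop :=
        St.step_of_top (hcon (t + j) (by omega))
      rw [this]
      refine ⟨h1, h2, ?_⟩
      simp only [St.stepTop, h1, h2] at h3 ⊢
      push_cast at h3 ⊢
      linarith
  obtain ⟨j, hj⟩ := exists_nat_gt
    (((rst θ t).n - (rst θ t).b * θ) / ((rst θ t).a * θ - (rst θ t).m))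
  have h1 := (hv t).q_pos
  have h2 := (hv (t + j)).p_pos
  rw [(key j).2.2] at h2
  rw [div_lt_iff₀ h1] at hj
  linarith

theorem exists_ge_top (hv : ∀ s, (rst θ s).Valid θ) (t : ℕ) :
    ∃ s ≥ t, (rst θ s).Top θ := by
  by_contra! hcon
  have key : ∀ j : ℕ, (rst θ (t + j)).b = (rst θ t).b ∧ (rst θ (t + j)).n = (rst θ t).n ∧
      (rst θ (t + j)).a * θ - (rst θ (t + j)).m =
        (rst θ t).a * θ - (rst θ t).m - j * ((rst θ t).n - (rst θ t).b * θ) := by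
    intro j
    induction j with
    | zero => simp
    | succ j ih =>
      obtain ⟨h1, h2, h3⟩ := ih
      have : rst θ (t + (j + 1)) = (rst θ (t + j)).stepBot :=
        St.step_of_not_top (hcon (t + j) (by omega))
      rw [this]
      refine ⟨h1, h2, ?_⟩
      simp only [St.stepBot, h1, h2] at h3 ⊢
      push_cast at h3 ⊢
      linarith
  obtain ⟨j, hj⟩ := exists_nat_gt
    (((rst θ t).a * θ - (rst θ t).m) / ((rst θ t).n - (rst θ t).b * θ))
  have h1 := (hv t).p_pos
  have h2 := (hv (t + j)).q_pos
  rw [(key j).2.2] at h2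
  rw [div_lt_iff₀ h1] at hj
  linarith

/-- The rotation by `θ` determines when a side wins. -/
def topSeq (θ : ℝ) (s : ℕ) : Prop := (rst θ s).Top θ

theorem exists_isRun_topSeq (hv : ∀ s, (rst θ s).Valid θ) (t : ℕ) :
    ∃ m, IsRun (topSeq θ) t m :=
  exists_isRun (exists_ge_top hv) (exists_ge_not_top hv) t

/-- `τ` enumerates the times of renormalisation. -/
def IsTimes (θ : ℝ) (τ : ℕ → ℕ) : Prop :=
  ∀ n, ∃ m, IsRun (topSeq θ) (τ n) m ∧ τ (n + 1) = τ n + m + 1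

theorem IsTimes.le (hτ : IsTimes θ τ) (n : ℕ) : n ≤ τ n := by
  induction n with
  | zero => exact Nat.zero_le _
  | succ n ih =>
    obtain ⟨m, _, h⟩ := hτ n
    omega


theorem dispP_le_one (h : RotOrder F θ) (hv : ∀ s, (rst θ s).Valid θ) (s : ℕ) :
    (rst θ s).DispP F 1 := by
  induction s with
  | zero =>
    intro x
    have h1 : St.Q F (rst θ 0) (St.P F (rst θ 0) x) = x + 1 := by
      unfold St.Q St.P
      rw [h.degOne.gm_gm]
      simp [rst, gm]
    have := (hv 0).lt_Q h (St.P F (rst θ 0) x)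
    linarith
  | succ s ih => exact ih.step h (hv s)

theorem dispQ_le_one (h : RotOrder F θ) (hv : ∀ s, (rst θ s).Valid θ) (s : ℕ) :
    (rst θ s).DispQ F 1 := by
  induction s with
  | zero =>
    intro x
    have h1 : St.P F (rst θ 0) (St.Q F (rst θ 0) x) = x + 1 := by
      unfold St.Q St.P
      rw [h.degOne.gm_gm]
      simp [rst, gm]
    have := (hv 0).lt_P h (St.Q F (rst θ 0) x)
    linarith
  | succ s ih => exact ih.step h (hv s)

theorem dispP_mono (h : RotOrder F θ) (hv : ∀ s, (rst θ s).Valid θ) {s t : ℕ} (hst : s ≤ t)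
    {D : ℝ} (hD : (rst θ s).DispP F D) : (rst θ t).DispP F D := by
  induction t, hst using Nat.le_induction with
  | base => exact hD
  | succ t _ ih => exact ih.step h (hv t)

theorem dispQ_mono (h : RotOrder F θ) (hv : ∀ s, (rst θ s).Valid θ) {s t : ℕ} (hst : s ≤ t)
    {D : ℝ} (hD : (rst θ s).DispQ F D) : (rst θ t).DispQ F D := by
  induction t, hst using Nat.le_induction with
  | base => exact hD
  | succ t _ ih => exact ih.step h (hv t)

/-- The displacements contract over two renormalisations. -/
theorem disp_contract (hφ : LogDeriv F φ) (h : RotOrder F θ) (hv : ∀ s, (rst θ s).Valid θ)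
    {τ : ℕ → ℕ} (hτ : IsTimes θ τ) (n : ℕ)
    (hw : ∀ s ≥ τ n, (rst θ s).Win F φ θ (3 * V)) {D : ℝ}
    (hP : (rst θ (τ n)).DispP F D) (hQ : (rst θ (τ n)).DispQ F D) :
    (rst θ (τ (n + 2))).DispP F (ratio V * D) ∧ (rst θ (τ (n + 2))).DispQ F (ratio V * D) := by
  obtain ⟨s, h1, h2, h3, h4⟩ := exists_switch_top hτ n
  obtain ⟨s', h1', h2', h3', h4'⟩ := exists_switch_bot hτ n
  exact ⟨dispP_mono h hv h2 ((dispP_mono h hv h1 hP).contract hφ h (hv s) (hw s h1) h3 h4),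
    dispQ_mono h hv h2' ((dispQ_mono h hv h1' hQ).contract hφ h (hv s') (hw s' h1') h3' h4')⟩

/-- The bound holds right after the first change of winner beyond `t₀` and is inherited from then
on. -/
theorem exists_win (hφ : LogDeriv F φ) (h : RotOrder F θ) (hv : ∀ s, (rst θ s).Valid θ) {t₀ : ℕ}
    (hd : ∀ s ≥ t₀, (rst θ s).Dist F φ V) : ∃ t₁, ∀ s ≥ t₁, (rst θ s).Win F φ θ (3 * V) := by
  obtain ⟨m, hm⟩ := exists_isRun_topSeq hv t₀
  obtain ⟨a1, a2, a3⟩ := hm.switch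
  have hsw : (rst θ (t₀ + m - 1)).Top θ ↔ ¬ ((rst θ (t₀ + m - 1)).step θ).Top θ := by
    change topSeq θ (t₀ + m - 1) ↔ ¬ topSeq θ (t₀ + m - 1 + 1)
    rw [a2]
    tauto
  refine ⟨t₀ + m - 1 + 1, fun s hs => ?_⟩
  induction s, hs using Nat.le_induction with
  | base =>
    exact St.Dist.win_of_switch (hd (t₀ + m - 1 + 1) (by omega)) hφ h (hv _)
      (rst_tower h.degOne (t₀ + m - 1 + 1)) hsw
  | succ s hs ih =>
    exact ih.step (hd (s + 1) (by omega)) hφ h (hv s) (rst_tower h.degOne (s + 1))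

/-- The displacements at the times of renormalisation decrease exponentially, at a rate that
depends only on the final bound of the distortion. -/
theorem disp_decay (hφ : LogDeriv F φ) (h : RotOrder F θ) (hv : ∀ s, (rst θ s).Valid θ)
    {τ : ℕ → ℕ} (hτ : IsTimes θ τ) {t₀ : ℕ} (hd : ∀ s ≥ t₀, (rst θ s).Dist F φ V) :
    ∃ C : ℝ, 0 < C ∧ ∀ n, (rst θ (τ n)).DispP F (C * Real.sqrt (ratio V) ^ n) ∧
      (rst θ (τ n)).DispQ F (C * Real.sqrt (ratio V) ^ n) := by
  obtain ⟨n₀, hw⟩ := exists_win hφ h hv hd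
  set μ := Real.sqrt (ratio V) with hμ
  have hμ0 : 0 < μ := Real.sqrt_pos.2 (ratio_pos V)
  have hμ1 : μ ≤ 1 := Real.sqrt_le_one.2 (ratio_lt_one V).le
  have hsq : μ ^ 2 = ratio V := Real.sq_sqrt (ratio_pos V).le
  -- With this constant the claimed bound is at least `1` for `n < n₀ + 2`, where displacements are
  -- at most `1` anyway. From there the induction goes in steps of two, each gaining `μ ^ 2 = ratio
  -- V`.
  refine ⟨(μ ^ (n₀ + 1))⁻¹, by positivity, fun n => ?_⟩
  induction n using Nat.strong_induction_on with
  | _ n ih =>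
    by_cases hn : n < n₀ + 2
    · have h1 : 1 ≤ (μ ^ (n₀ + 1))⁻¹ * μ ^ n := by
        rw [inv_mul_eq_div, one_le_div (by positivity)]
        exact pow_le_pow_of_le_one hμ0.le hμ1 (by omega)
      exact ⟨fun x => (dispP_le_one h hv _ x).trans h1, fun x => (dispQ_le_one h hv _ x).trans h1⟩
    · obtain ⟨k, rfl⟩ : ∃ k, n = k + 2 := ⟨n - 2, by omega⟩
      obtain ⟨i1, i2⟩ := ih k (by omega)
      have h2 := disp_contract hφ h hv hτ k
        (fun s hs => hw s (by have := hτ.le k; omega)) i1 i2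
      have h3 : ratio V * ((μ ^ (n₀ + 1))⁻¹ * μ ^ k) = (μ ^ (n₀ + 1))⁻¹ * μ ^ (k + 2) := by
        rw [← hsq]; ring
      rwa [h3] at h2

/-- The derivatives of the return maps at the times of renormalisation are bounded. -/
theorem exists_deriv_bound (hφ : LogDeriv F φ) (h : RotOrder F θ) (hv : ∀ s, (rst θ s).Valid θ)
    (hd : ∀ s, (rst θ s).Dist F φ V) {τ : ℕ → ℕ} (hτ : IsTimes θ τ) :
    ∃ t₁, ∀ n, t₁ ≤ n → ∀ x, |bsum F φ (rst θ (τ n)).a x| ≤ 6 * V ∧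
      |bsum F φ (rst θ (τ n)).b x| ≤ 6 * V := by
  obtain ⟨t₁, hw⟩ := exists_win (V := V) (t₀ := 0) hφ h hv (fun s _ => hd s)
  refine ⟨t₁ + 1, fun n hn x => ?_⟩
  obtain ⟨k, rfl⟩ : ∃ k, n = k + 1 := ⟨n - 1, by omega⟩
  obtain ⟨m, hm, hk⟩ := hτ k
  obtain ⟨a1, a2, a3⟩ := hm.switch
  have hle := hτ.le k
  have w1 := hw (τ k + m - 1) (by omega)
  have w2 := hw (τ k + m) (by omega)
  have hV : 0 ≤ V := (abs_nonneg _).trans ((hd 0 0 0 le_rfl).1 ((hv 0).lt_P h 0).le 0 (Nat.zero_le _))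
  set s := rst θ (τ k + m - 1) with hs
  have e1 : rst θ (τ k + m) = s.step θ := by rw [← a2]; rfl
  have e2 : rst θ (τ (k + 1)) = (rst θ (τ k + m)).step θ := by rw [hk]; rfl
  -- The last two steps before `τ (k + 1)` are won by different sides, so both powers are bounded by
  -- `3 * V` as winners; the last step adds them, hence `6 * V`.
  have add : ∀ i j : ℕ, (∀ y, |bsum F φ i y| ≤ 3 * V) → (∀ y, |bsum F φ j y| ≤ 3 * V) →
      |bsum F φ (i + j) x| ≤ 6 * V := fun i j hi hj => by
    rw [bsum_add]
    exact (abs_add_le _ _).trans (by linarith [hi x, hj ((F ^ i) x)])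
  rcases a3 with ⟨_, c2, c3⟩ | ⟨_, c2, c3⟩
  · have b1 := fun y => (w1.1 c2).abs_le hφ h.degOne y
    have b2 := fun y => (w2.2 c3).abs_le hφ h.degOne y
    have e3 : (rst θ (τ k + m)).a = s.a := by rw [e1, St.step_of_top c2]; rfl
    rw [e2, St.step_of_not_top c3]
    change |bsum F φ ((rst θ (τ k + m)).a + (rst θ (τ k + m)).b) x| ≤ _ ∧
      |bsum F φ (rst θ (τ k + m)).b x| ≤ _
    rw [e3]
    exact ⟨add _ _ b1 b2, (b2 x).trans (by linarith)⟩
  · have b1 := fun y => (w1.2 c2).abs_le hφ h.degOne y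
    have b2 := fun y => (w2.1 c3).abs_le hφ h.degOne y
    have e3 : (rst θ (τ k + m)).b = s.b := by rw [e1, St.step_of_not_top c2]; rfl
    rw [e2, St.step_of_top c3]
    change |bsum F φ (rst θ (τ k + m)).a x| ≤ _ ∧
      |bsum F φ ((rst θ (τ k + m)).a + (rst θ (τ k + m)).b) x| ≤ _
    rw [e3]
    exact ⟨(b2 x).trans (by linarith), add _ _ b2 b1⟩

end Times

/-! ## Rauzy induction and the subtractive algorithm -/

/-- The length of the interval of the induced map. -/
noncomputable def St.len (F : ℝ ≃o ℝ) (s : St) : ℝ := s.Q F (s.P F 0)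

open Classical in
/-- The induced map on `[0, len)`. -/
noncomputable def St.map (F : ℝ ≃o ℝ) (s : St) (x : ℝ) : ℝ :=
  if x < s.P F 0 then s.Q F x else s.R F x

/-- The induced map, rescaled to `[0,1)`. -/
noncomputable def St.scaled (F : ℝ ≃o ℝ) (s : St) (x : ℝ) : ℝ := s.map F (s.len F * x) / s.len F

theorem firstReturn_of_one {f : ℝ → ℝ} {l x : ℝ} (h : f x ∈ Ico 0 l) : firstReturn f l x = f x := by
  have : returnTime f l x = 1 := by
    unfold returnTime
    exact IsLeast.csInf_eq ⟨⟨le_rfl, by simpa using h⟩, fun n hn => hn.1⟩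
  rw [firstReturn, this, Function.iterate_one]

theorem firstReturn_of_two {f : ℝ → ℝ} {l x : ℝ} (h1 : f x ∉ Ico 0 l) (h2 : f (f x) ∈ Ico 0 l) :
    firstReturn f l x = f (f x) := by
  have : returnTime f l x = 2 := by
    unfold returnTime
    refine IsLeast.csInf_eq ⟨⟨by norm_num, by simpa using h2⟩, fun n hn => ?_⟩
    by_contra! hlt
    have : n = 1 := by have := hn.1; omega
    subst this
    exact h1 (by simpa using hn.2)
  rw [firstReturn, this]
  rfl

section Rauzy

variable {F : ℝ ≃o ℝ} {θ : ℝ} {s : St} {f : ℝ → ℝ}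

theorem St.Valid.P_pos (hs : s.Valid θ) (h : RotOrder F θ) : 0 < s.P F 0 := hs.lt_P h 0

theorem St.Valid.Q_pos (hs : s.Valid θ) (h : RotOrder F θ) : 0 < s.Q F 0 := hs.lt_Q h 0

theorem St.Valid.P_lt_len (hs : s.Valid θ) (h : RotOrder F θ) : s.P F 0 < s.len F := hs.lt_Q h _

theorem St.Valid.Q_lt_len (hs : s.Valid θ) (h : RotOrder F θ) : s.Q F 0 < s.len F := by
  unfold St.len
  exact (s.Q_mono F) (hs.P_pos h)

theorem St.Valid.len_pos (hs : s.Valid θ) (h : RotOrder F θ) : 0 < s.len F :=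
  (hs.P_pos h).trans (hs.P_lt_len h)

theorem St.map_of_lt {x : ℝ} (hx : x < s.P F 0) : s.map F x = s.Q F x := if_pos hx

theorem St.map_of_le {x : ℝ} (hx : s.P F 0 ≤ x) : s.map F x = s.R F x := if_neg (not_lt.2 hx)

theorem St.R_P_zero (h : RotOrder F θ) : s.R F (s.P F 0) = 0 := s.R_P h.degOne 0

theorem topSing_eq (hs : s.Valid θ) (h : RotOrder F θ) (hf : EqOn f (s.scaled F) (Ico 0 1)) :
    topSing f = s.P F 0 / s.len F := by
  have hl := hs.len_pos h
  have hset : {x | x ∈ Ico (0 : ℝ) 1 ∧ f x = 0} = {s.P F 0 / s.len F} := by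
    ext x
    simp only [mem_ofPred_eq, mem_singleton_iff]
    constructor
    · rintro ⟨hx, hx0⟩
      rw [hf hx, St.scaled, div_eq_zero_iff] at hx0
      replace hx0 := hx0.resolve_right hl.ne'
      rcases lt_or_ge (s.len F * x) (s.P F 0) with hlt | hge
      · rw [St.map_of_lt hlt] at hx0
        have h1 := hs.lt_Q h (s.len F * x)
        have h2 := mul_nonneg hl.le hx.1
        linarith
      · rw [St.map_of_le hge, ← St.R_P_zero h] at hx0
        rw [eq_div_iff hl.ne', mul_comm]
        exact (s.R_mono F).injective hx0
    · rintro rfl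
      have hmem : s.P F 0 / s.len F ∈ Ico (0 : ℝ) 1 :=
        ⟨(div_pos (hs.P_pos h) hl).le, (div_lt_one hl).2 (hs.P_lt_len h)⟩
      refine ⟨hmem, ?_⟩
      rw [hf hmem, St.scaled, mul_div_cancel₀ _ hl.ne', St.map_of_le le_rfl, St.R_P_zero h,
        zero_div]
  rw [topSing, hset, csInf_singleton]

theorem botSing_eq (hs : s.Valid θ) (h : RotOrder F θ) (hf : EqOn f (s.scaled F) (Ico 0 1)) :
    botSing f = s.Q F 0 / s.len F := by
  rw [botSing, hf (left_mem_Ico.2 one_pos), St.scaled, mul_zero, St.map_of_lt (hs.P_pos h)]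

theorem topWins_iff (hs : s.Valid θ) (h : RotOrder F θ) (hf : EqOn f (s.scaled F) (Ico 0 1)) :
    TopWins f ↔ s.Top θ := by
  rw [TopWins, topSing_eq hs h hf, botSing_eq hs h hf, div_lt_div_iff_of_pos_right (hs.len_pos h)]
  constructor
  · intro h1
    by_contra h2
    exact absurd (hs.P_lt_Q h h2 0) (not_lt.2 h1.le)
  · exact fun h1 => hs.Q_lt_P h h1 0

theorem botWins_iff (hs : s.Valid θ) (h : RotOrder F θ) (hf : EqOn f (s.scaled F) (Ico 0 1)) :
    BotWins f ↔ ¬ s.Top θ := by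
  rw [BotWins, topSing_eq hs h hf, botSing_eq hs h hf, div_lt_div_iff_of_pos_right (hs.len_pos h)]
  constructor
  · intro h1 h2
    exact absurd (hs.Q_lt_P h h2 0) (not_lt.2 h1.le)
  · exact fun h1 => hs.P_lt_Q h h1 0

theorem scaled_div (hs : s.Valid θ) (h : RotOrder F θ) (hf : EqOn f (s.scaled F) (Ico 0 1))
    {z : ℝ} (hz : z ∈ Ico 0 (s.len F)) : f (z / s.len F) = s.map F z / s.len F := by
  have hl := hs.len_pos h
  rw [hf ⟨div_nonneg hz.1 hl.le, (div_lt_one hl).2 hz.2⟩, St.scaled, mul_div_cancel₀ _ hl.ne']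

/-- The return time is `1` or `2`: a point of the shorter interval leaves it only under `Q`, into
the part cut off, from where `R` brings it back. This is the composition `R ∘ Q` of the step,
applied on the loser's side. -/
theorem rauzy_eqOn (hs : s.Valid θ) (h : RotOrder F θ) (hf : EqOn f (s.scaled F) (Ico 0 1)) :
    EqOn (rauzy f) ((s.step θ).scaled F) (Ico 0 1) := by
  intro x hx
  have hl := hs.len_pos h
  have hv := hs.step h.irrational
  have hl' := hv.len_pos h
  set l := s.len F with hldef
  set l' := (s.step θ).len F with hl'def
  suffices hmain : max (topSing f) (botSing f) = l' / l ∧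
      firstReturn f (l' / l) (l' * x / l) = (s.step θ).map F (l' * x) / l by
    rw [rauzy, hmain.1, show l' / l * x = l' * x / l by ring, hmain.2, St.scaled, ← hl'def]
    field_simp
  have hz : l' * x ∈ Ico 0 l' := ⟨mul_nonneg hl'.le hx.1, mul_lt_of_lt_one_right hl' hx.2⟩
  set z := l' * x
  rw [topSing_eq hs h hf, botSing_eq hs h hf]
  have mem : ∀ {y}, y ∈ Ico 0 l' → y / l ∈ Ico 0 (l' / l) := fun hy =>
    ⟨div_nonneg hy.1 hl.le, (div_lt_div_iff_of_pos_right hl).2 hy.2⟩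
  have nmem : ∀ {y}, l' ≤ y → y / l ∉ Ico 0 (l' / l) := fun hy hmem =>
    absurd ((div_lt_div_iff_of_pos_right hl).1 hmem.2) (not_lt.2 hy)
  have P0 := hs.P_pos h
  have Pl := hs.P_lt_len h
  have Q0 := hs.Q_pos h
  have Ql := hs.Q_lt_len h
  by_cases htop : s.Top θ
  · have hPQ := hs.Q_lt_P h htop 0
    rw [St.step_of_top htop] at hv ⊢
    have e1 : l' = s.P F 0 := by
      rw [hl'def, St.step_of_top htop]
      exact s.Q_stepTop_P h.degOne 0
    have e2 := s.Q_stepTop_P h.degOne 0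
    refine ⟨by rw [e1, max_eq_left (by gcongr)], ?_⟩
    have hzl : z ∈ Ico 0 l := ⟨hz.1, hz.2.trans (e1 ▸ Pl)⟩
    have f1 : f (z / l) = s.Q F z / l := by
      rw [scaled_div hs h hf hzl, St.map_of_lt (hz.2.trans_eq e1)]
    have hQz := hs.lt_Q h z
    rcases lt_or_ge z (s.stepTop.P F 0) with hlt | hge
    · rw [firstReturn_of_one, f1, St.map_of_lt hlt]
      · rfl
      · rw [f1]
        refine mem ⟨hz.1.trans hQz.le, ?_⟩
        rw [e1, ← e2]
        exact (s.Q_mono F) hlt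
    · have h1 : s.P F 0 ≤ s.Q F z := by rw [← e2]; exact (s.Q_mono F).monotone hge
      have h2 : s.Q F z < l := (s.Q_mono F) (hz.2.trans_eq e1)
      have f2 : f (f (z / l)) = s.stepTop.R F z / l := by
        rw [f1, scaled_div hs h hf ⟨P0.le.trans h1, h2⟩, St.map_of_le h1, s.stepTop_R h.degOne]
      rw [firstReturn_of_two, f2, St.map_of_le hge]
      · rw [f1]; exact nmem (e1 ▸ h1)
      · rw [f2]
        refine mem ⟨?_, ?_⟩
        · rw [s.stepTop_R h.degOne, ← St.R_P_zero h (s := s)]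
          exact (s.R_mono F).monotone h1
        · have h3 := hv.lt_P h (s.stepTop.R F z)
          rw [s.stepTop.P_R h.degOne] at h3
          exact h3.trans hz.2
  · have hPQ := hs.P_lt_Q h htop 0
    rw [St.step_of_not_top htop] at hv ⊢
    have e1 : l' = s.Q F 0 := by
      rw [hl'def, St.step_of_not_top htop, St.len, St.Q_P h.degOne, St.stepBot_P,
        s.P_stepBot_Q h.degOne 0]
    refine ⟨by rw [e1, max_eq_right (by gcongr)], ?_⟩
    have hzl : z ∈ Ico 0 l := ⟨hz.1, hz.2.trans (e1 ▸ Ql)⟩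
    rcases lt_or_ge z (s.P F 0) with hlt | hge
    · have f1 : f (z / l) = s.Q F z / l := by
        rw [scaled_div hs h hf hzl, St.map_of_lt hlt]
      have h1 : s.Q F 0 ≤ s.Q F z := (s.Q_mono F).monotone hz.1
      have h2 : s.Q F z < l := (s.Q_mono F) hlt
      have f2 : f (f (z / l)) = s.stepBot.Q F z / l := by
        rw [f1, scaled_div hs h hf ⟨Q0.le.trans h1, h2⟩, St.map_of_le (hPQ.le.trans h1),
          s.stepBot_Q h.degOne]
      rw [firstReturn_of_two, f2, St.map_of_lt (s := s.stepBot) (by rwa [St.stepBot_P])]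
      · rw [f1]; exact nmem (e1 ▸ h1)
      · rw [f2]
        refine mem ⟨hz.1.trans (hv.lt_Q h z).le, ?_⟩
        rw [e1, ← s.P_stepBot_Q h.degOne 0, ← St.stepBot_P, ← St.Q_P h.degOne]
        exact (s.stepBot.Q_mono F) hlt
    · have f1 : f (z / l) = s.R F z / l := by
        rw [scaled_div hs h hf hzl, St.map_of_le hge]
      rw [firstReturn_of_one, f1, St.map_of_le (s := s.stepBot) (by rwa [St.stepBot_P]),
        St.stepBot_R]
      rw [f1]
      refine mem ⟨?_, ?_⟩
      · rw [← St.R_P_zero h (s := s)]; exact (s.R_mono F).monotone hge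
      · have h3 := hs.lt_P h (s.R F z)
        rw [s.P_R h.degOne] at h3
        exact h3.trans hz.2


theorem rauzy_iterate_eqOn (h : RotOrder F θ) (hv : ∀ s, (rst θ s).Valid θ)
    (hf : EqOn f ((rst θ 0).scaled F) (Ico 0 1)) (t : ℕ) :
    EqOn (rauzy^[t] f) ((rst θ t).scaled F) (Ico 0 1) := by
  induction t with
  | zero => exact hf
  | succ t ih =>
    rw [Function.iterate_succ_apply']
    exact rauzy_eqOn (hv t) h ih

theorem isSwitch_iff (h : RotOrder F θ) (hv : ∀ s, (rst θ s).Valid θ)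
    (hf : EqOn f ((rst θ 0).scaled F) (Ico 0 1)) (t m : ℕ) :
    IsSwitch (rauzy^[t] f) m ↔ IsRun (topSeq θ) t m := by
  have h1 : ∀ j, TopWins (rauzy^[j] (rauzy^[t] f)) ↔ topSeq θ (t + j) := fun j => by
    rw [← Function.iterate_add_apply, add_comm j]
    exact topWins_iff (hv _) h (rauzy_iterate_eqOn h hv hf _)
  have h2 : ∀ j, BotWins (rauzy^[j] (rauzy^[t] f)) ↔ ¬ topSeq θ (t + j) := fun j => by
    rw [← Function.iterate_add_apply, add_comm j]
    exact botWins_iff (hv _) h (rauzy_iterate_eqOn h hv hf _)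
  have h3 := h1 0
  have h4 := h2 0
  simp only [Function.iterate_zero, id, add_zero] at h3 h4
  unfold IsSwitch IsRun
  simp only [h1, h2, h3, h4]

theorem IsRun.unique {top : ℕ → Prop} {t m m' : ℕ} (h : IsRun top t m) (h' : IsRun top t m') :
    m = m' := by
  wlog hlt : m < m' generalizing m m'
  · rcases (not_lt.1 hlt).eq_or_lt with e | e
    · exact e.symm
    · exact (this h' h e).symm
  exfalso
  rcases h with ⟨h1, _, h3⟩ | ⟨h1, _, h3⟩ <;> rcases h' with ⟨h1', h2', _⟩ | ⟨h1', h2', _⟩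
  · exact h3 (h2' m hlt)
  · exact h1' h1
  · exact h1 h1'
  · exact h2' m hlt h3

/-- The renormalisations of `f` are its Rauzy inductions at the times of renormalisation. -/
theorem exists_times (h : RotOrder F θ) (hv : ∀ s, (rst θ s).Valid θ)
    (hf : EqOn f ((rst θ 0).scaled F) (Ico 0 1)) :
    (∀ n, IsRenormalisable (renorm^[n] f)) ∧ ∃ τ : ℕ → ℕ, IsTimes θ τ ∧
      ∀ n, EqOn (renorm^[n] f) ((rst θ (τ n)).scaled F) (Ico 0 1) := by
  choose m hm using fun t => exists_isRun_topSeq hv t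
  let τ : ℕ → ℕ := fun n => Nat.rec 0 (fun _ t => t + m t + 1) n
  -- The length of a run is unique, so the infimum in `renorm` is taken over a singleton and is not
  -- a default value.
  have hrenorm : ∀ t, renorm (rauzy^[t] f) = rauzy^[t + m t + 1] f := fun t => by
    have hset : {j | IsSwitch (rauzy^[t] f) j} = {m t} := by
      ext j
      simp only [mem_ofPred_eq, mem_singleton_iff, isSwitch_iff h hv hf]
      exact ⟨fun hj => hj.unique (hm t), fun hj => hj ▸ hm t⟩
    rw [renorm, hset, csInf_singleton, ← Function.iterate_add_apply]
    congr 1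
    omega
  have hiter : ∀ n, renorm^[n] f = rauzy^[τ n] f := fun n => by
    induction n with
    | zero => rfl
    | succ n ih => rw [Function.iterate_succ_apply', ih, hrenorm]
  refine ⟨fun n => ?_, τ, fun n => ⟨m (τ n), hm _, rfl⟩, fun n => ?_⟩
  · rw [hiter]
    exact ⟨m (τ n), (isSwitch_iff h hv hf _ _).2 (hm _)⟩
  · rw [hiter]
    exact rauzy_iterate_eqOn h hv hf _

/-- The circle map, cut at `0`, is the initial state. -/
theorem cutMap_eqOn {T : UnitAddCircle ≃ₜ UnitAddCircle} (hF : IsDegOne F)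
    (hT : ∀ x : ℝ, ((F x : ℝ) : UnitAddCircle) = T (x : UnitAddCircle)) (h0 : 0 < F 0)
    (h1 : F 0 < 1) : EqOn (cutMap T) ((rst θ 0).scaled F) (Ico 0 1) := by
  intro x hx
  have e1 : cutMap T x = Int.fract (F x) := by
    rw [cutMap, ← hT, AddCircle.coe_equivIco_mk_apply]
    simp
  have hP : (rst θ 0).P F 0 = F.symm 0 + 1 := by
    simp [St.P, gm, rst]
    rfl
  have hlen : (rst θ 0).len F = 1 := by
    rw [St.len, hP]
    have : F (F.symm 0 + 1) = 1 := by rw [hF]; simp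
    simpa [St.Q, gm, rst] using this
  rw [e1, St.scaled, hlen, one_mul, div_one]
  have hF1 : F (F.symm 0 + 1) = 1 := by rw [hF]; simp
  have hx1 : F x < 2 := by
    have := F.strictMono hx.2
    have e := hF 0
    rw [zero_add] at e
    linarith
  have hx0 : 0 ≤ F x := h0.le.trans (F.monotone hx.1)
  rcases lt_or_ge x (F.symm 0 + 1) with hlt | hge
  · rw [St.map_of_lt (hP ▸ hlt)]
    have : F x < 1 := by rw [← hF1]; exact F.strictMono hlt
    rw [Int.fract_eq_self.2 ⟨hx0, this⟩]
    simp [St.Q, gm, rst]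
  · rw [St.map_of_le (hP ▸ hge)]
    have : 1 ≤ F x := by rw [← hF1]; exact F.monotone hge
    have e2 : Int.fract (F x) = F x - 1 := by
      rw [Int.fract_eq_iff]
      exact ⟨by linarith, by linarith, 1, by push_cast; ring⟩
    rw [e2]
    simp [St.R, gm, rst]
    ring

end Rauzy

/-! ## Functions of class `C^r` -/

/-- `f` is Hölder continuous of exponent `γ` on `s`. -/
def HolR (γ : ℝ) (f : ℝ → ℝ) (s : Set ℝ) : Prop :=
  ∃ C : ℝ, 0 ≤ C ∧ ∀ x ∈ s, ∀ y ∈ s, |f x - f y| ≤ C * |x - y| ^ γ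

/-- `f` has `n` derivatives on `s` and the last one is continuous and Hölder of exponent `γ`. -/
def CrOn (γ : ℝ) : ℕ → (ℝ → ℝ) → Set ℝ → Prop
  | 0, f, s => ContinuousOn f s ∧ HolR γ f s
  | n + 1, f, s => ∃ f' : ℝ → ℝ, (∀ x ∈ s, HasDerivWithinAt f (f' x) s x) ∧ CrOn γ n f' s

section Cr

variable {γ : ℝ} {n : ℕ} {f g : ℝ → ℝ} {s t : Set ℝ} {a b : ℝ}

theorem holderOnWith_iff (hγ : 0 ≤ γ) :
    (∃ C, HolderOnWith C γ.toNNReal f s) ↔ HolR γ f s := by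
  have key : ∀ (C : ℝ), 0 ≤ C → ∀ x y : ℝ, (edist (f x) (f y) ≤ (C.toNNReal : ℝ≥0∞) *
      edist x y ^ (γ.toNNReal : ℝ) ↔ |f x - f y| ≤ C * |x - y| ^ γ) := by
    intro C hC x y
    rw [edist_dist, edist_dist, Real.coe_toNNReal _ hγ,
      ENNReal.ofReal_rpow_of_nonneg dist_nonneg hγ, Real.dist_eq, Real.dist_eq,
      ← ENNReal.ofReal, ← ENNReal.ofReal_mul hC, ENNReal.ofReal_le_ofReal_iff]
    positivity
  constructor
  · rintro ⟨C, hC⟩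
    refine ⟨C, C.2, fun x hx y hy => (key C C.2 x y).1 ?_⟩
    simpa using hC x hx y hy
  · rintro ⟨C, hC, h⟩
    exact ⟨C.toNNReal, fun x hx y hy => (key C hC x y).2 (h x hx y hy)⟩

theorem CrOn.congr (hf : CrOn γ n f s) (h : EqOn g f s) : CrOn γ n g s := by
  cases n with
  | zero =>
    obtain ⟨h1, C, h2, h3⟩ := hf
    exact ⟨h1.congr h, C, h2, fun x hx y hy => by rw [h hx, h hy]; exact h3 x hx y hy⟩
  | succ n =>
    obtain ⟨f', h1, h2⟩ := hf
    exact ⟨f', fun x hx => (h1 x hx).congr h (h hx), h2⟩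

theorem CrOn.continuousOn (hf : CrOn γ n f s) : ContinuousOn f s := by
  cases n with
  | zero => exact hf.1
  | succ n =>
    obtain ⟨f', h1, _⟩ := hf
    exact fun x hx => (h1 x hx).continuousWithinAt

theorem exists_abs_le_of_continuousOn (hf : ContinuousOn f (Icc a b)) :
    ∃ M : ℝ, 0 ≤ M ∧ ∀ x ∈ Icc a b, |f x| ≤ M := by
  obtain ⟨M, hM⟩ := isCompact_Icc.exists_bound_of_continuousOn hf
  exact ⟨max M 0, le_max_right _ _, fun x hx => (hM x hx).trans (le_max_left _ _)⟩

theorem exists_lipschitz {f' : ℝ → ℝ} (hf : ∀ x ∈ Icc a b, HasDerivWithinAt f (f' x) (Icc a b) x)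
    (hc : ContinuousOn f' (Icc a b)) :
    ∃ M : ℝ, 0 ≤ M ∧ ∀ x ∈ Icc a b, ∀ y ∈ Icc a b, |f x - f y| ≤ M * |x - y| := by
  obtain ⟨M, hM, h⟩ := exists_abs_le_of_continuousOn hc
  refine ⟨M, hM, fun x hx y hy => ?_⟩
  have := (convex_Icc a b).norm_image_sub_le_of_norm_hasDerivWithin_le hf
    (fun x hx => h x hx) hy hx
  simpa using this

theorem holR_of_lipschitz (hγ0 : 0 ≤ γ) (hγ1 : γ ≤ 1) {M : ℝ} (hM : 0 ≤ M)
    (h : ∀ x ∈ Icc a b, ∀ y ∈ Icc a b, |f x - f y| ≤ M * |x - y|) : HolR γ f (Icc a b) := by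
  refine ⟨M * (|b - a| + 1), by positivity, fun x hx y hy => (h x hx y hy).trans ?_⟩
  rw [mul_assoc]
  refine mul_le_mul_of_nonneg_left ?_ hM
  have hd : |x - y| ≤ |b - a| + 1 := by
    have : |x - y| ≤ |b - a| := by
      rw [abs_of_nonneg (sub_nonneg.2 (hx.1.trans hx.2)), abs_le]
      constructor <;> linarith [hx.1, hx.2, hy.1, hy.2]
    linarith
  rcases (abs_nonneg (x - y)).eq_or_lt with h0 | h0
  · rw [← h0]; positivity
  rcases le_total |x - y| 1 with h1 | h1
  · have := Real.rpow_le_rpow_of_exponent_ge h0 h1 hγ1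
    rw [Real.rpow_one] at this
    refine this.trans (le_mul_of_one_le_left (by positivity) ?_)
    linarith [abs_nonneg (b - a)]
  · have := Real.one_le_rpow h1 hγ0
    nlinarith

theorem CrOn.of_succ (hγ0 : 0 ≤ γ) (hγ1 : γ ≤ 1) (hf : CrOn γ (n + 1) f (Icc a b)) :
    CrOn γ n f (Icc a b) := by
  induction n generalizing f with
  | zero =>
    have hc := hf.continuousOn
    obtain ⟨f', h1, h2⟩ := hf
    obtain ⟨M, hM, h3⟩ := exists_lipschitz h1 h2.continuousOn
    exact ⟨hc, holR_of_lipschitz hγ0 hγ1 hM h3⟩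
  | succ n ih =>
    obtain ⟨f', h1, h2⟩ := hf
    exact ⟨f', h1, ih h2⟩

theorem CrOn.of_le (hγ0 : 0 ≤ γ) (hγ1 : γ ≤ 1) {m : ℕ} (hm : m ≤ n)
    (hf : CrOn γ n f (Icc a b)) : CrOn γ m f (Icc a b) := by
  induction n, hm using Nat.le_induction with
  | base => exact hf
  | succ n _ ih => exact ih (hf.of_succ hγ0 hγ1)

theorem crOn_const (n : ℕ) (c : ℝ) : CrOn γ n (fun _ => c) s := by
  induction n generalizing c with
  | zero => exact ⟨continuousOn_const, 0, le_rfl, fun x _ y _ => by simp⟩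
  | succ n ih => exact ⟨fun _ => 0, fun x _ => hasDerivWithinAt_const _ _ _, ih 0⟩

theorem CrOn.add (hf : CrOn γ n f s) (hg : CrOn γ n g s) : CrOn γ n (fun x => f x + g x) s := by
  induction n generalizing f g with
  | zero =>
    obtain ⟨h1, C, h2, h3⟩ := hf
    obtain ⟨h1', C', h2', h3'⟩ := hg
    refine ⟨h1.add h1', C + C', add_nonneg h2 h2', fun x hx y hy => ?_⟩
    rw [add_sub_add_comm, add_mul]
    exact (abs_add_le _ _).trans (add_le_add (h3 x hx y hy) (h3' x hx y hy))
  | succ n ih =>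
    obtain ⟨f', h1, h2⟩ := hf
    obtain ⟨g', h1', h2'⟩ := hg
    exact ⟨_, fun x hx => (h1 x hx).add (h1' x hx), ih h2 h2'⟩

theorem CrOn.mul (hγ0 : 0 ≤ γ) (hγ1 : γ ≤ 1) (hf : CrOn γ n f (Icc a b))
    (hg : CrOn γ n g (Icc a b)) : CrOn γ n (fun x => f x * g x) (Icc a b) := by
  induction n generalizing f g with
  | zero =>
    obtain ⟨h1, C, h2, h3⟩ := hf
    obtain ⟨h1', C', h2', h3'⟩ := hg
    obtain ⟨M, hM, hMf⟩ := exists_abs_le_of_continuousOn h1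
    obtain ⟨M', hM', hMg⟩ := exists_abs_le_of_continuousOn h1'
    refine ⟨h1.mul h1', M * C' + M' * C, by positivity, fun x hx y hy => ?_⟩
    rw [show f x * g x - f y * g y = f x * (g x - g y) + g y * (f x - f y) by ring, add_mul,
      mul_assoc, mul_assoc]
    refine (abs_add_le _ _).trans ?_
    rw [abs_mul, abs_mul]
    exact add_le_add (mul_le_mul (hMf x hx) (h3' x hx y hy) (abs_nonneg _) hM)
      (mul_le_mul (hMg y hy) (h3 x hx y hy) (abs_nonneg _) hM')
  | succ n ih =>
    have hf0 := hf.of_succ hγ0 hγ1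
    have hg0 := hg.of_succ hγ0 hγ1
    obtain ⟨f', h1, h2⟩ := hf
    obtain ⟨g', h1', h2'⟩ := hg
    exact ⟨_, fun x hx => (h1 x hx).mul (h1' x hx), (ih h2 hg0).add (ih hf0 h2')⟩

/-- One derivative more is assumed of `g` than of `f`: the base case needs `g` Lipschitz, and in the
chain rule `f' ∘ g` falls under the induction hypothesis with `g` lowered by one class. -/
theorem CrOn.comp_aux (hγ0 : 0 ≤ γ) (hγ1 : γ ≤ 1) (hf : CrOn γ n f s)
    (hg : CrOn γ (n + 1) g (Icc a b)) (hm : MapsTo g (Icc a b) s) :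
    CrOn γ n (fun x => f (g x)) (Icc a b) := by
  induction n generalizing f g with
  | zero =>
    obtain ⟨h1, C, h2, h3⟩ := hf
    have hc := hg.continuousOn
    obtain ⟨g', h1', h2'⟩ := hg
    obtain ⟨M, hM, h4⟩ := exists_lipschitz h1' h2'.continuousOn
    refine ⟨h1.comp hc hm, C * M ^ γ, by positivity, fun x hx y hy => ?_⟩
    refine (h3 _ (hm hx) _ (hm hy)).trans ?_
    rw [mul_assoc, ← Real.mul_rpow hM (abs_nonneg _)]
    exact mul_le_mul_of_nonneg_left
      (Real.rpow_le_rpow (abs_nonneg _) (h4 x hx y hy) hγ0) h2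
  | succ n ih =>
    obtain ⟨f', h1, h2⟩ := hf
    have hg0 := hg.of_succ hγ0 hγ1
    obtain ⟨g', h1', h2'⟩ := hg
    exact ⟨_, fun x hx => (h1 _ (hm hx)).comp x (h1' x hx) hm,
      (ih h2 hg0 hm).mul hγ0 hγ1 (h2'.of_succ hγ0 hγ1)⟩

/-- The class `C^r`, `r ≥ 1`, is closed under composition. -/
theorem CrOn.comp (hγ0 : 0 ≤ γ) (hγ1 : γ ≤ 1) (hf : CrOn γ (n + 1) f s)
    (hg : CrOn γ (n + 1) g (Icc a b)) (hm : MapsTo g (Icc a b) s) :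
    CrOn γ (n + 1) (fun x => f (g x)) (Icc a b) := by
  obtain ⟨f', h1, h2⟩ := hf
  have h3 := h2.comp_aux hγ0 hγ1 hg hm
  obtain ⟨g', h1', h2'⟩ := hg
  exact ⟨_, fun x hx => (h1 _ (hm hx)).comp x (h1' x hx) hm, h3.mul hγ0 hγ1 h2'⟩

theorem crOn_id (n : ℕ) (hγ0 : 0 ≤ γ) (hγ1 : γ ≤ 1) : CrOn γ n (fun x => x) (Icc a b) := by
  cases n with
  | zero =>
    exact ⟨continuousOn_id, holR_of_lipschitz hγ0 hγ1 zero_le_one fun x _ y _ => by simp⟩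
  | succ n => exact ⟨fun _ => 1, fun x _ => hasDerivWithinAt_id _ _, crOn_const n 1⟩

/-- Links the class of the theorem to the recursive one, which is convenient for products and
composites. Nondegeneracy of the segment makes derivatives within it unique. -/
theorem crOn_iff (hγ : 0 ≤ γ) (hab : a < b) :
    CrOn γ n f (Icc a b) ↔ ContDiffOn ℝ (n : WithTop ℕ∞) f (Icc a b) ∧
      ∃ C, HolderOnWith C γ.toNNReal (iteratedDerivWithin n f (Icc a b)) (Icc a b) := by
  have hu : UniqueDiffOn ℝ (Icc a b) := uniqueDiffOn_Icc hab
  induction n generalizing f with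
  | zero =>
    rw [iteratedDerivWithin_zero, holderOnWith_iff hγ]
    simp [CrOn]
  | succ n ih =>
    rw [Nat.cast_succ, contDiffOn_succ_iff_derivWithin hu, iteratedDerivWithin_succ']
    constructor
    · rintro ⟨f', h1, h2⟩
      have h3 := ih.1 (h2.congr fun x hx => (h1 x hx).derivWithin (hu x hx))
      exact ⟨⟨fun x hx => (h1 x hx).differentiableWithinAt, by simp, h3.1⟩, h3.2⟩
    · rintro ⟨⟨h1, -, h2⟩, h3⟩
      exact ⟨_, fun x hx => (h1 x hx).hasDerivWithinAt, ih.2 ⟨h2, h3⟩⟩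

theorem fract_exponent {r : ℝ} (hr : 0 ≤ r) : 0 ≤ r - ⌊r⌋₊ ∧ r - ⌊r⌋₊ ≤ 1 :=
  ⟨sub_nonneg.2 (Nat.floor_le hr), by linarith [Nat.lt_floor_add_one r]⟩

theorem isCrOn_iff {r : ℝ} (hr : 0 ≤ r) (hab : a < b) :
    IsCrOn r f (Icc a b) ↔ CrOn (r - ⌊r⌋₊) ⌊r⌋₊ f (Icc a b) :=
  (crOn_iff (fract_exponent hr).1 hab).symm

/-- Smooth functions are of class `C^r`. -/
theorem isCrOn_of_contDiffOn {r : ℝ} (hr : 0 ≤ r) (hab : a < b)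
    (hf : ContDiffOn ℝ (⌊r⌋₊ + 1 : ℕ) f (Icc a b)) : IsCrOn r f (Icc a b) := by
  obtain ⟨h0, h1⟩ := fract_exponent hr
  rw [isCrOn_iff hr hab]
  have key : ∀ n : ℕ, ∀ f : ℝ → ℝ, ContDiffOn ℝ (n + 1 : ℕ) f (Icc a b) →
      CrOn (r - ⌊r⌋₊) n f (Icc a b) := by
    intro n
    induction n with
    | zero =>
      intro f hf
      rw [zero_add, Nat.cast_one, ← zero_add (1 : WithTop ℕ∞),
        contDiffOn_succ_iff_derivWithin (uniqueDiffOn_Icc hab)] at hf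
      obtain ⟨M, hM, h3⟩ := exists_lipschitz
        (fun x hx => (hf.1 x hx).hasDerivWithinAt) hf.2.2.continuousOn
      exact ⟨hf.1.continuousOn, holR_of_lipschitz h0 h1 hM h3⟩
    | succ n ih =>
      intro f hf
      rw [Nat.cast_succ, contDiffOn_succ_iff_derivWithin (uniqueDiffOn_Icc hab)] at hf
      exact ⟨_, fun x hx => (hf.1 x hx).hasDerivWithinAt, ih _ hf.2.2⟩
  exact key _ _ hf

end Cr

/-! ## Comparison with Möbius maps -/

/-- The logarithm of the quotient of the square of a difference quotient and the derivatives at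
both ends, where the derivatives are the exponentials of `L x` and `L y`. It vanishes identically
for Möbius maps and it is additive under composition. -/
noncomputable def xr (H L : ℝ → ℝ) (x y : ℝ) : ℝ :=
  2 * Real.log ((H y - H x) / (y - x)) - L x - L y

theorem xr_pow (F : ℝ ≃o ℝ) (φ : ℝ → ℝ) (i : ℕ) {x y : ℝ} (hxy : x < y) :
    xr (fun z => (F ^ i) z) (bsum F φ i) x y =
      ∑ j ∈ Finset.range i, xr F φ ((F ^ j) x) ((F ^ j) y) := by
  induction i with
  | zero =>
    have : y - x ≠ 0 := (sub_pos.2 hxy).ne'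
    simp [xr, bsum, div_self this]
  | succ i ih =>
    rw [Finset.sum_range_succ, ← ih]
    unfold xr
    have h1 : 0 < (F ^ i) y - (F ^ i) x := sub_pos.2 ((F ^ i).strictMono hxy)
    have h2 : 0 < F ((F ^ i) y) - F ((F ^ i) x) := sub_pos.2 (F.strictMono (sub_pos.1 h1))
    have h3 : 0 < y - x := sub_pos.2 hxy
    have e : ∀ z, (F ^ (i + 1)) z = F ((F ^ i) z) := fun z => by
      rw [pow_succ', RelIso.mul_apply]
    simp only [bsum_succ, e]
    rw [Real.log_div h1.ne' h3.ne', Real.log_div h2.ne' h1.ne', Real.log_div h2.ne' h3.ne']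
    ring

theorem abs_log_sub_log_le {a b m : ℝ} (hm : 0 < m) (ha : m ≤ a) (hb : m ≤ b) :
    |Real.log a - Real.log b| ≤ |a - b| / m := by
  wlog h : b ≤ a generalizing a b
  · rw [abs_sub_comm, abs_sub_comm a]
    exact this hb ha (not_le.1 h).le
  have ha0 := hm.trans_le ha
  have hb0 := hm.trans_le hb
  rw [abs_of_nonneg (sub_nonneg.2 (Real.log_le_log hb0 h)), abs_of_nonneg (sub_nonneg.2 h),
    ← Real.log_div ha0.ne' hb0.ne']
  refine (Real.log_le_sub_one_of_pos (div_pos ha0 hb0)).trans ?_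
  rw [div_sub_one hb0.ne']
  exact div_le_div_of_nonneg_left (sub_nonneg.2 h) hm hb

/-- The estimate of `xr` for maps of class `C^{2+δ}`. -/
theorem xr_bound {f f' f'' : ℝ → ℝ} {p q δ : ℝ} (hδ0 : 0 < δ) (hδ1 : δ ≤ 1)
    (h1 : ∀ x ∈ Icc p q, HasDerivWithinAt f (f' x) (Icc p q) x)
    (h2 : ∀ x ∈ Icc p q, HasDerivWithinAt f' (f'' x) (Icc p q) x)
    (h3 : CrOn δ 0 f'' (Icc p q)) (hpos : ∀ x ∈ Icc p q, 0 < f' x) :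
    ∃ C : ℝ, 0 ≤ C ∧ ∀ x ∈ Icc p q, ∀ y ∈ Icc p q, x < y →
      |xr f (fun z => Real.log (f' z)) x y| ≤ C * (y - x) ^ (1 + δ) := by
  rcases lt_or_ge q p with hpq | hpq
  · exact ⟨0, le_rfl, fun x hx => absurd (hx.1.trans hx.2) (not_le.2 hpq)⟩
  have hc' : ContinuousOn f' (Icc p q) := fun x hx => (h2 x hx).continuousWithinAt
  obtain ⟨hc'', K, hK, hH⟩ := h3
  obtain ⟨M, hM, hLip⟩ := exists_lipschitz h2 hc''
  obtain ⟨B, hB, hBd⟩ := exists_abs_le_of_continuousOn hc'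
  obtain ⟨x₀, hx₀, hmin⟩ := isCompact_Icc.exists_isMinOn (nonempty_Icc.2 hpq) hc'
  set m := f' x₀ with hm
  have hm0 : 0 < m := hpos x₀ hx₀
  -- Since `xr` compares `Δ ^ 2` with `f' x * f' y`, where `Δ` is the slope, two errors arise. `K *
  -- B` comes from the trapezoidal rule `Δ ≈ (f' x + f' y) / 2`; the other term from `(f' x - f' y)
  -- ^ 2 / 4`, the gap between the squared arithmetic and geometric means, with `d ^ 2 ≤ (q - p) ^
  -- (1 - δ) * d ^ (1 + δ)`.
  set C₁ := K * B + M ^ 2 / 4 * (q - p) ^ (1 - δ)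
  refine ⟨C₁ / m ^ 2, div_nonneg (add_nonneg (by positivity)
    (mul_nonneg (by positivity) (Real.rpow_nonneg (by linarith) _))) (by positivity),
    fun x hx y hy hxy => ?_⟩
  set d := y - x with hd
  have hd0 : 0 < d := sub_pos.2 hxy
  have hsub : Icc x y ⊆ Icc p q := Icc_subset_Icc hx.1 hy.2
  have e1 : d ^ (1 + δ) = d * d ^ δ := by rw [Real.rpow_add hd0, Real.rpow_one]
  -- first order expansion of the derivative
  have step1 : ∀ t ∈ Icc x y, |f' t - f' x - (t - x) * f'' t| ≤ K * d ^ δ * d := by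
    intro t ht
    have hsub' : Icc x t ⊆ Icc p q := (Icc_subset_Icc_right ht.2).trans hsub
    have := (convex_Icc x t).norm_image_sub_le_of_norm_hasDerivWithin_le
      (f := fun u => f' u - u * f'' t) (f' := fun u => f'' u - f'' t) (C := K * d ^ δ)
      (fun u hu => by
        have := ((h2 u (hsub' hu)).mono hsub').sub
          ((hasDerivWithinAt_id u (Icc x t)).mul_const (f'' t))
        exact this.congr_deriv (by ring))
      (fun u hu => by
        refine (hH u (hsub' hu) t (hsub ht)).trans (mul_le_mul_of_nonneg_left ?_ hK)
        refine Real.rpow_le_rpow (abs_nonneg _) ?_ hδ0.le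
        rw [abs_le]
        constructor <;> linarith [hu.1, hu.2, ht.1, ht.2])
      (left_mem_Icc.2 ht.1) (right_mem_Icc.2 ht.1)
    rw [Real.norm_eq_abs, Real.norm_eq_abs, abs_of_nonneg (sub_nonneg.2 ht.1)] at this
    have e : f' t - f' x - (t - x) * f'' t = f' t - t * f'' t - (f' x - x * f'' t) := by ring
    rw [e]
    refine this.trans (mul_le_mul_of_nonneg_left (by linarith [ht.2]) (by positivity))
  -- trapezoidal rule
  have step2 : |f y - f x - (y - x) * (f' y + f' x) / 2| ≤ K * d ^ δ * d / 2 * d := by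
    have := (convex_Icc x y).norm_image_sub_le_of_norm_hasDerivWithin_le
      (f := fun t => f t - (t - x) * (f' t + f' x) / 2)
      (f' := fun t => (f' t - f' x - (t - x) * f'' t) / 2) (C := K * d ^ δ * d / 2)
      (fun t ht => by
        have a1 := (h1 t (hsub ht)).mono hsub
        have a2 := ((h2 t (hsub ht)).mono hsub).add_const (f' x)
        have a3 := (hasDerivWithinAt_id t (Icc x y)).sub_const x
        have := a1.sub ((a3.mul a2).div_const 2)
        refine this.congr_deriv ?_
        simp only [id]
        ring)
      (fun t ht => by
        rw [Real.norm_eq_abs, abs_div, abs_two]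
        linarith [step1 t ht])
      (left_mem_Icc.2 hxy.le) (right_mem_Icc.2 hxy.le)
    rw [Real.norm_eq_abs, Real.norm_eq_abs, abs_of_nonneg hd0.le] at this
    have e : f y - f x - (y - x) * (f' y + f' x) / 2 =
      f y - (y - x) * (f' y + f' x) / 2 - (f x - (x - x) * (f' x + f' x) / 2) := by ring
    rw [e]
    exact this
  obtain ⟨ξ, hξ, hΔ⟩ := exists_hasDerivAt_eq_slope f f' hxy
    (fun t ht => ((h1 t (hsub ht)).continuousWithinAt).mono hsub)
    (fun t ht => (h1 t (hsub (Ioo_subset_Icc_self ht))).hasDerivAt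
      (Icc_mem_nhds (hx.1.trans_lt ht.1) (ht.2.trans_le hy.2)))
  have hξ' := hsub (Ioo_subset_Icc_self hξ)
  set Δ := (f y - f x) / (y - x) with hΔdef
  have hΔm : m ≤ Δ := hΔ ▸ hmin hξ'
  have hΔB : Δ ≤ B := hΔ ▸ (le_abs_self _).trans (hBd ξ hξ')
  have hxm : m ≤ f' x := hmin hx
  have hym : m ≤ f' y := hmin hy
  have hxB := (le_abs_self _).trans (hBd x hx)
  have hyB := (le_abs_self _).trans (hBd y hy)
  have step3 : |Δ - (f' x + f' y) / 2| ≤ K * d ^ δ * d / 2 := by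
    have e : Δ - (f' x + f' y) / 2 = (f y - f x - (y - x) * (f' y + f' x) / 2) / d := by
      rw [hΔdef, ← hd]; field_simp; ring
    rw [e, abs_div, abs_of_pos hd0, div_le_iff₀ hd0]
    exact step2
  have step4 : |Δ ^ 2 - f' x * f' y| ≤ C₁ * d ^ (1 + δ) := by
    have e : Δ ^ 2 - f' x * f' y = (Δ - (f' x + f' y) / 2) * (Δ + (f' x + f' y) / 2) +
      (f' x - f' y) ^ 2 / 4 := by ring
    have b1 : |(Δ - (f' x + f' y) / 2) * (Δ + (f' x + f' y) / 2)| ≤ K * d ^ δ * d / 2 * (2 * B) := by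
      rw [abs_mul]
      refine mul_le_mul step3 ?_ (abs_nonneg _) (by positivity)
      rw [abs_of_pos (by linarith)]
      linarith
    have b2 : |(f' x - f' y) ^ 2 / 4| ≤ M ^ 2 / 4 * (q - p) ^ (1 - δ) * (d * d ^ δ) := by
      rw [abs_of_nonneg (by positivity), ← sq_abs]
      have c1 : |f' x - f' y| ≤ M * d := by
        have := hLip x hx y hy
        rwa [abs_sub_comm x y, abs_of_pos hd0] at this
      have c2 : |f' x - f' y| ^ 2 ≤ (M * d) ^ 2 := pow_le_pow_left₀ (abs_nonneg _) c1 2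
      have c3 : d = d ^ (1 - δ) * d ^ δ := by
        rw [← Real.rpow_add hd0]; simp
      have c4 : d ^ (1 - δ) ≤ (q - p) ^ (1 - δ) :=
        Real.rpow_le_rpow hd0.le (by linarith [hx.1, hy.2]) (by linarith)
      have c5 : d * d ≤ (q - p) ^ (1 - δ) * (d * d ^ δ) := by
        nth_rw 2 [c3]
        have : 0 ≤ d * d ^ δ := by positivity
        nlinarith
      have c6 : 0 ≤ M ^ 2 / 4 := by positivity
      nlinarith
    rw [e, e1]
    refine (abs_add_le _ _).trans ((add_le_add b1 b2).trans (le_of_eq ?_))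
    ring
  have hfx := hm0.trans_le hxm
  have hfy := hm0.trans_le hym
  have hΔ0 := hm0.trans_le hΔm
  have e2 : xr f (fun z => Real.log (f' z)) x y = Real.log (Δ ^ 2) - Real.log (f' x * f' y) := by
    rw [xr, Real.log_mul hfx.ne' hfy.ne', Real.log_pow]
    push_cast; ring
  rw [e2]
  refine (abs_log_sub_log_le (m := m ^ 2) (by positivity)
    (pow_le_pow_left₀ hm0.le hΔm 2) (by nlinarith)).trans ?_
  rw [div_mul_eq_mul_div]
  exact div_le_div_of_nonneg_right step4 (by positivity)

/-! ### The Möbius map with given values at the ends and given derivative at the left end -/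

/-- The denominator of `mob`. -/
noncomputable def mobDen (x₀ X Y h x : ℝ) : ℝ := X * Y + (x - x₀) * (h * X - Y)

/-- The Möbius map that maps `x₀` to `y₀` with derivative `h`, and `x₀ + X` to `y₀ + Y`. -/
noncomputable def mob (x₀ y₀ X Y h x : ℝ) : ℝ := y₀ + h * X * Y * (x - x₀) / mobDen x₀ X Y h x

section Moebius

variable {x₀ y₀ X Y h x : ℝ}

/-- The denominator is affine, with the positive values `X * Y` and `h * X ^ 2` at the two ends. -/
theorem mobDen_pos (hX : 0 < X) (hY : 0 < Y) (hh : 0 < h) (hx : x ∈ Icc x₀ (x₀ + X)) :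
    0 < mobDen x₀ X Y h x := by
  have e : mobDen x₀ X Y h x = (x₀ + X - x) * Y + (x - x₀) * h * X := by
    unfold mobDen; ring
  rw [e]
  rcases hx.1.eq_or_lt with h1 | h1
  · rw [← h1]; simp; positivity
  · have h2 : 0 ≤ x₀ + X - x := by linarith [hx.2]
    have h3 : 0 < x - x₀ := by linarith
    positivity

theorem mob_left (x₀ y₀ X Y h : ℝ) : mob x₀ y₀ X Y h x₀ = y₀ := by simp [mob]

theorem mob_right (hX : 0 < X) (hh : 0 < h) :
    mob x₀ y₀ X Y h (x₀ + X) = y₀ + Y := by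
  unfold mob mobDen
  have : X * Y + (x₀ + X - x₀) * (h * X - Y) = h * X * X := by ring
  rw [this]
  field_simp
  ring

theorem hasDerivAt_mob (hx : mobDen x₀ X Y h x ≠ 0) :
    HasDerivAt (mob x₀ y₀ X Y h) (h * X ^ 2 * Y ^ 2 / mobDen x₀ X Y h x ^ 2) x := by
  have h1 : HasDerivAt (fun x => h * X * Y * (x - x₀)) (h * X * Y) x := by
    simpa using ((hasDerivAt_id x).sub_const x₀).const_mul (h * X * Y)
  have h2 : HasDerivAt (mobDen x₀ X Y h) (h * X - Y) x := by
    unfold mobDen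
    simpa using (((hasDerivAt_id x).sub_const x₀).mul_const (h * X - Y)).const_add (X * Y)
  refine ((h1.div h2 hx).const_add y₀).congr_deriv ?_
  congr 1
  unfold mobDen
  ring

theorem mob_eq (hx : mobDen x₀ X Y h x ≠ 0) :
    mob x₀ y₀ X Y h x = ((y₀ * (h * X - Y) + h * X * Y) * x +
      (y₀ * (X * Y - x₀ * (h * X - Y)) - h * X * Y * x₀)) /
      ((h * X - Y) * x + (X * Y - x₀ * (h * X - Y))) := by
  have e : (h * X - Y) * x + (X * Y - x₀ * (h * X - Y)) = mobDen x₀ X Y h x := by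
    unfold mobDen; ring
  rw [e, mob, eq_div_iff hx, add_mul, div_mul_cancel₀ _ hx]
  unfold mobDen
  ring

theorem contDiffOn_mob (hX : 0 < X) (hY : 0 < Y) (hh : 0 < h) (n : WithTop ℕ∞) :
    ContDiffOn ℝ n (mob x₀ y₀ X Y h) (Icc x₀ (x₀ + X)) := by
  unfold mob
  refine contDiffOn_const.add (ContDiffOn.div ?_ ?_ fun x hx => (mobDen_pos hX hY hh hx).ne')
  · exact (contDiff_const.mul (contDiff_id.sub contDiff_const)).contDiffOn
  · unfold mobDen
    exact (contDiff_const.add ((contDiff_id.sub contDiff_const).mul contDiff_const)).contDiffOn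

theorem mob_strictMonoOn (hX : 0 < X) (hY : 0 < Y) (hh : 0 < h) :
    StrictMonoOn (mob x₀ y₀ X Y h) (Icc x₀ (x₀ + X)) := by
  refine strictMonoOn_of_deriv_pos (convex_Icc _ _)
    (contDiffOn_mob hX hY hh 0).continuousOn fun x hx => ?_
  have h1 := mobDen_pos hX hY hh (interior_subset hx)
  rw [(hasDerivAt_mob h1.ne').deriv]
  positivity

theorem mob_image_Ico (hX : 0 < X) (hY : 0 < Y) (hh : 0 < h) :
    mob x₀ y₀ X Y h '' Ico x₀ (x₀ + X) = Ico y₀ (y₀ + Y) := by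
  have hm := mob_strictMonoOn (y₀ := y₀) (x₀ := x₀) hX hY hh
  have h0 : x₀ ≤ x₀ + X := by linarith
  apply Subset.antisymm
  · rintro _ ⟨x, hx, rfl⟩
    have hx' := Ico_subset_Icc_self hx
    constructor
    · have := hm.monotoneOn (left_mem_Icc.2 h0) hx' hx.1
      rwa [mob_left] at this
    · have := hm hx' (right_mem_Icc.2 h0) hx.2
      rwa [mob_right hX hh] at this
  · have := intermediate_value_Ico h0 (contDiffOn_mob (x₀ := x₀) (y₀ := y₀) hX hY hh 0).continuousOn
    rwa [mob_left, mob_right hX hh] at this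

theorem abs_one_sub_exp_le {z E : ℝ} (hz : |z| ≤ E) : |1 - Real.exp z| ≤ Real.exp E - 1 := by
  obtain ⟨h1, h2⟩ := abs_le.1 hz
  have h3 := Real.exp_le_exp.2 h1
  have h4 := Real.exp_le_exp.2 h2
  have h5 := Real.exp_pos E
  have h6 : 2 - Real.exp E ≤ Real.exp (-E) := by
    rw [Real.exp_neg, ← one_div, le_div_iff₀ h5]
    nlinarith [sq_nonneg (Real.exp E - 1)]
  rw [abs_le]
  constructor <;> linarith

/-- A map for which `xr` is small, with respect to the left end, is `C^1`-close to the Möbius map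
with the same values at the ends and the same derivative at the left end. -/
theorem mob_close {H L : ℝ → ℝ} {ε : ℝ} (hX : 0 < X) (hY : 0 < Y)
    (hc : ContinuousOn H (Icc x₀ (x₀ + X))) (h0 : H x₀ = y₀) (h1 : H (x₀ + X) = y₀ + Y)
    (hm : StrictMonoOn H (Icc x₀ (x₀ + X)))
    (hd : ∀ x ∈ Ioo x₀ (x₀ + X), HasDerivAt H (Real.exp (L x)) x)
    (hε : ∀ x ∈ Ioo x₀ (x₀ + X), |xr H L x₀ x| ≤ ε) (hx : x ∈ Ioo x₀ (x₀ + X)) :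
    |H x - mob x₀ y₀ X Y (Real.exp (L x₀)) x| ≤ (Real.exp (3 * ε) - 1) * (H x - y₀) ∧
    |Real.exp (L x) - deriv (mob x₀ y₀ X Y (Real.exp (L x₀))) x| ≤
      (Real.exp (3 * ε) - 1) * Real.exp (L x) := by
  set h := Real.exp (L x₀) with hh
  have hh0 : 0 < h := Real.exp_pos _
  have hxx : x₀ < x₀ + X := by linarith
  have hε0 : 0 ≤ ε := (abs_nonneg _).trans (hε x hx)
  have hIoc : Ioc x₀ (x₀ + X) ⊆ Icc x₀ (x₀ + X) := Ioc_subset_Icc_self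
  have hHpos : ∀ t ∈ Ioc x₀ (x₀ + X), 0 < H t - y₀ := fun t ht => by
    rw [← h0]
    exact sub_pos.2 (hm (left_mem_Icc.2 hxx.le) (hIoc ht) ht.1)
  -- the derivative of `H` in terms of `xr`
  have hder : ∀ t ∈ Ioo x₀ (x₀ + X), Real.exp (L t) =
      (H t - y₀) ^ 2 / ((t - x₀) ^ 2 * h) * Real.exp (-xr H L x₀ t) := fun t ht => by
    have a1 := hHpos t (Ioo_subset_Ioc_self ht)
    have a2 : 0 < t - x₀ := sub_pos.2 ht.1
    have e : L t = 2 * Real.log ((H t - y₀) / (t - x₀)) - L x₀ - xr H L x₀ t := by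
      rw [xr, h0]; ring
    nth_rw 1 [e]
    have e2 : Real.exp (2 * Real.log ((H t - y₀) / (t - x₀))) = ((H t - y₀) / (t - x₀)) ^ 2 := by
      rw [two_mul, Real.exp_add, Real.exp_log (div_pos a1 a2), sq]
    rw [Real.exp_sub, Real.exp_sub, e2, Real.exp_neg, ← hh]
    field_simp
  -- monotonicity of the reciprocals
  have hmono : ∀ σ c : ℝ, (∀ t ∈ Ioo x₀ (x₀ + X), 0 ≤ σ * (c - Real.exp (-xr H L x₀ t))) →
      MonotoneOn (fun t => σ * ((H t - y₀)⁻¹ - c * (h * (t - x₀))⁻¹)) (Ioc x₀ (x₀ + X)) := by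
    intro σ c hcc
    refine monotoneOn_of_hasDerivWithinAt_nonneg (convex_Ioc _ _)
      (f' := fun t => σ * (-Real.exp (L t) / (H t - y₀) ^ 2 - c * (-h / (h * (t - x₀)) ^ 2)))
      ?_ ?_ ?_
    · refine continuousOn_const.mul (ContinuousOn.sub (((hc.mono hIoc).sub continuousOn_const).inv₀
        fun t ht => (hHpos t ht).ne') (continuousOn_const.mul (ContinuousOn.inv₀ (by fun_prop) ?_)))
      intro t ht
      have := sub_pos.2 ht.1
      positivity
    · intro t ht
      rw [interior_Ioc] at ht ⊢
      have a1 := hHpos t (Ioo_subset_Ioc_self ht)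
      have a2 : 0 < t - x₀ := sub_pos.2 ht.1
      have b1 := ((hd t ht).sub_const y₀).inv a1.ne'
      have b2 : HasDerivAt (fun t => h * (t - x₀)) h t := by
        simpa using ((hasDerivAt_id t).sub_const x₀).const_mul h
      have b3 := (b2.inv (by positivity)).const_mul c
      exact ((b1.sub b3).const_mul σ).hasDerivWithinAt
    · intro t ht
      rw [interior_Ioc] at ht
      have a1 := hHpos t (Ioo_subset_Ioc_self ht)
      have a2 : 0 < t - x₀ := sub_pos.2 ht.1
      have e : σ * (-Real.exp (L t) / (H t - y₀) ^ 2 - c * (-h / (h * (t - x₀)) ^ 2)) =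
          σ * (c - Real.exp (-xr H L x₀ t)) / (h * (t - x₀) ^ 2) := by
        rw [hder t ht]
        field_simp
        ring
      rw [e]
      exact div_nonneg (hcc t ht) (by positivity)
  have hxc := Ioo_subset_Ioc_self hx
  have hend : x₀ + X ∈ Ioc x₀ (x₀ + X) := right_mem_Ioc.2 hxx
  -- With `u = H - y₀`, the formula for the derivative reads `(1 / u)' = (1 / (h (t - x₀)))' * exp
  -- (-xr)`. So the increment of `1 / u` up to the right end lies between the multiples by `exp
  -- (-ε)` and `exp ε` of the increment of `1 / (h (t - x₀))`.
  have up := hmono 1 (Real.exp ε) (fun t ht => by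
    have := Real.exp_le_exp.2 (neg_le.1 (abs_le.1 (hε t ht)).1)
    linarith) hxc hend hx.2.le
  have lo := hmono (-1) (Real.exp (-ε)) (fun t ht => by
    have := Real.exp_le_exp.2 (neg_le_neg (abs_le.1 (hε t ht)).2)
    linarith) hxc hend hx.2.le
  simp only [h1, add_sub_cancel_left] at up lo
  set u := H x - y₀ with hu
  have hu0 : 0 < u := hHpos x hxc
  set X' := x - x₀ with hX'
  have hX'0 : 0 < X' := sub_pos.2 hx.1
  have hden := mobDen_pos hX hY hh0 (Ioo_subset_Icc_self hx)
  set N := mob x₀ y₀ X Y h x - y₀ with hN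
  have hNeq : N = h * X * Y * X' / mobDen x₀ X Y h x := by rw [hN, mob, add_sub_cancel_left]
  have hN0 : 0 < N := by rw [hNeq]; positivity
  -- For the Möbius map the same relation holds with `xr = 0`: its reciprocal is affine in `1 / (x -
  -- x₀)`. Both maps have the value `Y⁻¹` at the right end.
  have hNinv : N⁻¹ = Y⁻¹ + ((h * X')⁻¹ - (h * X)⁻¹) := by
    rw [hNeq, mobDen]
    field_simp
    ring
  have hq : 0 ≤ (h * X')⁻¹ - (h * X)⁻¹ := by
    rw [sub_nonneg]
    gcongr
    linarith [hx.2]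
  have hp : 0 < Y⁻¹ := inv_pos.2 hY
  have hE1 : 1 ≤ Real.exp ε := Real.one_le_exp hε0
  have hE2 : Real.exp (-ε) ≤ 1 := Real.exp_le_one_iff.2 (by linarith)
  have up' : u⁻¹ ≤ Real.exp ε * N⁻¹ := by
    rw [hNinv]; nlinarith
  have lo' : Real.exp (-ε) * N⁻¹ ≤ u⁻¹ := by
    rw [hNinv]; nlinarith
  have hw : |Real.log (N / u)| ≤ ε := by
    rw [abs_le]
    constructor
    · rw [Real.le_log_iff_exp_le (div_pos hN0 hu0), div_eq_mul_inv]
      calc Real.exp (-ε) = N * (Real.exp (-ε) * N⁻¹) := by field_simp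
        _ ≤ N * u⁻¹ := by gcongr
    · rw [Real.log_le_iff_le_exp (div_pos hN0 hu0), div_eq_mul_inv]
      calc N * u⁻¹ ≤ N * (Real.exp ε * N⁻¹) := by gcongr
        _ = Real.exp ε := by field_simp
  set w := Real.log (N / u) with hwdef
  have hNu : N = u * Real.exp w := by
    rw [hwdef, Real.exp_log (div_pos hN0 hu0)]; field_simp
  constructor
  · have e : H x - mob x₀ y₀ X Y h x = (1 - Real.exp w) * u := by
      have : H x - mob x₀ y₀ X Y h x = u - N := by rw [hu, hN]; ring
      rw [this, hNu]; ring
    rw [e, abs_mul, abs_of_pos hu0]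
    exact mul_le_mul_of_nonneg_right (abs_one_sub_exp_le (hw.trans (by linarith))) hu0.le
  · rw [(hasDerivAt_mob hden.ne').deriv]
    have e1 : h * X ^ 2 * Y ^ 2 / mobDen x₀ X Y h x ^ 2 = N ^ 2 / (X' ^ 2 * h) := by
      rw [hNeq]; field_simp
    -- The derivatives involve the squares of `N` and `u`, so the error in the exponent is `2 * w`
    -- plus `xr`, in total `3 * ε`.
    have e2 : N ^ 2 / (X' ^ 2 * h) = Real.exp (L x) * Real.exp (2 * w + xr H L x₀ x) := by
      rw [hder x hx, ← hu, ← hX', hNu, Real.exp_add, two_mul, Real.exp_add, Real.exp_neg]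
      field_simp
    have e3 : Real.exp (L x) - h * X ^ 2 * Y ^ 2 / mobDen x₀ X Y h x ^ 2 =
        (1 - Real.exp (2 * w + xr H L x₀ x)) * Real.exp (L x) := by
      rw [e1, e2]; ring
    rw [e3, abs_mul, abs_of_pos (Real.exp_pos (L x))]
    refine mul_le_mul_of_nonneg_right (abs_one_sub_exp_le ?_) (Real.exp_pos _).le
    refine (abs_add_le _ _).trans ?_
    rw [abs_mul, abs_two]
    linarith [hε x hx]

end Moebius

/-! ## Lifts of circle diffeomorphisms with breaks -/

/-- The lift `F` of a circle diffeomorphism with breaks at `p`. -/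
structure BreakLift (r : ℝ) {k : ℕ} (c : Fin k → ℝ) (F : ℝ ≃o ℝ) (p : Fin (k + 1) → ℝ) :
    Prop where
  degOne : IsDegOne F
  sub : IsSubdivision p
  cr : ∀ i : Fin k, IsCrOn r F (Icc (p i.castSucc) (p i.succ))
  pos : ∀ i : Fin k, ∀ x ∈ Icc (p i.castSucc) (p i.succ),
    0 < derivWithin F (Icc (p i.castSucc) (p i.succ)) x
  jump : ∀ i : Fin k, derivWithin F (Ici (p i.castSucc)) (p i.castSucc) /
    derivWithin F (Iic (p i.castSucc)) (p i.castSucc) = c i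

/-- The logarithm of the right derivative. -/
noncomputable def logD (F : ℝ ≃o ℝ) (x : ℝ) : ℝ := Real.log (derivWithin F (Ici x) x)

/-- The right derivative of the logarithm of the right derivative. -/
noncomputable def nonlin (F : ℝ ≃o ℝ) (x : ℝ) : ℝ := derivWithin (logD F) (Ici x) x

/-- The sum of weights `w i` of the points of `p i + ℤ` up to `x`. -/
noncomputable def floorSum {k : ℕ} (p : Fin (k + 1) → ℝ) (w : Fin k → ℝ) (x : ℝ) : ℝ :=
  ∑ i, w i * ⌊x - p i.castSucc⌋

theorem _root_.CircleBreaks.IsSubdivision.exists_mem {k : ℕ} {p : Fin (k + 1) → ℝ} (hp : IsSubdivision p)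
    {x : ℝ} (hx : x ∈ Ico (0 : ℝ) 1) : ∃ i : Fin k, x ∈ Ico (p i.castSucc) (p i.succ) := by
  by_contra! hcon
  have key : ∀ i : Fin (k + 1), p i ≤ x := by
    intro i
    induction i using Fin.induction with
    | zero => rw [hp.zero]; exact hx.1
    | succ i ih => exact not_lt.1 fun h => hcon i ⟨ih, h⟩
  have := key (Fin.last k)
  rw [hp.last] at this
  exact absurd hx.2 (not_lt.2 this)

theorem _root_.CircleBreaks.IsSubdivision.mem_Icc {k : ℕ} {p : Fin (k + 1) → ℝ} (hp : IsSubdivision p)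
    (i : Fin (k + 1)) : p i ∈ Icc (0 : ℝ) 1 := by
  rw [← hp.zero, ← hp.last]
  exact ⟨hp.strictMono.monotone (Fin.zero_le _), hp.strictMono.monotone (Fin.le_last _)⟩

theorem exists_floor_mem {k : ℕ} {p : Fin (k + 1) → ℝ} (hp : IsSubdivision p) (x : ℝ) :
    ∃ (i : Fin k) (n : ℤ), x - n ∈ Ico (p i.castSucc) (p i.succ) := by
  obtain ⟨i, hi⟩ := hp.exists_mem (x := x - ⌊x⌋)
    ⟨sub_nonneg.2 (Int.floor_le x), by linarith [Int.lt_floor_add_one x]⟩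
  exact ⟨i, _, hi⟩

/-! ### Jump functions with jumps at the breaks -/

section FloorSum

variable {k : ℕ} {p : Fin (k + 1) → ℝ} {w : Fin k → ℝ}

theorem floorSum_add_one (p : Fin (k + 1) → ℝ) (w : Fin k → ℝ) (x : ℝ) :
    floorSum p w (x + 1) = floorSum p w x + ∑ i, w i := by
  unfold floorSum
  rw [← Finset.sum_add_distrib]
  refine Finset.sum_congr rfl fun i _ => ?_
  rw [show x + 1 - p i.castSucc = x - p i.castSucc + 1 by ring, Int.floor_add_one]
  push_cast; ring

theorem floorSum_mono (hw : ∀ i, 0 ≤ w i) : Monotone (floorSum p w) := fun x y h =>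
  Finset.sum_le_sum fun i _ => mul_le_mul_of_nonneg_left
    (by exact_mod_cast Int.floor_mono (by linarith)) (hw i)

theorem abs_floorSum_sub_le {x y : ℝ} (h : x ≤ y) :
    |floorSum p w y - floorSum p w x| ≤
      floorSum p (fun i => |w i|) y - floorSum p (fun i => |w i|) x := by
  unfold floorSum
  rw [← Finset.sum_sub_distrib, ← Finset.sum_sub_distrib]
  refine (Finset.abs_sum_le_sum_abs _ _).trans (Finset.sum_le_sum fun i _ => ?_)
  rw [← mul_sub, ← mul_sub, abs_mul]
  refine le_of_eq ?_
  congr 1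
  have : (⌊x - p i.castSucc⌋ : ℝ) ≤ ⌊y - p i.castSucc⌋ := by
    exact_mod_cast Int.floor_mono (by linarith)
  exact abs_of_nonneg (sub_nonneg.2 this)

theorem floor_sub_eq (hp : IsSubdivision p) (j : Fin k) {x : ℝ} (hx : x ∈ Ico (0 : ℝ) 1) :
    ⌊x - p j.castSucc⌋ = if p j.castSucc ≤ x then 0 else -1 := by
  have h0 := hp.mem_Icc j.castSucc
  have h1 : p j.castSucc < 1 := by
    rw [← hp.last]; exact hp.strictMono (Fin.castSucc_lt_last j)
  split_ifs with h
  · rw [Int.floor_eq_zero_iff]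
    exact ⟨by linarith, by linarith [hx.2, h0.1]⟩
  · rw [Int.floor_eq_iff]
    push_cast
    constructor <;> linarith [hx.1, h0.1]

theorem floorSum_eq_on_piece (hp : IsSubdivision p) (w : Fin k → ℝ) (i : Fin k) {x : ℝ}
    (hx : x ∈ Ico (p i.castSucc) (p i.succ)) :
    floorSum p w x = floorSum p w (p i.castSucc) := by
  have hi0 := hp.mem_Icc i.castSucc
  have hi1 := hp.mem_Icc i.succ
  have hlt : p i.castSucc < p i.succ := hp.strictMono Fin.castSucc_lt_succ
  unfold floorSum
  refine Finset.sum_congr rfl fun j _ => ?_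
  rw [floor_sub_eq hp j ⟨hi0.1.trans hx.1, hx.2.trans_le hi1.2⟩,
    floor_sub_eq hp j ⟨hi0.1, hlt.trans_le hi1.2⟩]
  congr 3
  refine propext ⟨fun h => ?_, fun h => h.trans hx.1⟩
  rw [hp.strictMono.le_iff_le]
  have h2 := hp.strictMono.lt_iff_lt.1 (h.trans_lt hx.2)
  rw [Fin.lt_def] at h2
  rw [Fin.le_def]
  simp at h2 ⊢
  omega

theorem floorSum_succ (hp : IsSubdivision p) (w : Fin k → ℝ) (i j : Fin k)
    (hij : j.castSucc = i.succ) :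
    floorSum p w (p i.succ) = floorSum p w (p i.castSucc) + w j := by
  have hi0 := hp.mem_Icc i.castSucc
  have hj0 := hp.mem_Icc j.castSucc
  have hlt : p i.castSucc < p i.succ := hp.strictMono Fin.castSucc_lt_succ
  have hj1 : p j.castSucc < 1 := by
    rw [← hp.last]; exact hp.strictMono (Fin.castSucc_lt_last j)
  rw [← hij] at hlt ⊢
  rw [← sub_eq_iff_eq_add']
  unfold floorSum
  rw [← Finset.sum_sub_distrib, Finset.sum_eq_single j]
  · rw [floor_sub_eq hp j ⟨hj0.1, hj1⟩, floor_sub_eq hp j ⟨hi0.1, hlt.trans hj1⟩,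
      if_pos le_rfl, if_neg (not_le.2 hlt)]
    push_cast; ring
  · intro l _ hl
    rw [floor_sub_eq hp l ⟨hj0.1, hj1⟩, floor_sub_eq hp l ⟨hi0.1, hlt.trans hj1⟩, sub_eq_zero]
    congr 3
    rw [hp.strictMono.le_iff_le, hp.strictMono.le_iff_le, Fin.le_def, Fin.le_def]
    have h1 := congrArg Fin.val hij
    have h2 : (l : ℕ) ≠ j := fun h => hl (Fin.ext h)
    simp at h1 ⊢
    omega
  · simp

/-- The right end of the last piece is `1`, a translate of the break `0`, whence the weight of index
`0`. -/
theorem floorSum_last (hp : IsSubdivision p) (w : Fin k → ℝ) (i : Fin k)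
    (hi : i.succ = Fin.last k) (hk : 0 < k) :
    floorSum p w (p i.succ) = floorSum p w (p i.castSucc) + w ⟨0, hk⟩ := by
  have hi0 := hp.mem_Icc i.castSucc
  have hlt : p i.castSucc < p i.succ := hp.strictMono Fin.castSucc_lt_succ
  rw [← sub_eq_iff_eq_add']
  rw [hi, hp.last] at hlt ⊢
  unfold floorSum
  have h1 := congrArg Fin.val hi
  simp at h1
  rw [← Finset.sum_sub_distrib, Finset.sum_eq_single ⟨0, hk⟩]
  · have e : p (Fin.castSucc ⟨0, hk⟩) = 0 := hp.zero
    rw [floor_sub_eq hp _ ⟨hi0.1, hlt⟩, e, if_pos hi0.1]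
    simp
  · intro l _ hl
    have hl0 : p l.castSucc ≤ p i.castSucc := by
      rw [hp.strictMono.le_iff_le, Fin.le_def]
      have := l.2
      simp; omega
    have hl1 : 0 < p l.castSucc := by
      rw [← hp.zero]
      apply hp.strictMono
      rw [Fin.lt_def]
      have h2 : (l : ℕ) ≠ 0 := fun h => hl (Fin.ext h)
      simp; omega
    rw [floor_sub_eq hp l ⟨hi0.1, hlt⟩, if_pos hl0]
    have : ⌊1 - p l.castSucc⌋ = 0 := by
      rw [Int.floor_eq_zero_iff]
      constructor <;> linarith
    rw [this]; simp
  · simp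

end FloorSum

/-! ### One-sided derivatives and nonlinearity of a lift with breaks -/

section Lift

variable {r : ℝ} {k : ℕ} {c : Fin k → ℝ} {F : ℝ ≃o ℝ} {p : Fin (k + 1) → ℝ}

/-- A map of class `C^r`, `r > 2`, is twice differentiable with Hölder second derivative. -/
theorem exists_second_deriv {f : ℝ → ℝ} {a b : ℝ} (hr : 2 < r) (hab : a < b)
    (hf : IsCrOn r f (Icc a b)) : ∃ f' f'' : ℝ → ℝ,
      (∀ x ∈ Icc a b, HasDerivWithinAt f (f' x) (Icc a b) x) ∧
      (∀ x ∈ Icc a b, HasDerivWithinAt f' (f'' x) (Icc a b) x) ∧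
      CrOn (min 1 (r - 2)) 0 f'' (Icc a b) := by
  have hr0 : 0 ≤ r := by linarith
  rw [isCrOn_iff hr0 hab] at hf
  obtain ⟨h0, h1⟩ := fract_exponent hr0
  have h2 : 2 ≤ ⌊r⌋₊ := Nat.le_floor (by exact_mod_cast hr.le)
  -- If `⌊r⌋ = 2` the Hölder exponent is `r - 2`. Otherwise `r ≥ 3`, and the continuous third
  -- derivative makes the second one Lipschitz.
  rcases h2.eq_or_lt with h3 | h3
  · rw [← h3] at hf h1
    obtain ⟨f', h4, f'', h5, h6⟩ := hf
    refine ⟨f', f'', h4, h5, ?_⟩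
    push_cast at h6 h1
    rwa [min_eq_right h1]
  · obtain ⟨f', h4, f'', h5, f''', h6, h7⟩ := hf.of_le h0 h1 h3
    refine ⟨f', f'', h4, h5, fun x hx => (h6 x hx).continuousWithinAt, ?_⟩
    have h8 : (3 : ℝ) ≤ r := (by exact_mod_cast h3 : (3 : ℝ) ≤ ⌊r⌋₊).trans (Nat.floor_le hr0)
    obtain ⟨M, hM, h9⟩ := exists_lipschitz h6 h7.continuousOn
    rw [min_eq_left (by linarith)]
    exact holR_of_lipschitz zero_le_one le_rfl hM h9

theorem hasDerivWithinAt_Ici_of_Icc {f : ℝ → ℝ} {d a b x : ℝ} (hx : x ∈ Ico a b)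
    (h : HasDerivWithinAt f d (Icc a b) x) : HasDerivWithinAt f d (Ici x) x :=
  h.mono_of_mem_nhdsWithin
    (Filter.mem_of_superset (Icc_mem_nhdsGE hx.2) (Icc_subset_Icc_left hx.1))

theorem hasDerivWithinAt_add_int (hF : IsDegOne F) {d x : ℝ} {n : ℤ}
    (h : HasDerivWithinAt F d (Ici (x - n)) (x - n)) : HasDerivWithinAt F d (Ici x) x := by
  have h1 : HasDerivWithinAt (fun z : ℝ => z - n) 1 (Ici x) x :=
    (hasDerivWithinAt_id x _).sub_const _
  have h2 := (h.comp x h1 (fun z hz => sub_le_sub_right (mem_Ici.1 hz) _)).add_const (n : ℝ)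
  rw [mul_one] at h2
  refine h2.congr (fun z _ => ?_) ?_
  · have := hF.add_int (z - n) n
    rwa [sub_add_cancel] at this
  · have := hF.add_int (x - n) n
    rwa [sub_add_cancel] at this

/-- The data of a piece between two breaks. -/
theorem BreakLift.piece (h : BreakLift r c F p) (hr : 2 < r) (i : Fin k) : ∃ f' f'' : ℝ → ℝ,
    (∀ x ∈ Icc (p i.castSucc) (p i.succ),
      HasDerivWithinAt F (f' x) (Icc (p i.castSucc) (p i.succ)) x) ∧
    (∀ x ∈ Icc (p i.castSucc) (p i.succ),
      HasDerivWithinAt f' (f'' x) (Icc (p i.castSucc) (p i.succ)) x) ∧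
    CrOn (min 1 (r - 2)) 0 f'' (Icc (p i.castSucc) (p i.succ)) ∧
    (∀ x ∈ Icc (p i.castSucc) (p i.succ), 0 < f' x) ∧
    (∀ x ∈ Ico (p i.castSucc) (p i.succ), logD F x = Real.log (f' x)) ∧
    (∀ x ∈ Ico (p i.castSucc) (p i.succ),
      HasDerivWithinAt (logD F) (f'' x / f' x) (Ici x) x) := by
  have hlt : p i.castSucc < p i.succ := h.sub.strictMono Fin.castSucc_lt_succ
  obtain ⟨f', f'', h1, h2, h3⟩ := exists_second_deriv hr hlt (h.cr i)
  have hu : UniqueDiffOn ℝ (Icc (p i.castSucc) (p i.succ)) := uniqueDiffOn_Icc hlt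
  have hpos : ∀ x ∈ Icc (p i.castSucc) (p i.succ), 0 < f' x := fun x hx => by
    rw [← (h1 x hx).derivWithin (hu x hx)]
    exact h.pos i x hx
  have hlog : ∀ x ∈ Ico (p i.castSucc) (p i.succ), logD F x = Real.log (f' x) := fun x hx => by
    rw [logD, (hasDerivWithinAt_Ici_of_Icc hx (h1 x (Ico_subset_Icc_self hx))).derivWithin
      (uniqueDiffOn_Ici x x self_mem_Ici)]
  refine ⟨f', f'', h1, h2, h3, hpos, hlog, fun x hx => ?_⟩
  have hx' := Ico_subset_Icc_self hx
  have h4 := hasDerivWithinAt_Ici_of_Icc hx ((h2 x hx').log (hpos x hx').ne')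
  refine h4.congr_of_eventuallyEq ?_ (hlog x hx)
  have : Ico x (p i.succ) ∈ nhdsWithin x (Ici x) := Ico_mem_nhdsGE hx.2
  filter_upwards [this] with z hz
  exact hlog z ⟨hx.1.trans hz.1, hz.2⟩

theorem BreakLift.logDeriv (h : BreakLift r c F p) (hr : 2 < r) : LogDeriv F (logD F) := by
  have key : ∀ x, ∃ d, 0 < d ∧ HasDerivWithinAt F d (Ici x) x := fun x => by
    obtain ⟨i, n, hi⟩ := exists_floor_mem h.sub x
    obtain ⟨f', f'', h1, _, _, h4, _⟩ := h.piece hr i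
    have hi' := Ico_subset_Icc_self hi
    exact ⟨f' (x - n), h4 _ hi', hasDerivWithinAt_add_int h.degOne
      (hasDerivWithinAt_Ici_of_Icc hi (h1 _ hi'))⟩
  constructor
  · intro x
    obtain ⟨d, hd, h1⟩ := key x
    rwa [logD, h1.derivWithin (uniqueDiffOn_Ici x x self_mem_Ici), Real.exp_log hd]
  · intro x
    obtain ⟨d, hd, h1⟩ := key x
    have h2 : HasDerivWithinAt F d (Ici (x + 1)) (x + 1) :=
      hasDerivWithinAt_add_int (n := 1) h.degOne (by simpa using h1)
    rw [logD, logD, h1.derivWithin (uniqueDiffOn_Ici x x self_mem_Ici),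
      h2.derivWithin (uniqueDiffOn_Ici _ _ self_mem_Ici)]

theorem logD_sub_int (hφ : LogDeriv F (logD F)) (x : ℝ) (n : ℤ) : logD F (x - n) = logD F x := by
  have := add_int_of_add_one (ν := logD F) (c := 0) (by simpa using hφ.periodic) (x - n) n
  rw [sub_add_cancel] at this
  simpa using this.symm

theorem BreakLift.hasDeriv_logD (h : BreakLift r c F p) (hr : 2 < r) (x : ℝ) :
    HasDerivWithinAt (logD F) (nonlin F x) (Ici x) x := by
  obtain ⟨i, n, hi⟩ := exists_floor_mem h.sub x
  obtain ⟨f', f'', _, _, _, _, _, h6⟩ := h.piece hr i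
  have h1 : HasDerivWithinAt (fun z : ℝ => z - n) 1 (Ici x) x :=
    (hasDerivWithinAt_id x _).sub_const _
  have h2 := (h6 _ hi).comp x h1 (fun z hz => sub_le_sub_right (mem_Ici.1 hz) _)
  have h3 : HasDerivWithinAt (logD F) _ (Ici x) x :=
    h2.congr (fun z _ => (logD_sub_int (h.logDeriv hr) z n).symm)
      (logD_sub_int (h.logDeriv hr) x n).symm
  exact h3.differentiableWithinAt.hasDerivWithinAt

theorem BreakLift.nonlin_periodic (h : BreakLift r c F p) (hr : 2 < r) (x : ℝ) (n : ℤ) :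
    nonlin F (x - n) = nonlin F x := by
  have h1 : HasDerivWithinAt (fun z : ℝ => z - n) 1 (Ici x) x :=
    (hasDerivWithinAt_id x _).sub_const _
  have h2 := (h.hasDeriv_logD hr (x - n)).comp x h1 (fun z hz => sub_le_sub_right (mem_Ici.1 hz) _)
  have h3 : HasDerivWithinAt (logD F) (nonlin F (x - n) * 1) (Ici x) x :=
    h2.congr (fun z _ => (logD_sub_int (h.logDeriv hr) z n).symm)
      (logD_sub_int (h.logDeriv hr) x n).symm
  have h4 := (h.hasDeriv_logD hr x).derivWithin (uniqueDiffOn_Ici x x self_mem_Ici)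
  rw [h3.derivWithin (uniqueDiffOn_Ici x x self_mem_Ici)] at h4
  simpa using h4

theorem measurable_nonlin (F : ℝ ≃o ℝ) : Measurable (nonlin F) := measurable_derivWithin_Ici _

theorem BreakLift.nonlin_bounded (h : BreakLift r c F p) (hr : 2 < r) :
    ∃ B : ℝ, 0 ≤ B ∧ ∀ x, |nonlin F x| ≤ B := by
  have key : ∀ i : Fin k, ∃ B : ℝ, 0 ≤ B ∧ ∀ x ∈ Ico (p i.castSucc) (p i.succ),
      |nonlin F x| ≤ B := fun i => by
    obtain ⟨f', f'', h1, h2, h3, h4, h5, h6⟩ := h.piece hr i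
    have hc : ContinuousOn (fun x => f'' x / f' x) (Icc (p i.castSucc) (p i.succ)) :=
      h3.continuousOn.div (fun x hx => (h2 x hx).continuousWithinAt) fun x hx => (h4 x hx).ne'
    obtain ⟨B, hB, hB'⟩ := exists_abs_le_of_continuousOn hc
    refine ⟨B, hB, fun x hx => ?_⟩
    rw [nonlin, (h6 x hx).derivWithin (uniqueDiffOn_Ici x x self_mem_Ici)]
    exact hB' x (Ico_subset_Icc_self hx)
  choose B hB hB' using key
  refine ⟨∑ i, B i, Finset.sum_nonneg fun i _ => hB i, fun x => ?_⟩
  obtain ⟨i, n, hi⟩ := exists_floor_mem h.sub x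
  rw [← h.nonlin_periodic hr x n]
  exact (hB' i _ hi).trans (Finset.single_le_sum (fun j _ => hB j) (Finset.mem_univ i))

theorem BreakLift.nonlin_integrable (h : BreakLift r c F p) (hr : 2 < r) (a b : ℝ) :
    IntervalIntegrable (nonlin F) MeasureTheory.volume a b := by
  obtain ⟨B, _, hB⟩ := h.nonlin_bounded hr
  refine (intervalIntegrable_const (c := B)).mono_fun
    (measurable_nonlin F).aestronglyMeasurable (Filter.Eventually.of_forall fun x => ?_)
  exact (hB x).trans (le_abs_self B)

/-- The logarithmic derivative along a piece, and its jump at the end of the piece. -/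
theorem BreakLift.logD_piece (h : BreakLift r c F p) (hr : 2 < r) (i : Fin k) :
    (∀ x ∈ Ico (p i.castSucc) (p i.succ), logD F x - floorSum p (fun j => Real.log (c j)) x =
      logD F (p i.castSucc) - floorSum p (fun j => Real.log (c j)) (p i.castSucc) +
        ∫ t in (p i.castSucc)..x, nonlin F t) ∧
    logD F (p i.succ) - floorSum p (fun j => Real.log (c j)) (p i.succ) =
      logD F (p i.castSucc) - floorSum p (fun j => Real.log (c j)) (p i.castSucc) +
        ∫ t in (p i.castSucc)..(p i.succ), nonlin F t := by
  have hlt : p i.castSucc < p i.succ := h.sub.strictMono Fin.castSucc_lt_succ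
  obtain ⟨f', f'', h1, h2, h3, h4, h5, h6⟩ := h.piece hr i
  have hφ := h.logDeriv hr
  have hcont : ContinuousOn (fun x => Real.log (f' x)) (Icc (p i.castSucc) (p i.succ)) :=
    ContinuousOn.log (fun x hx => (h2 x hx).continuousWithinAt) fun x hx => (h4 x hx).ne'
  have ftc : ∀ x ∈ Icc (p i.castSucc) (p i.succ),
      ∫ t in (p i.castSucc)..x, nonlin F t = Real.log (f' x) - logD F (p i.castSucc) := by
    intro x hx
    rw [h5 _ (left_mem_Ico.2 hlt)]
    refine intervalIntegral.integral_eq_sub_of_hasDeriv_right_of_le hx.1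
      (hcont.mono (Icc_subset_Icc_right hx.2)) (fun t ht => ?_) (h.nonlin_integrable hr _ _)
    have ht' : t ∈ Ico (p i.castSucc) (p i.succ) := ⟨ht.1.le, ht.2.trans_le hx.2⟩
    have h7 := hasDerivWithinAt_Ici_of_Icc ht' ((h2 t (Ico_subset_Icc_self ht')).log
      (h4 t (Ico_subset_Icc_self ht')).ne')
    rw [nonlin, (h6 t ht').derivWithin (uniqueDiffOn_Ici t t self_mem_Ici)]
    exact h7.mono Ioi_subset_Ici_self
  refine ⟨fun x hx => ?_, ?_⟩
  · rw [ftc x (Ico_subset_Icc_self hx), h5 x hx, floorSum_eq_on_piece h.sub _ i hx]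
    ring
  · rw [ftc _ (right_mem_Icc.2 hlt.le)]
    have hright := right_mem_Icc.2 hlt.le
    have hleft : HasDerivWithinAt F (f' (p i.succ)) (Iic (p i.succ)) (p i.succ) :=
      (h1 _ hright).mono_of_mem_nhdsWithin (Icc_mem_nhdsLE hlt)
    have hk : 0 < k := Fin.pos i
    -- `f'` at the right end is the left derivative there, whereas `logD` uses the right one; the
    -- size of the break is their ratio.
    have jump : ∀ j : Fin k, logD F (p j.castSucc) = logD F (p i.succ) →
        HasDerivWithinAt F (f' (p i.succ)) (Iic (p j.castSucc)) (p j.castSucc) →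
        logD F (p i.succ) = Real.log (f' (p i.succ)) + Real.log (c j) := by
      intro j hj hd
      rw [← hj, ← h.jump j, hd.derivWithin (uniqueDiffOn_Iic _ _ self_mem_Iic),
        Real.log_div _ (h4 _ hright).ne', logD]
      · ring
      · rw [(hφ.hasDeriv _).derivWithin (uniqueDiffOn_Ici _ _ self_mem_Ici)]
        exact (Real.exp_pos _).ne'
    rcases Fin.eq_castSucc_or_eq_last i.succ with ⟨j, hj⟩ | hl
    · rw [floorSum_succ h.sub _ i j hj.symm, jump j (by rw [hj]) (by rw [← hj]; exact hleft)]
      ring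
    · rw [floorSum_last h.sub _ i hl hk]
      have e0 : p (Fin.castSucc ⟨0, hk⟩) = 0 := h.sub.zero
      have e1 : p i.succ = 1 := by rw [hl, h.sub.last]
      rw [jump ⟨0, hk⟩]
      · ring
      · rw [e0, e1, ← hφ.periodic 0, zero_add]
      · rw [e0]
        -- The left derivative at `1` is carried to the break `0`, where the size `c 0` is
        -- prescribed.
        have g1 : HasDerivWithinAt (fun z : ℝ => z + 1) 1 (Iic 0) 0 :=
          (hasDerivWithinAt_id 0 _).add_const _
        rw [e1] at hleft ⊢
        have g2 := (HasDerivWithinAt.comp (0 : ℝ) (h₂ := F) (s' := Iic 1)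
          (by simpa using hleft) g1 (fun z hz => by
            have := mem_Iic.1 hz
            exact mem_Iic.2 (by linarith))).sub_const 1
        rw [mul_one] at g2
        refine g2.congr (fun z _ => ?_) ?_
        · simp [h.degOne z]
        · have := h.degOne 0
          simp only [Function.comp]
          linarith

/-- The logarithmic derivative is the sum of a jump function and the integral of the
nonlinearity. -/
theorem BreakLift.logD_sub (h : BreakLift r c F p) (hr : 2 < r) :
    ∫ t in (0 : ℝ)..1, nonlin F t = -∑ i, Real.log (c i) ∧
    ∀ x y, logD F y - logD F x = (floorSum p (fun j => Real.log (c j)) y -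
      floorSum p (fun j => Real.log (c j)) x) + ∫ t in x..y, nonlin F t := by
  set κ := floorSum p (fun j => Real.log (c j)) with hκ
  have hφ := h.logDeriv hr
  have hint := h.nonlin_integrable hr
  have hp : ∀ i, logD F (p i) - κ (p i) = logD F 0 - κ 0 + ∫ t in (0 : ℝ)..(p i), nonlin F t := by
    intro i
    induction i using Fin.induction with
    | zero => rw [h.sub.zero]; simp
    | succ i ih =>
      rw [(h.logD_piece hr i).2, ← hκ, ih, add_assoc,
        intervalIntegral.integral_add_adjacent_intervals (hint _ _) (hint _ _)]
  have h01 : ∀ x ∈ Ico (0 : ℝ) 1,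
      logD F x - κ x = logD F 0 - κ 0 + ∫ t in (0 : ℝ)..x, nonlin F t := by
    intro x hx
    obtain ⟨i, hi⟩ := h.sub.exists_mem hx
    rw [(h.logD_piece hr i).1 x hi, ← hκ, hp, add_assoc,
        intervalIntegral.integral_add_adjacent_intervals (hint _ _) (hint _ _)]
  have hκ1 : ∀ x, κ (x + 1) = κ x + ∑ i, Real.log (c i) := floorSum_add_one p _
  -- `logD` is periodic, so over a period the integral of the nonlinearity cancels the jumps.
  have hone : ∫ t in (0 : ℝ)..1, nonlin F t = -∑ i, Real.log (c i) := by
    have h1 := hp (Fin.last k)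
    have h2 := hφ.periodic 0
    have h3 := hκ1 0
    rw [zero_add] at h2 h3
    rw [h.sub.last, h2, h3] at h1
    linarith
  refine ⟨hone, ?_⟩
  have hper : Function.Periodic (nonlin F) 1 := fun x => by
    have := h.nonlin_periodic hr (x + 1) 1
    simpa using this.symm
  have hall : ∀ x, logD F x - κ x = logD F 0 - κ 0 + ∫ t in (0 : ℝ)..x, nonlin F t := by
    intro x
    have hΘ : ∀ z, logD F (z + 1) - κ (z + 1) - ∫ t in (0 : ℝ)..(z + 1), nonlin F t =
        logD F z - κ z - (∫ t in (0 : ℝ)..z, nonlin F t) + 0 := by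
      intro z
      rw [hφ.periodic, hκ1, ← intervalIntegral.integral_add_adjacent_intervals (hint 0 z)
        (hint z (z + 1)), hper.intervalIntegral_add_eq z 0, zero_add, hone]
      ring
    have h1 := add_int_of_add_one
      (ν := fun z => logD F z - κ z - ∫ t in (0 : ℝ)..z, nonlin F t) (c := 0) hΘ (x - ⌊x⌋) ⌊x⌋
    have h2 := h01 (x - ⌊x⌋)
      ⟨sub_nonneg.2 (Int.floor_le x), by linarith [Int.lt_floor_add_one x]⟩
    simp only [sub_add_cancel] at h1
    linarith
  intro x y
  have h1 := hall x
  have h2 := hall y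
  rw [← intervalIntegral.integral_add_adjacent_intervals (hint 0 x) (hint x y)] at h2
  linarith

/-- Denjoy's argument: `ν` dominates the variation of `φ`, and its increments over disjoint levels
add up to at most its increment `V` over a period. -/
theorem dist_of_bound {θ V : ℝ} {s : St} {φ ν : ℝ → ℝ} (hν : Monotone ν)
    (hV : ∀ x, ν (x + 1) = ν x + V) (hb : ∀ x y, x ≤ y → |φ y - φ x| ≤ ν y - ν x)
    (h : RotOrder F θ) (hs : s.Valid θ) (ht : s.Tower F) : s.Dist F φ V := by
  have key : ∀ (i : ℕ) (x w : ℝ), x ≤ w →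
      |bsum F φ i w - bsum F φ i x| ≤ bsum F ν i w - bsum F ν i x := by
    intro i x w hxw
    unfold bsum
    rw [← Finset.sum_sub_distrib, ← Finset.sum_sub_distrib]
    exact (Finset.abs_sum_le_sum_abs _ _).trans
      (Finset.sum_le_sum fun j _ => hb _ _ ((F ^ j).monotone hxw))
  exact fun x w hxw => ⟨fun hw i hi => (key i x w hxw).trans
      (ht.bsum_sub_le_P hs h hν hV hi le_rfl hxw hw),
    fun hw i hi => (key i x w hxw).trans (ht.bsum_sub_le_Q hs h hν hV hi le_rfl hxw hw)⟩

theorem abs_integral_le {f : ℝ → ℝ} {B x y : ℝ} (hB : ∀ t, |f t| ≤ B) (hxy : x ≤ y) :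
    |∫ t in x..y, f t| ≤ B * (y - x) := by
  have := intervalIntegral.norm_integral_le_of_norm_le_const (a := x) (b := y) (f := f) (C := B)
    fun t _ => hB t
  rwa [abs_of_nonneg (sub_nonneg.2 hxy)] at this

/-- The distortion is bounded. -/
theorem BreakLift.exists_dist (h : BreakLift r c F p) (hr : 2 < r) {θ : ℝ} (ho : RotOrder F θ) (hv : ∀ s, (rst θ s).Valid θ) :
    ∃ V, ∀ s, (rst θ s).Dist F (logD F) V := by
  obtain ⟨B, hB, hB'⟩ := h.nonlin_bounded hr
  set w : Fin k → ℝ := fun j => |Real.log (c j)|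
  -- This `V` depends on the map through `B`. It serves for ergodicity and for multiplicative
  -- constants, but not for the rate.
  refine ⟨B + ∑ j, w j, fun s => dist_of_bound (ν := fun x => B * x + floorSum p w x)
    ?_ ?_ ?_ ho (hv s) (rst_tower ho.degOne s)⟩
  · exact (monotone_id.const_mul hB).add (floorSum_mono fun j => abs_nonneg _)
  · intro x
    rw [floorSum_add_one]; ring
  · intro x y hxy
    rw [(h.logD_sub hr).2 x y]
    refine (abs_add_le _ _).trans ?_
    have h1 := abs_floorSum_sub_le (p := p) (w := fun j => Real.log (c j)) hxy
    have h2 := abs_integral_le hB' hxy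
    linarith

/-- The bound of `xr` on intervals without breaks. -/
theorem BreakLift.xr_le (h : BreakLift r c F p) (hr : 2 < r) : ∃ C : ℝ, 0 ≤ C ∧
    ∀ (i : Fin k) (n : ℤ) (x y : ℝ), x < y → x - n ∈ Ico (p i.castSucc) (p i.succ) →
      y - n ∈ Ico (p i.castSucc) (p i.succ) →
      |xr F (logD F) x y| ≤ C * (y - x) ^ (1 + min 1 (r - 2)) := by
  have hδ : 0 < min 1 (r - 2) := lt_min one_pos (by linarith)
  have key : ∀ i : Fin k, ∃ C : ℝ, 0 ≤ C ∧ ∀ x ∈ Ico (p i.castSucc) (p i.succ),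
      ∀ y ∈ Ico (p i.castSucc) (p i.succ), x < y →
      |xr F (logD F) x y| ≤ C * (y - x) ^ (1 + min 1 (r - 2)) := fun i => by
    obtain ⟨f', f'', h1, h2, h3, h4, h5, _⟩ := h.piece hr i
    obtain ⟨C, hC, hC'⟩ := xr_bound hδ (min_le_left _ _) h1 h2 h3 h4
    refine ⟨C, hC, fun x hx y hy hxy => ?_⟩
    have := hC' x (Ico_subset_Icc_self hx) y (Ico_subset_Icc_self hy) hxy
    rwa [xr, ← h5 x hx, ← h5 y hy] at this
  choose C hC hC' using key
  refine ⟨∑ i, C i, Finset.sum_nonneg fun i _ => hC i, fun i n x y hxy hx hy => ?_⟩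
  have e : xr F (logD F) x y = xr F (logD F) (x - n) (y - n) := by
    have e1 : ∀ z : ℝ, F z = F (z - n) + n := fun z => by
      rw [← h.degOne.add_int, sub_add_cancel]
    rw [xr, xr, logD_sub_int (h.logDeriv hr), logD_sub_int (h.logDeriv hr), e1 x, e1 y]
    congr 5 <;> ring
  rw [e]
  refine (hC' i _ hx _ hy (by linarith)).trans ?_
  rw [sub_sub_sub_cancel_right]
  refine mul_le_mul_of_nonneg_right
    (Finset.single_le_sum (fun j _ => hC j) (Finset.mem_univ i)) ?_
  exact Real.rpow_nonneg (by linarith) _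

end Lift

end BreakRenorm

namespace BreakRenorm

open MeasureTheory Filter Topology

/-! ## Ergodicity with respect to the Lebesgue measure -/

section Change

variable {G : ℝ ≃o ℝ} {ψ : ℝ → ℝ}

theorem integrableOn_exp (hd : ∀ x, HasDerivWithinAt G (Real.exp (ψ x)) (Ici x) x) (x y : ℝ) :
    IntegrableOn (fun t => Real.exp (ψ t)) (Ioc x y) :=
  intervalIntegral.integrableOn_deriv_right_of_nonneg G.continuous.continuousOn
    (fun z _ => (hasDerivWithinAt_Ioi_iff_Ici).2 (hd z)) fun _ _ => (Real.exp_pos _).le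

theorem measurableEmbedding_symm (G : ℝ ≃o ℝ) : MeasurableEmbedding G.symm :=
  G.symm.toHomeomorph.measurableEmbedding

theorem preimage_symm_Ioc (G : ℝ ≃o ℝ) (x y : ℝ) :
    G.symm ⁻¹' Ioc x y = Ioc (G x) (G y) := by
  ext z
  simp

/-- Only right derivatives are available, so the change of variables is read off on half-open
intervals from the fundamental theorem of calculus for right derivatives. -/
theorem map_symm_volume
    (hd : ∀ x, HasDerivWithinAt G (Real.exp (ψ x)) (Ici x) x) :
    Measure.map G.symm volume =
      (volume : Measure ℝ).withDensity fun x => ENNReal.ofReal (Real.exp (ψ x)) := by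
  symm
  have hval : ∀ a b : ℝ, a < b → ((volume : Measure ℝ).withDensity fun x =>
      ENNReal.ofReal (Real.exp (ψ x))) (Ioc a b) = ENNReal.ofReal (G b - G a) := by
    intro a b hab
    rw [withDensity_apply _ measurableSet_Ioc,
      ← ofReal_integral_eq_lintegral_ofReal (integrableOn_exp hd a b)
        (Eventually.of_forall fun t => (Real.exp_pos _).le),
      ← intervalIntegral.integral_of_le hab.le,
      intervalIntegral.integral_eq_sub_of_hasDeriv_right_of_le hab.le
        G.continuous.continuousOn (fun z _ => (hasDerivWithinAt_Ioi_iff_Ici).2 (hd z))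
        ((intervalIntegrable_iff_integrableOn_Ioc_of_le hab.le).2 (integrableOn_exp hd a b))]
  have : IsLocallyFiniteMeasure ((volume : Measure ℝ).withDensity fun x =>
      ENNReal.ofReal (Real.exp (ψ x))) := by
    refine ⟨fun x => ⟨Ioc (x - 1) (x + 1), Ioc_mem_nhds (by linarith) (by linarith), ?_⟩⟩
    rw [hval _ _ (by linarith)]
    exact ENNReal.ofReal_lt_top
  refine Measure.ext_of_Ioc _ _ fun a b hab => ?_
  rw [hval a b hab, (measurableEmbedding_symm G).map_apply]
  rw [preimage_symm_Ioc, Real.volume_Ioc]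

/-- The density in `map_symm_volume` is positive, so `G` pulls null sets back to null sets. -/
theorem ae_comp (hψ : Measurable ψ)
    (hd : ∀ x, HasDerivWithinAt G (Real.exp (ψ x)) (Ici x) x) {p : ℝ → Prop}
    (hp : ∀ᵐ t, p t) : ∀ᵐ t, p (G t) := by
  have h1 : (volume : Measure ℝ) ≪ Measure.map G.symm volume := by
    rw [map_symm_volume hd]
    exact withDensity_absolutelyContinuous' (by fun_prop)
      (Eventually.of_forall fun x => by simp [Real.exp_pos])
  have h2 : ∀ᵐ t ∂(Measure.map G.symm volume), p (G t) := by
    rw [(measurableEmbedding_symm G).ae_map_iff]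
    simpa using hp
  exact h1.ae_le h2

theorem integral_change (hψ : Measurable ψ)
    (hd : ∀ x, HasDerivWithinAt G (Real.exp (ψ x)) (Ici x) x) (g : ℝ → ℝ) {x y : ℝ}
    (hxy : x ≤ y) : ∫ t in G x..G y, g t = ∫ t in x..y, g (G t) * Real.exp (ψ t) := by
  have hpre := preimage_symm_Ioc G x y
  have h1 := (measurableEmbedding_symm G).setIntegral_map (μ := volume) (fun t => g (G t))
    (Ioc x y)
  rw [map_symm_volume hd, hpre] at h1
  rw [intervalIntegral.integral_of_le hxy, intervalIntegral.integral_of_le (G.monotone hxy)]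
  simp only [OrderIso.apply_symm_apply] at h1
  rw [← h1, setIntegral_withDensity_eq_setIntegral_toReal_smul₀ (by fun_prop)
    (Eventually.of_forall fun t => ENNReal.ofReal_lt_top) _ measurableSet_Ioc]
  refine setIntegral_congr_fun measurableSet_Ioc fun t _ => ?_
  simp [ENNReal.toReal_ofReal (Real.exp_pos _).le, mul_comm]

theorem intervalIntegrable_change (hψ : Measurable ψ)
    (hd : ∀ x, HasDerivWithinAt G (Real.exp (ψ x)) (Ici x) x) {g : ℝ → ℝ} {x y : ℝ}
    (hxy : x ≤ y) (hg : IntervalIntegrable (fun t => g (G t) * Real.exp (ψ t)) volume x y) :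
    IntervalIntegrable g volume (G x) (G y) := by
  have hpre := preimage_symm_Ioc G x y
  rw [intervalIntegrable_iff_integrableOn_Ioc_of_le hxy] at hg
  rw [intervalIntegrable_iff_integrableOn_Ioc_of_le (G.monotone hxy)]
  have h1 := (measurableEmbedding_symm G).integrableOn_map_iff (μ := volume)
    (f := fun t => g (G t)) (s := Ioc x y)
  rw [map_symm_volume hd, hpre] at h1
  have h2 : IntegrableOn g (Ioc (G x) (G y)) volume ↔
      IntegrableOn ((fun t => g (G t)) ∘ G.symm) (Ioc (G x) (G y)) volume := by
    rw [show ((fun t => g (G t)) ∘ G.symm) = g from funext fun t => by simp]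
  rw [h2, ← h1, IntegrableOn, restrict_withDensity measurableSet_Ioc,
    integrable_withDensity_iff_integrable_smul₀' (by fun_prop)
    (Eventually.of_forall fun t => ENNReal.ofReal_lt_top)]
  refine hg.congr (Eventually.of_forall fun t => ?_)
  simp [ENNReal.toReal_ofReal (Real.exp_pos _).le, mul_comm]

end Change

section Ergodic

variable {F : ℝ ≃o ℝ} {φ : ℝ → ℝ} {θ V : ℝ}

theorem measurable_bsum (hm : Measurable φ) (i : ℕ) : Measurable (bsum F φ i) := by
  unfold bsum
  exact Finset.measurable_sum _ fun j _ => hm.comp (F ^ j).continuous.measurable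

theorem ae_pow_of_ae (hφ : LogDeriv F φ) (hm : Measurable φ) {g : ℝ → ℝ}
    (hg : ∀ᵐ t, g (F t) = g t) (i : ℕ) : ∀ᵐ t, g ((F ^ i) t) = g t := by
  induction i with
  | zero => simp
  | succ i ih =>
    filter_upwards [ih, ae_comp (measurable_bsum hm i) (hφ.pow i) hg] with t h1 h2
    rw [pow_succ']
    exact h2.trans h1

/-- Transport of a small proportion along a tower: distortion enlarges the integral of the invariant
`g` by at most `exp V` relative to the left end and shrinks the length by at most the same factor,
hence `exp (2 * V)`. -/
theorem increment_pow_le (hφ : LogDeriv F φ) (hm : Measurable φ) {g : ℝ → ℝ} (hgm : Measurable g)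
    (hg0 : ∀ t, 0 ≤ g t) (hg1 : ∀ t, g t ≤ 1) (hg : ∀ᵐ t, g (F t) = g t) {x y ε : ℝ} {i : ℕ}
    (hxy : x ≤ y) (hV : ∀ w ∈ Icc x y, |bsum F φ i w - bsum F φ i x| ≤ V)
    (hε : ∫ t in x..y, g t ≤ ε * (y - x)) (hε0 : 0 ≤ ε) :
    ∫ t in (F ^ i) x..(F ^ i) y, g t ≤
      Real.exp (2 * V) * ε * ((F ^ i) y - (F ^ i) x) := by
  have hgi : ∀ a b : ℝ, IntervalIntegrable g volume a b := fun a b =>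
    (intervalIntegrable_const (c := (1 : ℝ))).mono_fun hgm.aestronglyMeasurable
      (Eventually.of_forall fun t => by
        simpa [abs_of_nonneg (hg0 t)] using hg1 t)
  rw [integral_change (measurable_bsum hm i) (hφ.pow i) g hxy]
  have e1 : ∫ t in x..y, g ((F ^ i) t) * Real.exp (bsum F φ i t) =
      ∫ t in x..y, g t * Real.exp (bsum F φ i t) := by
    refine intervalIntegral.integral_congr_ae ?_
    filter_upwards [ae_pow_of_ae hφ hm hg i] with t ht _
    rw [ht]
  have hei := integrableOn_exp (hφ.pow i) x y
  have hint : IntervalIntegrable (fun t => g t * Real.exp (bsum F φ i t)) volume x y := by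
    rw [intervalIntegrable_iff_integrableOn_Ioc_of_le hxy]
    exact hei.bdd_mul (c := 1) hgm.aestronglyMeasurable
      (Eventually.of_forall fun t => by simpa [abs_of_nonneg (hg0 t)] using hg1 t)
  have h2 : ∫ t in x..y, g t * Real.exp (bsum F φ i t) ≤
      ∫ t in x..y, Real.exp (bsum F φ i x + V) * g t := by
    refine intervalIntegral.integral_mono_on hxy hint ((hgi x y).const_mul _) fun t ht => ?_
    rw [mul_comm]
    refine mul_le_mul_of_nonneg_right (Real.exp_le_exp.2 ?_) (hg0 t)
    linarith [(abs_le.1 (hV t ht)).2]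
  rw [intervalIntegral.integral_const_mul] at h2
  have h3 := hφ.le_sub (i := i) (C := bsum F φ i x - V) hxy fun z hz => by
    linarith [(abs_le.1 (hV z (Ico_subset_Icc_self hz))).1]
  rw [e1]
  calc _ ≤ _ := h2
    _ ≤ Real.exp (bsum F φ i x + V) * (ε * (y - x)) :=
      mul_le_mul_of_nonneg_left hε (Real.exp_pos _).le
    _ = Real.exp (2 * V) * ε * (Real.exp (bsum F φ i x - V) * (y - x)) := by
      rw [show bsum F φ i x + V = 2 * V + (bsum F φ i x - V) by ring, Real.exp_add]; ring
    _ ≤ _ := mul_le_mul_of_nonneg_left h3 (by positivity)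

/-- A circle diffeomorphism with breaks is ergodic with respect to the Lebesgue measure. -/
theorem ae_mem_or_ae_notMem (hφ : LogDeriv F φ) (hm : Measurable φ) (ho : RotOrder F θ)
    (hv : ∀ s, (rst θ s).Valid θ) (hd : ∀ s, (rst θ s).Dist F φ V)
    (hD : ∀ ε > 0, ∃ s, (rst θ s).DispP F ε ∧ (rst θ s).DispQ F ε) {E : Set ℝ}
    (hE : MeasurableSet E) (hE1 : ∀ x, x + 1 ∈ E ↔ x ∈ E) (hEF : ∀ᵐ t, F t ∈ E ↔ t ∈ E) :
    (∀ᵐ t, t ∈ E) ∨ ∀ᵐ t, t ∉ E := by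
  classical
  by_cases hne : ∀ᵐ t, t ∉ E
  · exact Or.inr hne
  left
  set g : ℝ → ℝ := Eᶜ.indicator fun _ => 1 with hg
  have hgm : Measurable g := measurable_const.indicator hE.compl
  have hg0 : ∀ t, 0 ≤ g t := fun t => indicator_nonneg (fun _ _ => zero_le_one) t
  have hg1 : ∀ t, g t ≤ 1 := fun t => indicator_le_self' (fun _ _ => zero_le_one) t
  have hgF : ∀ᵐ t, g (F t) = g t := by
    filter_upwards [hEF] with t ht
    simp [hg, indicator, ht]
  have hgp : Function.Periodic g 1 := fun t => by simp [hg, indicator, hE1]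
  have hgl : LocallyIntegrable g volume :=
    (locallyIntegrable_const (1 : ℝ)).mono hgm.aestronglyMeasurable
      (Eventually.of_forall fun t => by simpa [abs_of_nonneg (hg0 t)] using hg1 t)
  have hgi : ∀ a b : ℝ, IntervalIntegrable g volume a b := fun a b =>
    (intervalIntegrable_const (c := (1 : ℝ))).mono_fun hgm.aestronglyMeasurable
      (Eventually.of_forall fun t => by
        simpa [abs_of_nonneg (hg0 t)] using hg1 t)
  set ν : ℝ → ℝ := fun y => ∫ t in (0 : ℝ)..y, g t with hν
  have hsub : ∀ x y, ν y - ν x = ∫ t in x..y, g t := fun x y =>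
    intervalIntegral.integral_interval_sub_left (hgi _ _) (hgi _ _)
  have hνm : Monotone ν := fun x y hxy => by
    have := hsub x y
    have h2 := intervalIntegral.integral_nonneg (μ := volume) hxy fun t _ => hg0 t
    linarith
  set m := ∫ t in (0 : ℝ)..1, g t with hmdef
  have hν1 : ∀ x, ν (x + 1) = ν x + m := fun x => by
    have h1 := hsub x (x + 1)
    rw [hgp.intervalIntegral_add_eq x 0, zero_add] at h1
    linarith
  have hder := LocallyIntegrable.ae_hasDerivAt_integral hgl
  -- A Lebesgue density point of `E`, which exists because `E` is not null; `ν` measures the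
  -- complement of `E`.
  obtain ⟨x, hxE, hx⟩ : ∃ x, x ∈ E ∧ HasDerivAt ν 0 x := by
    by_contra! hcon
    refine hne ?_
    filter_upwards [hder] with x hx hxE
    refine hcon x hxE ?_
    have := hx 0
    rwa [show g x = 0 by simp [hg, hxE]] at this
  have hm0 : m ≤ 0 := by
    have key : ∀ ε > 0, m ≤ Real.exp (2 * V) * ε := by
      intro ε hε
      have h1 := (hasDerivAt_iff_isLittleO.1 hx).bound hε
      obtain ⟨δ, hδ, h2⟩ := Metric.eventually_nhds_iff.1 h1
      obtain ⟨s, hP, hQ⟩ := hD (δ / 2) (by linarith)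
      set S := rst θ s
      have hvs := hv s
      have hR := S.P_R ho.degOne x
      have hRx : S.R F x < x := by
        have := hvs.lt_P ho (S.R F x)
        rwa [hR] at this
      have hxQ := hvs.lt_Q ho x
      have hRd : x - S.R F x ≤ δ / 2 := by
        have := hP (S.R F x)
        rwa [hR] at this
      have hQd := hQ x
      have hA : ∫ t in S.R F x..x, g t ≤ ε * (x - S.R F x) := by
        rw [← hsub]
        have := h2 (y := S.R F x) (by rw [Real.dist_eq, abs_lt]; constructor <;> linarith)
        simp only [smul_zero, sub_zero, Real.norm_eq_abs] at this
        rw [abs_sub_comm, abs_sub_comm (S.R F x), abs_of_nonneg (sub_nonneg.2 hRx.le)] at this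
        exact (le_abs_self _).trans this
      have hB : ∫ t in x..S.Q F x, g t ≤ ε * (S.Q F x - x) := by
        rw [← hsub]
        have := h2 (y := S.Q F x) (by rw [Real.dist_eq, abs_lt]; constructor <;> linarith)
        simp only [smul_zero, sub_zero, Real.norm_eq_abs] at this
        rw [abs_of_nonneg (sub_nonneg.2 hxQ.le)] at this
        exact (le_abs_self _).trans this
      -- The towers over `[R x, x)` and `[x, Q x)`, two short intervals at the density point, tile
      -- the circle. The tower identity for `ν` and for the length turns the proportion `ε` of the
      -- complement in the bases into at most `exp (2 * V) * ε` of the circle.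
      have ht1 := rst_tower (θ := θ) ho.degOne s ν m hν1 (S.R F x)
      have ht2 := rst_tower (θ := θ) ho.degOne s (fun z => z) 1 (fun _ => rfl) (S.R F x)
      rw [hR] at ht1 ht2
      rw [← ht1, ← mul_one (Real.exp (2 * V) * ε), ← ht2]
      unfold bsum
      rw [← Finset.sum_sub_distrib, ← Finset.sum_sub_distrib, ← Finset.sum_sub_distrib,
        ← Finset.sum_sub_distrib, mul_add, Finset.mul_sum, Finset.mul_sum]
      refine add_le_add (Finset.sum_le_sum fun i hi => ?_) (Finset.sum_le_sum fun i hi => ?_)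
      · rw [hsub]
        refine increment_pow_le hφ hm hgm hg0 hg1 hgF hRx.le (fun w hw => ?_) hA hε.le
        exact (hd s _ _ hw.1).1 (by rw [hR]; exact hw.2) i (Finset.mem_range.1 hi).le
      · rw [hsub]
        refine increment_pow_le hφ hm hgm hg0 hg1 hgF hxQ.le (fun w hw => ?_) hB hε.le
        exact (hd s _ _ hw.1).2 hw.2 i (Finset.mem_range.1 hi).le
    refine le_of_forall_pos_le_add fun η hη => ?_
    have := key (η / Real.exp (2 * V)) (by positivity)
    rw [mul_div_cancel₀ _ (Real.exp_pos _).ne'] at this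
    linarith
  have hm1 : m = 0 := le_antisymm hm0 (intervalIntegral.integral_nonneg zero_le_one fun t _ => hg0 t)
  have hconst : ∀ x, ν x = 0 := by
    have hν0 : ν 0 = 0 := intervalIntegral.integral_same
    have h2 : ∀ n : ℤ, ν n = 0 := fun n => by
      have := add_int_of_add_one hν1 0 n
      simpa [hm1, hν0] using this
    intro x
    refine le_antisymm ?_ ?_
    · rw [← h2 ⌈x⌉]; exact hνm (Int.le_ceil x)
    · rw [← h2 ⌊x⌋]; exact hνm (Int.floor_le x)
  filter_upwards [hder] with x hx
  have h1 := hx 0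
  have h2 : HasDerivAt ν 0 x := by
    rw [show ν = fun _ => 0 from funext hconst]; exact hasDerivAt_const x 0
  have h3 := h1.unique h2
  by_contra hxE
  simp [hg, hxE] at h3

end Ergodic

/-! ## Approximation by coboundaries -/

section Coboundary

variable {F : ℝ ≃o ℝ} {φ : ℝ → ℝ}

theorem ae_of_ae_Ioc {p : ℝ → Prop} (hp : ∀ (t : ℝ) (n : ℤ), p (t - n) → p t)
    (h : ∀ᵐ t ∂(volume.restrict (Ioc (0 : ℝ) 1)), p t) : ∀ᵐ t, p t := by
  rw [ae_restrict_iff' measurableSet_Ioc] at h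
  have h2 : ∀ n : ℤ, ∀ᵐ t : ℝ, (t - n) ∈ Ioc (0 : ℝ) 1 → p (t - n) := fun n =>
    (measurePreserving_sub_right volume (n : ℝ)).quasiMeasurePreserving.ae h
  filter_upwards [ae_all_iff.2 h2] with t ht
  refine hp t (⌈t⌉ - 1) (ht _ ?_)
  push_cast
  constructor <;> linarith [Int.le_ceil t, Int.ceil_lt_add_one t]

/-- The transfer coboundary of `k`. -/
noncomputable def cobound (F : ℝ ≃o ℝ) (φ k : ℝ → ℝ) (t : ℝ) : ℝ := k t - k (F t) * Real.exp (φ t)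

/-- Bounded measurable functions of period one. -/
structure IsBddPeriodic (k : ℝ → ℝ) : Prop where
  meas : Measurable k
  bdd : ∃ K, ∀ t, |k t| ≤ K
  per : Function.Periodic k 1

theorem IsBddPeriodic.add {k l : ℝ → ℝ} (hk : IsBddPeriodic k) (hl : IsBddPeriodic l) :
    IsBddPeriodic (k + l) := by
  obtain ⟨K, hK⟩ := hk.bdd
  obtain ⟨L, hL⟩ := hl.bdd
  exact ⟨hk.meas.add hl.meas, ⟨K + L, fun t => (abs_add_le _ _).trans (add_le_add (hK t) (hL t))⟩,
    hk.per.add hl.per⟩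

theorem IsBddPeriodic.smul {k : ℝ → ℝ} (hk : IsBddPeriodic k) (c : ℝ) :
    IsBddPeriodic (c • k) := by
  obtain ⟨K, hK⟩ := hk.bdd
  refine ⟨hk.meas.const_smul c, ⟨|c| * K, fun t => ?_⟩, hk.per.smul c⟩
  simp only [Pi.smul_apply, smul_eq_mul, abs_mul]
  exact mul_le_mul_of_nonneg_left (hK t) (abs_nonneg c)

theorem IsBddPeriodic.intervalIntegrable {k : ℝ → ℝ} (hk : IsBddPeriodic k) (a b : ℝ) :
    IntervalIntegrable k volume a b := by
  obtain ⟨K, hK⟩ := hk.bdd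
  exact (intervalIntegrable_const (c := K)).mono_fun hk.meas.aestronglyMeasurable
    (Eventually.of_forall fun t => (hK t).trans (le_abs_self K))

theorem IsBddPeriodic.cobound {k : ℝ → ℝ} (hk : IsBddPeriodic k) (hF : IsDegOne F)
    (hφ : IsBddPeriodic φ) : IsBddPeriodic (cobound F φ k) := by
  obtain ⟨K, hK⟩ := hk.bdd
  obtain ⟨B, hB⟩ := hφ.bdd
  refine ⟨hk.meas.sub ((hk.meas.comp F.continuous.measurable).mul hφ.meas.exp),
    ⟨K + K * Real.exp B, fun t => ?_⟩, fun t => ?_⟩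
  · refine (abs_sub _ _).trans (add_le_add (hK t) ?_)
    rw [abs_mul, Real.abs_exp]
    exact mul_le_mul (hK _) (Real.exp_le_exp.2 ((le_abs_self _).trans (hB t))) (Real.exp_pos _).le
      ((abs_nonneg _).trans (hK t))
  · simp only [BreakRenorm.cobound]
    rw [hF, hk.per, hk.per, hφ.per]

theorem IsBddPeriodic.memLp {k : ℝ → ℝ} (hk : IsBddPeriodic k) :
    MemLp k 2 (volume.restrict (Ioc (0 : ℝ) 1)) := by
  obtain ⟨K, hK⟩ := hk.bdd
  exact MemLp.of_bound hk.meas.aestronglyMeasurable K (Eventually.of_forall hK)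

/-- The space of coboundaries in `L²`. -/
noncomputable def coboundaries (F : ℝ ≃o ℝ) (φ : ℝ → ℝ) :
    Submodule ℝ (Lp ℝ 2 (volume.restrict (Ioc (0 : ℝ) 1))) where
  carrier := {g | ∃ k, IsBddPeriodic k ∧ g =ᵐ[volume.restrict (Ioc (0 : ℝ) 1)] cobound F φ k}
  add_mem' := by
    rintro g₁ g₂ ⟨k₁, h₁, e₁⟩ ⟨k₂, h₂, e₂⟩
    refine ⟨k₁ + k₂, h₁.add h₂, ?_⟩
    filter_upwards [Lp.coeFn_add g₁ g₂, e₁, e₂] with t h h1 h2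
    rw [h, Pi.add_apply, h1, h2]
    simp only [cobound, Pi.add_apply]
    ring
  zero_mem' := by
    refine ⟨0, ⟨measurable_const, ⟨0, by simp⟩, fun _ => rfl⟩, ?_⟩
    filter_upwards [Lp.coeFn_zero ℝ 2 (volume.restrict (Ioc (0 : ℝ) 1))] with t h
    rw [h]
    simp [cobound]
  smul_mem' := by
    rintro c g ⟨k, hk, e⟩
    refine ⟨c • k, hk.smul c, ?_⟩
    filter_upwards [Lp.coeFn_smul c g, e] with t h h1
    rw [h, Pi.smul_apply, h1]
    simp only [cobound, Pi.smul_apply, smul_eq_mul]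
    ring

/-- A change of variables turns the orthogonality into `∫ (H - H ∘ F⁻¹) * k = 0`. Since `H` need not
be bounded while test functions must be, `g = H - H ∘ F⁻¹` is tested against `g / (1 + |g|)`, which
leaves the nonnegative integrand `g ^ 2 / (1 + |g|)`. -/
theorem ae_eq_comp_of_integral_cobound (hF : IsDegOne F) (hφd : LogDeriv F φ)
    (hφ : IsBddPeriodic φ) {H : ℝ → ℝ} (hH : Measurable H) (hper : Function.Periodic H 1)
    (hint : IntervalIntegrable H volume 0 1)
    (horth : ∀ k, IsBddPeriodic k → ∫ t in (0 : ℝ)..1, H t * cobound F φ k t = 0) :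
    ∀ᵐ t, H (F t) = H t := by
  have hd : ∀ x, HasDerivWithinAt F (Real.exp (φ x)) (Ici x) x := hφd.hasDeriv
  have hint' : ∀ a b, IntervalIntegrable H volume a b :=
    hper.intervalIntegrable one_ne_zero (t := 0) (by simpa using hint)
  obtain ⟨B, hB⟩ := hφ.bdd
  set Hs : ℝ → ℝ := fun t => H (F.symm t) with hHs
  have hHsm : Measurable Hs := hH.comp F.symm.continuous.measurable
  have hHsp : Function.Periodic Hs 1 := fun t => by
    have := hF.symm_add_int t 1
    simp only [Int.cast_one] at this
    simp only [hHs, this, hper _]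
  have hHsi : IntervalIntegrable Hs volume 0 1 := by
    have := intervalIntegrable_change (g := Hs) hφ.meas hd
      (F.symm.monotone (zero_le_one (α := ℝ))) ?_
    · simpa using this
    · simp only [hHs, OrderIso.symm_apply_apply]
      have h1 := hint' (F.symm 0) (F.symm 1)
      rw [intervalIntegrable_iff] at h1 ⊢
      simp_rw [mul_comm (H _)]
      exact Integrable.bdd_mul (c := Real.exp B) h1 hφ.meas.exp.aestronglyMeasurable
        (Eventually.of_forall fun t => by
          rw [Real.norm_eq_abs, Real.abs_exp]
          exact Real.exp_le_exp.2 ((le_abs_self _).trans (hB t)))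
  set g : ℝ → ℝ := fun t => H t - Hs t with hg
  have hgm : Measurable g := hH.sub hHsm
  set k : ℝ → ℝ := fun t => g t / (1 + |g t|) with hk
  have hk1 : ∀ t, |k t| ≤ 1 := fun t => by
    have h0 : 0 < 1 + |g t| := by positivity
    rw [hk, abs_div, abs_of_pos h0, div_le_one h0]
    linarith
  have hkb : IsBddPeriodic k := by
    refine ⟨hgm.div (measurable_const.add (continuous_abs.measurable.comp hgm)), ⟨1, hk1⟩, ?_⟩
    intro t
    simp only [hk, hg, hper t, hHsp t]
  have hmk : ∀ {f : ℝ → ℝ} {a b : ℝ}, IntervalIntegrable f volume a b →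
      ∀ {l : ℝ → ℝ}, Measurable l → ∀ K, (∀ t, |l t| ≤ K) →
      IntervalIntegrable (fun t => f t * l t) volume a b := by
    intro f a b hf l hl K hK
    rw [intervalIntegrable_iff] at hf ⊢
    simp_rw [mul_comm (f _)]
    exact Integrable.bdd_mul (c := K) hf hl.aestronglyMeasurable (Eventually.of_forall hK)
  have hsplit : ∫ t in (0 : ℝ)..1, H t * cobound F φ k t =
      (∫ t in (0 : ℝ)..1, H t * k t) - ∫ t in (0 : ℝ)..1, Hs t * k t := by
    have e1 : ∫ t in (0 : ℝ)..1, Hs t * k t =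
        ∫ t in (0 : ℝ)..1, H t * (k (F t) * Real.exp (φ t)) := by
      have hp : Function.Periodic (fun t => Hs t * k t) 1 := hHsp.mul hkb.per
      have h2 := hp.intervalIntegral_add_eq (F 0) 0
      rw [← hF 0, zero_add] at h2
      rw [← h2, integral_change hφ.meas hd _ zero_le_one]
      simp only [hHs, OrderIso.symm_apply_apply, mul_assoc]
    rw [e1, ← intervalIntegral.integral_sub (hmk hint hkb.meas 1 hk1)]
    · simp only [cobound, mul_sub]
    · refine hmk hint ((hkb.meas.comp F.continuous.measurable).mul hφ.meas.exp)
        (1 * Real.exp B) fun t => ?_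
      simp only [abs_mul, Real.abs_exp]
      exact mul_le_mul (hk1 _) (Real.exp_le_exp.2 ((le_abs_self _).trans (hB t)))
        (Real.exp_pos _).le zero_le_one
  rw [horth k hkb, ← intervalIntegral.integral_sub (hmk hint hkb.meas 1 hk1)
    (hmk hHsi hkb.meas 1 hk1)] at hsplit
  have hgk : ∀ t, H t * k t - Hs t * k t = g t ^ 2 / (1 + |g t|) := fun t => by
    simp only [hk, hg]; ring
  have hae := (intervalIntegral.integral_eq_zero_iff_of_nonneg_ae
    (f := fun t => H t * k t - Hs t * k t) (μ := volume) (a := 0) (b := 1)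
    (Eventually.of_forall fun t => by
      show 0 ≤ H t * k t - Hs t * k t
      rw [hgk]; positivity)
    ((hmk hint hkb.meas 1 hk1).sub (hmk hHsi hkb.meas 1 hk1))).1 hsplit.symm
  rw [Ioc_eq_empty (by norm_num : ¬ (1 : ℝ) < 0), union_empty] at hae
  have h1 : ∀ᵐ t ∂(volume.restrict (Ioc (0 : ℝ) 1)), g t = 0 := by
    filter_upwards [hae] with t ht
    have ht' : H t * k t - Hs t * k t = 0 := ht
    rw [hgk, div_eq_zero_iff] at ht'
    rcases ht' with h | h
    · exact pow_eq_zero_iff two_ne_zero |>.1 h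
    · exact absurd h (by positivity)
  have h2 : ∀ᵐ t, g t = 0 := ae_of_ae_Ioc (fun t n h => by
    have hgp : Function.Periodic g 1 := hper.sub hHsp
    rwa [← mul_one (n : ℝ), hgp.sub_int_mul_eq] at h) h1
  filter_upwards [ae_comp hφ.meas hd h2] with t ht
  simpa [hg, hHs, sub_eq_zero] using ht

theorem ae_fract_eq (h : ℝ → ℝ) :
    ∀ᵐ t ∂(volume.restrict (Ioc (0 : ℝ) 1)), h (Int.fract t) = h t := by
  rw [← restrict_Ioo_eq_restrict_Ioc, ae_restrict_iff' measurableSet_Ioo]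
  exact Eventually.of_forall fun t ht => by rw [Int.fract_eq_self.2 ⟨ht.1.le, ht.2⟩]

/-- The periodic extension is invariant almost everywhere, so preimages of measurable sets are null
or conull by ergodicity, which forces a constant. -/
theorem ae_const_of_mem_orthogonal (hF : IsDegOne F) (hφd : LogDeriv F φ)
    (hφ : IsBddPeriodic φ)
    (herg : ∀ E : Set ℝ, MeasurableSet E → (∀ x, x + 1 ∈ E ↔ x ∈ E) → (∀ᵐ t, F t ∈ E ↔ t ∈ E) →
      (∀ᵐ t, t ∈ E) ∨ ∀ᵐ t, t ∉ E)
    {h : Lp ℝ 2 (volume.restrict (Ioc (0 : ℝ) 1))} (hh : h ∈ (coboundaries F φ)ᗮ) :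
    ∃ a, ∀ᵐ t ∂(volume.restrict (Ioc (0 : ℝ) 1)), h t = a := by
  have hhm : Measurable (h : ℝ → ℝ) := (Lp.stronglyMeasurable h).measurable
  set H : ℝ → ℝ := fun t => h (Int.fract t) with hHdef
  have hH : Measurable H := hhm.comp measurable_fract
  have hper : Function.Periodic H 1 := fun t => by simp [hHdef]
  have hHh := ae_fract_eq h
  have hint : IntervalIntegrable H volume 0 1 := by
    rw [intervalIntegrable_iff_integrableOn_Ioc_of_le zero_le_one]
    exact ((Lp.memLp h).integrable one_le_two).congr (hHh.mono fun t ht => ht.symm)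
  have horth : ∀ k, IsBddPeriodic k → ∫ t in (0 : ℝ)..1, H t * cobound F φ k t = 0 := by
    intro k hk
    have hc := hk.cobound hF hφ
    have h1 : hc.memLp.toLp _ ∈ coboundaries F φ := ⟨k, hk, hc.memLp.coeFn_toLp⟩
    have h2 := Submodule.inner_right_of_mem_orthogonal h1 hh
    rw [L2.inner_def] at h2
    rw [intervalIntegral.integral_of_le zero_le_one]
    refine Eq.trans (integral_congr_ae ?_) h2
    filter_upwards [hHh, hc.memLp.coeFn_toLp] with t h3 h4
    simp only [hHdef]
    rw [h3, h4]
    simp [mul_comm]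
  have hinv := ae_eq_comp_of_integral_cobound hF hφd hφ hH hper hint horth
  obtain ⟨a, ha⟩ := exists_eventuallyEq_const_of_forall_separating (l := ae volume) (f := H)
    MeasurableSet fun U hU => by
      refine herg (H ⁻¹' U) (hH hU) (fun x => by simp only [mem_preimage, hper x]) ?_
      filter_upwards [hinv] with t ht
      simp only [mem_preimage, ht]
  refine ⟨a, ?_⟩
  filter_upwards [hHh, ae_restrict_of_ae ha] with t h1 h2
  rw [← h1]; exact h2

/-- Up to its mean, a bounded function is approximated by coboundaries. -/
theorem exists_cobound_near (hF : IsDegOne F) (hφd : LogDeriv F φ)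
    (hφ : IsBddPeriodic φ)
    (herg : ∀ E : Set ℝ, MeasurableSet E → (∀ x, x + 1 ∈ E ↔ x ∈ E) → (∀ᵐ t, F t ∈ E ↔ t ∈ E) →
      (∀ᵐ t, t ∈ E) ∨ ∀ᵐ t, t ∉ E)
    {η : ℝ → ℝ} (hη : IsBddPeriodic η) {ε : ℝ} (hε : 0 < ε) :
    ∃ k, IsBddPeriodic k ∧
      ∫ t in (0 : ℝ)..1, |η t - (∫ u in (0 : ℝ)..1, η u) - cobound F φ k t| ≤ ε := by
  set μ := volume.restrict (Ioc (0 : ℝ) 1) with hμ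
  have hprob : IsProbabilityMeasure μ := ⟨by simp [hμ]⟩
  set a := ∫ u in (0 : ℝ)..1, η u with ha
  have hζ : IsBddPeriodic fun t => η t - a := by
    obtain ⟨K, hK⟩ := hη.bdd
    exact ⟨hη.meas.sub_const a, ⟨K + |a|, fun t => (abs_sub _ _).trans (by linarith [hK t])⟩,
      fun t => by simp only [hη.per t]⟩
  set z := hζ.memLp.toLp _ with hz
  -- The orthogonal complement of the coboundaries consists of constants, and `z` has mean zero.
  have hmem : z ∈ (coboundaries F φ)ᗮᗮ := by
    rw [Submodule.mem_orthogonal]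
    intro h hh
    obtain ⟨b, hb⟩ := ae_const_of_mem_orthogonal hF hφd hφ herg hh
    rw [L2.inner_def]
    have : ∫ t, inner ℝ (h t) (z t) ∂μ = ∫ t, b * (η t - a) ∂μ := by
      refine integral_congr_ae ?_
      filter_upwards [hb, hζ.memLp.coeFn_toLp] with t h1 h2
      rw [h1, hz, h2]
      simp [mul_comm]
    rw [this, integral_const_mul, ← intervalIntegral.integral_of_le zero_le_one,
      intervalIntegral.integral_sub (hη.intervalIntegrable 0 1) intervalIntegrable_const, ← ha]
    simp
  rw [Submodule.orthogonal_orthogonal_eq_closure] at hmem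
  obtain ⟨g, ⟨k, hk, hgk⟩, hzg⟩ := Metric.mem_closure_iff.1 hmem ε hε
  refine ⟨k, hk, ?_⟩
  have hc := hk.cobound hF hφ
  have hsub : (z - g : Lp ℝ 2 μ) =ᵐ[μ] fun t => η t - a - cobound F φ k t := by
    filter_upwards [Lp.coeFn_sub z g, hζ.memLp.coeFn_toLp, hgk] with t h1 h2 h3
    rw [h1, Pi.sub_apply, h3, hz, h2]
  rw [dist_eq_norm, Lp.norm_def, eLpNorm_congr_ae hsub] at hzg
  have hm : AEStronglyMeasurable (fun t => η t - a - cobound F φ k t) μ :=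
    (hζ.meas.sub hc.meas).aestronglyMeasurable
  have h1 := eLpNorm_le_eLpNorm_of_exponent_le (μ := μ) one_le_two hm
  have h2 : eLpNorm (fun t => η t - a - cobound F φ k t) 2 μ ≠ ⊤ :=
    ((hζ.memLp.sub hc.memLp).2).ne
  have h3 := ENNReal.toReal_mono h2 h1
  rw [eLpNorm_one_eq_lintegral_enorm, ← integral_norm_eq_lintegral_enorm hm] at h3
  rw [intervalIntegral.integral_of_le zero_le_one]
  exact h3.trans hzg.le

end Coboundary

/-! ## Universal bound of the distortion -/

section Universal

variable {r θ : ℝ} {k : ℕ} {c : Fin k → ℝ} {F : ℝ ≃o ℝ} {p : Fin (k + 1) → ℝ}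

theorem BreakLift.isBddPeriodic_logD (h : BreakLift r c F p) (hr : 2 < r) :
    IsBddPeriodic (logD F) := by
  obtain ⟨B, hB, hB'⟩ := h.nonlin_bounded hr
  refine ⟨Real.measurable_log.comp (measurable_derivWithin_Ici _),
    ⟨|logD F 0| + (∑ j, |Real.log (c j)| + B), fun t => ?_⟩, (h.logDeriv hr).periodic⟩
  rw [← logD_sub_int (h.logDeriv hr) t ⌊t⌋]
  set y := t - ⌊t⌋ with hy
  have hy0 : 0 ≤ y := sub_nonneg.2 (Int.floor_le t)
  have hy1 : y ≤ 1 := by rw [hy]; linarith [Int.lt_floor_add_one t]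
  have h1 := (h.logD_sub hr).2 0 y
  have h2 := abs_floorSum_sub_le (p := p) (w := fun j => Real.log (c j)) hy0
  have h3 := floorSum_mono (p := p) (w := fun j => |Real.log (c j)|) (fun j => abs_nonneg _) hy1
  have h4 := floorSum_add_one p (fun j => |Real.log (c j)|) 0
  rw [zero_add] at h4
  have h5 := abs_integral_le hB' hy0
  have h6 : B * (y - 0) ≤ B := by nlinarith
  have h7 := abs_add_le (floorSum p (fun j => Real.log (c j)) y -
    floorSum p (fun j => Real.log (c j)) 0) (∫ t in (0 : ℝ)..y, nonlin F t)
  rw [← h1] at h7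
  have h8 := abs_add_le (logD F 0) (logD F y - logD F 0)
  rw [add_sub_cancel] at h8
  linarith

theorem BreakLift.isBddPeriodic_nonlin (h : BreakLift r c F p) (hr : 2 < r) :
    IsBddPeriodic (nonlin F) := by
  obtain ⟨B, hB, hB'⟩ := h.nonlin_bounded hr
  refine ⟨measurable_nonlin F, ⟨B, hB'⟩, fun x => ?_⟩
  have := h.nonlin_periodic hr (x + 1) 1
  simpa using this.symm

theorem exists_disp_le (hφ : LogDeriv F (logD F)) (ho : RotOrder F θ)
    (hv : ∀ s, (rst θ s).Valid θ) {τ : ℕ → ℕ} (hτ : IsTimes θ τ) {V : ℝ}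
    (hd : ∀ s, (rst θ s).Dist F (logD F) V) {ε : ℝ} (hε : 0 < ε) :
    ∃ s, (rst θ s).DispP F ε ∧ (rst θ s).DispQ F ε := by
  obtain ⟨C, hC, h⟩ := disp_decay hφ ho hv hτ (t₀ := 0) fun s _ => hd s
  have h1 : Real.sqrt (ratio V) < 1 := by
    rw [Real.sqrt_lt' one_pos]
    simpa using ratio_lt_one V
  have h2 := (tendsto_pow_atTop_nhds_zero_of_lt_one (Real.sqrt_nonneg _) h1).const_mul C
  rw [mul_zero] at h2
  obtain ⟨n, hn⟩ := (h2.eventually_lt_const hε).exists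
  exact ⟨τ n, fun x => ((h n).1 x).trans hn.le, fun x => ((h n).2 x).trans hn.le⟩

theorem bsum_telescope (φ l : ℝ → ℝ) (i : ℕ) (x : ℝ) :
    bsum F (fun y => φ y - l y + l (F y)) i x = bsum F φ i x - l x + l ((F ^ i) x) := by
  induction i with
  | zero => simp [bsum]
  | succ i ih =>
    rw [bsum_succ, bsum_succ, ih, pow_succ']
    simp only [RelIso.mul_apply]
    ring

/-- The distortion is eventually bounded by a constant that depends only on the sizes of the
breaks. -/
theorem BreakLift.exists_dist_universal (h : BreakLift r c F p) (hr : 2 < r) (ho : RotOrder F θ)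
    (hv : ∀ s, (rst θ s).Valid θ) {τ : ℕ → ℕ} (hτ : IsTimes θ τ) :
    ∃ t₀, ∀ s ≥ t₀, (rst θ s).Dist F (logD F) (2 * ∑ i, |Real.log (c i)| + 1) := by
  have hφ := h.logDeriv hr
  have hb := h.isBddPeriodic_logD hr
  have hη := h.isBddPeriodic_nonlin hr
  obtain ⟨V, hV⟩ := h.exists_dist hr ho hv
  have hD := fun (ε : ℝ) (hε : ε > 0) => exists_disp_le hφ ho hv hτ hV hε
  -- The allowance of `1` in the final bound is spent as `1 / 2` for this `L^1` error and `1 / 4`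
  -- for each of the two boundary terms of the telescoping sum.
  obtain ⟨g, hg, hge⟩ := exists_cobound_near h.degOne hφ hb (fun E h1 h2 h3 =>
    ae_mem_or_ae_notMem hφ hb.meas ho hv hV hD h1 h2 h3) hη (ε := 1 / 2) one_half_pos
  obtain ⟨K, hK⟩ := hg.bdd
  have hK0 : 0 ≤ K := (abs_nonneg _).trans (hK 0)
  -- The primitive `l` of `g` will be `K`-Lipschitz, so over intervals of this length it varies by
  -- at most `1 / 4`.
  obtain ⟨t₀, hP₀, hQ₀⟩ := hD (1 / (4 * (K + 1))) (by positivity)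
  refine ⟨t₀, fun s hs => ?_⟩
  have hP := dispP_mono ho hv hs hP₀
  have hQ := dispQ_mono ho hv hs hQ₀
  set S := ∑ i, |Real.log (c i)| with hS
  set m := ∫ t in (0 : ℝ)..1, nonlin F t with hm
  have hmS : |m| ≤ S := by
    rw [hm, (h.logD_sub hr).1, abs_neg]
    exact Finset.abs_sum_le_sum_abs _ _
  set l : ℝ → ℝ := fun y => ∫ t in (0 : ℝ)..y, g t with hl
  have hlsub : ∀ u v, l v - l u = ∫ t in u..v, g t := fun u v =>
    intervalIntegral.integral_interval_sub_left (hg.intervalIntegrable _ _)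
      (hg.intervalIntegrable _ _)
  have hllip : ∀ u v, u ≤ v → |l v - l u| ≤ K * (v - u) := fun u v huv => by
    rw [hlsub]; exact abs_integral_le hK huv
  have hc := hg.cobound h.degOne hb
  set e : ℝ → ℝ := fun t => nonlin F t - m - cobound F (logD F) g t with he
  have hei : ∀ a b, IntervalIntegrable e volume a b := fun a b =>
    ((hη.intervalIntegrable a b).sub intervalIntegrable_const).sub (hc.intervalIntegrable a b)
  have hep : Function.Periodic (fun t => |e t|) 1 := fun t => by
    simp only [he, hη.per t, hc.per t]
  have hea : ∀ a b, IntervalIntegrable (fun t => |e t|) volume a b := fun a b => (hei a b).abs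
  set ν : ℝ → ℝ := fun x => floorSum p (fun j => |Real.log (c j)|) x + |m| * x +
    ∫ t in (0 : ℝ)..x, |e t| with hν
  have heasub : ∀ u v, (∫ t in (0 : ℝ)..v, |e t|) - (∫ t in (0 : ℝ)..u, |e t|) =
      ∫ t in u..v, |e t| := fun u v =>
    intervalIntegral.integral_interval_sub_left (hea _ _) (hea _ _)
  have hνm : Monotone ν := by
    refine ((floorSum_mono fun j => abs_nonneg _).add
      (monotone_id.const_mul (abs_nonneg m))).add fun u v huv => ?_
    have h1 := heasub u v
    have h2 := intervalIntegral.integral_nonneg (μ := volume) huv fun t _ => abs_nonneg (e t)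
    linarith
  have hν1 : ∀ x, ν (x + 1) = ν x + (S + |m| + ∫ t in (0 : ℝ)..1, |e t|) := fun x => by
    have h1 := heasub x (x + 1)
    rw [hep.intervalIntegral_add_eq x 0, zero_add] at h1
    simp only [hν, floorSum_add_one]
    linarith
  -- Adding `l ∘ F - l` cancels the coboundary of `g` in the nonlinearity. Only the jumps, the
  -- constant slope `m` and the error `e` remain; their total mass is `S + |m| + ∫ |e| ≤ 2 * S + 1 /
  -- 2`.
  have hd := dist_of_bound (s := rst θ s) (φ := fun y => logD F y - l y + l (F y)) hνm hν1
    (fun u v huv => by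
      have h1 := (h.logD_sub hr).2 u v
      have h2 : l (F v) - l (F u) = ∫ t in u..v, g (F t) * Real.exp (logD F t) := by
        rw [hlsub, integral_change hb.meas hφ.hasDeriv g huv]
      have hgi : IntervalIntegrable (fun t => g (F t) * Real.exp (logD F t)) volume u v := by
        have := (hg.intervalIntegrable u v).sub (hc.intervalIntegrable u v)
        refine this.congr (fun t _ => ?_)
        simp only [cobound]
        ring
      have h3 : ∫ t in u..v, e t = (∫ t in u..v, nonlin F t) - m * (v - u) -
          ((l v - l u) - (l (F v) - l (F u))) := by
        rw [h2, hlsub, ← intervalIntegral.integral_sub (hg.intervalIntegrable u v) hgi]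
        have h4 : ∫ t in u..v, e t = ((∫ t in u..v, nonlin F t) - ∫ t in u..v, m) -
            ∫ t in u..v, cobound F (logD F) g t := by
          rw [← intervalIntegral.integral_sub (hη.intervalIntegrable u v)
            intervalIntegrable_const, ← intervalIntegral.integral_sub
            ((hη.intervalIntegrable u v).sub intervalIntegrable_const)
            (hc.intervalIntegrable u v)]
        rw [h4, intervalIntegral.integral_const, smul_eq_mul, mul_comm (v - u)]
        rfl
      have h5 := abs_floorSum_sub_le (p := p) (w := fun j => Real.log (c j)) huv
      have h6 : |∫ t in u..v, e t| ≤ ∫ t in u..v, |e t| :=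
        intervalIntegral.abs_integral_le_integral_abs huv
      have h7 : logD F v - l v + l (F v) - (logD F u - l u + l (F u)) =
          (floorSum p (fun j => Real.log (c j)) v - floorSum p (fun j => Real.log (c j)) u) +
          m * (v - u) + ∫ t in u..v, e t := by linarith
      rw [h7]
      refine (abs_add_three _ _ _).trans ?_
      rw [abs_mul, abs_of_nonneg (sub_nonneg.2 huv)]
      have h8 := heasub u v
      simp only [hν]
      linarith) ho (hv s) (rst_tower ho.degOne s)
  have key : ∀ (i : ℕ) (x w : ℝ), x ≤ w → w - x ≤ 1 / (4 * (K + 1)) →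
      (F ^ i) w - (F ^ i) x ≤ 1 / (4 * (K + 1)) →
      |bsum F (fun y => logD F y - l y + l (F y)) i w -
        bsum F (fun y => logD F y - l y + l (F y)) i x| ≤
        S + |m| + ∫ t in (0 : ℝ)..1, |e t| →
      |bsum F (logD F) i w - bsum F (logD F) i x| ≤ 2 * S + 1 := by
    intro i x w hxw h1 h2 h3
    rw [bsum_telescope, bsum_telescope] at h3
    have hmono := (F ^ i).monotone hxw
    have h4 := hllip x w hxw
    have h5 := hllip _ _ hmono
    have h6 : K * (1 / (4 * (K + 1))) ≤ 1 / 4 := by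
      rw [mul_one_div, div_le_div_iff₀ (by positivity) (by positivity)]
      linarith
    have h7 := h4.trans (mul_le_mul_of_nonneg_left h1 hK0)
    have h8 := h5.trans (mul_le_mul_of_nonneg_left h2 hK0)
    rw [abs_le] at h3 h7 h8 ⊢
    constructor <;> linarith
  refine fun x w hxw => ⟨fun hw i hi => ?_, fun hw i hi => ?_⟩
  · refine key i x w hxw (by linarith [hP x]) ?_ ((hd x w hxw).1 hw i hi)
    have h1 := (F ^ i).monotone hw
    rw [pow_P h.degOne] at h1
    linarith [hP ((F ^ i) x)]
  · refine key i x w hxw (by linarith [hQ x]) ?_ ((hd x w hxw).2 hw i hi)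
    have h1 := (F ^ i).monotone hw
    rw [pow_Q h.degOne] at h1
    linarith [hQ ((F ^ i) x)]

end Universal

end BreakRenorm

namespace BreakRenorm

/-! ## Normalised lifts -/

theorem isCrOn_const_add {r : ℝ} (hr : 2 < r) {f : ℝ → ℝ} {s : Set ℝ} (h : IsCrOn r f s) (a : ℝ) :
    IsCrOn r (fun x => a + f x) s := by
  obtain ⟨h1, C, h2⟩ := h
  have hn : 0 < ⌊r⌋₊ := Nat.floor_pos.2 (by linarith)
  refine ⟨contDiffOn_const.add h1, C, ?_⟩
  have : iteratedDerivWithin ⌊r⌋₊ (fun x => a + f x) s = iteratedDerivWithin ⌊r⌋₊ f s := by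
    funext x
    exact iteratedDerivWithin_const_add hn a
  rwa [this]

theorem _root_.CircleBreaks.IsLift.exists_int_add {F G : CircleDeg1Lift} {T : UnitAddCircle ≃ₜ UnitAddCircle}
    (hF : IsLift F T) (hG : IsLift G T) : ∃ n : ℤ, ∀ x, F x = n + G x := by
  have hmem : ∀ x, F x - G x ∈ AddSubgroup.zmultiples (1 : ℝ) := fun x => by
    have := (hF.2 x).trans (hG.2 x).symm
    rw [← sub_eq_zero, ← AddCircle.coe_sub] at this
    exact (QuotientAddGroup.eq_zero_iff _).1 this
  obtain ⟨n, hn⟩ := AddSubgroup.mem_zmultiples_iff.1 (hmem 0)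
  refine ⟨n, fun x => ?_⟩
  have := isPreconnected_univ.constant_of_mapsTo (T := (AddSubgroup.zmultiples (1 : ℝ) : Set ℝ))
    (f := fun x => F x - G x) (SetLike.isDiscrete_iff_discreteTopology.2
      (NormedSpace.discreteTopology_zmultiples 1)) (hF.1.sub hG.1).continuousOn (fun x _ => hmem x)
    (mem_univ x) (mem_univ 0)
  simp only [zsmul_eq_mul, mul_one] at hn this
  linarith

theorem _root_.CircleBreaks.IsLift.injective {F : CircleDeg1Lift} {T : UnitAddCircle ≃ₜ UnitAddCircle}
    (hF : IsLift F T) : Function.Injective F := fun x y hxy => by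
  have h1 : (x : UnitAddCircle) = (y : UnitAddCircle) := T.injective (by
    rw [← hF.2, ← hF.2, hxy])
  rw [← sub_eq_zero, ← AddCircle.coe_sub] at h1
  obtain ⟨n, hn⟩ := AddSubgroup.mem_zmultiples_iff.1 ((QuotientAddGroup.eq_zero_iff _).1 h1)
  simp only [zsmul_eq_mul, mul_one] at hn
  have h2 : F x = F y + n := by rw [← F.map_add_int, hn]; congr 1; ring
  have h3 : (n : ℝ) = 0 := by linarith
  linarith

theorem rotOrder_toOrderIso (u : CircleDeg1Liftˣ)
    (hu : Irrational (u : CircleDeg1Lift).translationNumber) :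
    RotOrder (CircleDeg1Lift.toOrderIso u) (u : CircleDeg1Lift).translationNumber := by
  refine ⟨fun x => (u : CircleDeg1Lift).map_add_one x, hu, fun n m hnm x => ?_⟩
  have h1 : ((-m : ℤ) : ℝ) < ((u ^ n : CircleDeg1Liftˣ) : CircleDeg1Lift).translationNumber := by
    rw [CircleDeg1Lift.translationNumber_zpow]
    push_cast; linarith
  have h2 := CircleDeg1Lift.lt_map_of_int_lt_translationNumber _ h1 x
  rw [gm, ← map_zpow, CircleDeg1Lift.coe_toOrderIso]
  push_cast at h2
  linarith

/-- The lift with the break data and the one with irrational translation number differ by an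
integer. Subtracting `⌊F₁ 0⌋` from the former normalises it; the value `0` at `0` is excluded
because a fixed point would make the translation number zero. -/
theorem exists_breakLift {r : ℝ} (hr : 2 < r) {k : ℕ} {c : Fin k → ℝ}
    {T : UnitAddCircle ≃ₜ UnitAddCircle} (hT : IsBreakDiffeo r c T)
    (hI : HasIrrationalRotationNumber T) :
    ∃ (F : ℝ ≃o ℝ) (p : Fin (k + 1) → ℝ) (θ : ℝ), BreakLift r c F p ∧ RotOrder F θ ∧ 0 < θ ∧
      θ < 1 ∧ (∀ x : ℝ, ((F x : ℝ) : UnitAddCircle) = T (x : UnitAddCircle)) ∧ 0 < F 0 ∧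
      F 0 < 1 := by
  obtain ⟨F₁, p, h₁, hp, hbr⟩ := hT
  obtain ⟨F₂, h₂, hirr⟩ := hI
  obtain ⟨n, hn⟩ := h₁.exists_int_add h₂
  set N := ⌊F₁ 0⌋ with hN
  have hbij : IsUnit F₁ := CircleDeg1Lift.isUnit_iff_bijective.2
    ⟨h₁.injective, F₁.continuous_iff_surjective.1 h₁.1⟩
  obtain ⟨u, hu⟩ := hbij
  set w : CircleDeg1Liftˣ :=
    CircleDeg1Lift.translate (Multiplicative.ofAdd (-(N : ℝ))) * u with hw
  have hwx : ∀ x, (w : CircleDeg1Lift) x = -(N : ℝ) + F₁ x := fun x => by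
    rw [hw, Units.val_mul, CircleDeg1Lift.mul_apply, CircleDeg1Lift.translate_apply, hu]
  set θ := (w : CircleDeg1Lift).translationNumber with hθ
  have hcomm : Commute ((CircleDeg1Lift.translate (Multiplicative.ofAdd ((n - N : ℤ) : ℝ)) :
      CircleDeg1Liftˣ) : CircleDeg1Lift) F₂ := by
    rw [CircleDeg1Lift.commute_iff_commute]
    intro x
    simp only [CircleDeg1Lift.translate_apply, F₂.map_int_add]
  have hθe : θ = ((n - N : ℤ) : ℝ) + F₂.translationNumber := by
    rw [hθ, ← CircleDeg1Lift.translationNumber_translate ((n - N : ℤ) : ℝ),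
      ← CircleDeg1Lift.translationNumber_mul_of_commute hcomm]
    congr 1
    ext x
    rw [hwx, CircleDeg1Lift.mul_apply, CircleDeg1Lift.translate_apply, hn]
    push_cast; ring
  have hθi : Irrational θ := by
    rw [hθe]; exact hirr.intCast_add _
  have h0 : 0 ≤ (w : CircleDeg1Lift) 0 := by
    rw [hwx]; linarith [Int.floor_le (F₁ 0)]
  have h1 : (w : CircleDeg1Lift) 0 < 1 := by
    rw [hwx]; linarith [Int.lt_floor_add_one (F₁ 0)]
  have h0' : (w : CircleDeg1Lift) 0 ≠ 0 := fun h => by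
    have := (w : CircleDeg1Lift).translationNumber_of_eq_add_int (x := 0) (m := 0) (by simpa using h)
    exact hθi ⟨0, by rw [hθ, this]; simp⟩
  have hθ0 : 0 ≤ θ := by
    have := (w : CircleDeg1Lift).le_translationNumber_of_add_int_le (x := 0) (m := 0)
      (by simpa using h0)
    simpa using this
  have hθ1 : θ ≤ 1 := by
    have := (w : CircleDeg1Lift).translationNumber_le_of_le_add_int (x := 0) (m := 1)
      (by simpa using h1.le)
    simpa using this
  have hFe : (CircleDeg1Lift.toOrderIso w : ℝ → ℝ) = fun x => -(N : ℝ) + F₁ x := funext hwx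
  refine ⟨CircleDeg1Lift.toOrderIso w, p, θ, ⟨fun x => (w : CircleDeg1Lift).map_add_one x, hp,
    fun i => ?_, fun i x hx => ?_, fun i => ?_⟩, rotOrder_toOrderIso w hθi,
    lt_of_le_of_ne hθ0 fun h => hθi ⟨0, by simp [← h]⟩,
    lt_of_le_of_ne hθ1 fun h => hθi ⟨1, by simp [h]⟩, fun x => ?_,
    lt_of_le_of_ne h0 (Ne.symm h0'), h1⟩
  · rw [hFe]; exact isCrOn_const_add hr (hbr i).1 _
  · rw [hFe, derivWithin_const_add]; exact (hbr i).2.1 x hx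
  · rw [hFe, derivWithin_const_add, derivWithin_const_add]; exact (hbr i).2.2
  · rw [hFe, ← h₁.2]
    simp only [AddCircle.coe_add, AddCircle.coe_neg]
    have : ((N : ℝ) : UnitAddCircle) = 0 :=
      (QuotientAddGroup.eq_zero_iff _).2 (AddSubgroup.mem_zmultiples_iff.2 ⟨N, by simp⟩)
    rw [this]; simp

/-! ## Branches without breaks -/

/-- `f` is of class `C^r` with positive derivative on `[u, v]`. -/
structure PosCr (r : ℝ) (f : ℝ → ℝ) (u v : ℝ) : Prop where
  cr : CrOn (r - ⌊r⌋₊) ⌊r⌋₊ f (Icc u v)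
  pos : ∀ t ∈ Icc u v, ∃ d, 0 < d ∧ HasDerivWithinAt f d (Icc u v) t

section PosCr

variable {r u v u' v' : ℝ} {f g : ℝ → ℝ}

theorem PosCr.comp (hr : 2 < r) (hf : PosCr r f u' v') (hg : PosCr r g u v)
    (hm : MapsTo g (Icc u v) (Icc u' v')) : PosCr r (fun x => f (g x)) u v := by
  obtain ⟨h0, h1⟩ := fract_exponent (r := r) (by linarith)
  obtain ⟨n, hn⟩ := Nat.exists_eq_succ_of_ne_zero (Nat.floor_pos.2 (by linarith : 1 ≤ r)).ne'
  refine ⟨?_, fun t ht => ?_⟩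
  · have h2 := hf.cr
    have h3 := hg.cr
    generalize r - (⌊r⌋₊ : ℝ) = γ at *
    rw [hn] at h2 h3 ⊢
    exact CrOn.comp h0 h1 h2 h3 hm
  · obtain ⟨d, hd, h2⟩ := hg.pos t ht
    obtain ⟨d', hd', h3⟩ := hf.pos (g t) (hm ht)
    exact ⟨d' * d, mul_pos hd' hd, h3.comp t h2 hm⟩

theorem posCr_affine (hr : 2 < r) {a : ℝ} (ha : 0 < a) (b : ℝ) :
    PosCr r (fun x => a * x + b) u v := by
  obtain ⟨h0, h1⟩ := fract_exponent (r := r) (by linarith)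
  refine ⟨((crOn_const _ a).mul h0 h1 (crOn_id _ h0 h1)).add (crOn_const _ b), fun t _ =>
    ⟨a, ha, ?_⟩⟩
  have := ((hasDerivAt_id t).const_mul a).add_const b
  simpa using this.hasDerivWithinAt

theorem PosCr.isCrOn (hr : 2 < r) (huv : u < v) (h : PosCr r f u v) : IsCrOn r f (Icc u v) :=
  (isCrOn_iff (by linarith) huv).2 h.cr

theorem PosCr.derivWithin_pos (huv : u < v) (h : PosCr r f u v) {x : ℝ} (hx : x ∈ Icc u v) :
    0 < derivWithin f (Icc u v) x := by
  obtain ⟨d, hd, h1⟩ := h.pos x hx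
  rwa [h1.derivWithin (uniqueDiffOn_Icc huv x hx)]

theorem posCr_mob (hr : 2 < r) {x₀ y₀ X Y h : ℝ} (hX : 0 < X) (hY : 0 < Y) (hh : 0 < h) :
    PosCr r (mob x₀ y₀ X Y h) x₀ (x₀ + X) := by
  refine ⟨(isCrOn_iff (by linarith) (by linarith)).1 (isCrOn_of_contDiffOn (by linarith)
    (by linarith) (contDiffOn_mob hX hY hh _)), fun t ht => ?_⟩
  have hd := mobDen_pos hX hY hh ht
  exact ⟨_, by positivity, (hasDerivAt_mob hd.ne').hasDerivWithinAt⟩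

end PosCr

/-- The first iterates of `[u, v)` lie between consecutive breaks. -/
def Clean (F : ℝ ≃o ℝ) {k : ℕ} (p : Fin (k + 1) → ℝ) (N : ℕ) (u v : ℝ) : Prop :=
  ∀ j < N, ∃ (i : Fin k) (n : ℤ), (F ^ j) u - n ∈ Ico (p i.castSucc) (p i.succ) ∧
    (F ^ j) v - n ≤ p i.succ

section Clean

variable {r θ : ℝ} {k : ℕ} {c : Fin k → ℝ} {F : ℝ ≃o ℝ} {p : Fin (k + 1) → ℝ} {N : ℕ} {u v : ℝ}

theorem BreakLift.posCr (h : BreakLift r c F p) (hr : 2 < r) {i : Fin k} {n : ℤ}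
    (hu : p i.castSucc ≤ u - n) (hv : v - n ≤ p i.succ) : PosCr r F u v := by
  have hlt : p i.castSucc < p i.succ := h.sub.strictMono Fin.castSucc_lt_succ
  have hm : MapsTo (fun x : ℝ => 1 * x + (-(n : ℝ))) (Icc u v) (Icc (p i.castSucc) (p i.succ)) :=
    fun x hx => ⟨by linarith [hx.1], by linarith [hx.2]⟩
  have h0 : PosCr r F (p i.castSucc) (p i.succ) := by
    refine ⟨(isCrOn_iff (by linarith) hlt).1 (h.cr i), fun t ht => ?_⟩
    obtain ⟨f', f'', h1, _, _, h4, _⟩ := h.piece hr i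
    exact ⟨f' t, h4 t ht, h1 t ht⟩
  have h1 := PosCr.comp (f := fun x => 1 * x + (n : ℝ)) (u' := F (u - n)) (v' := F (v - n)) hr
    (posCr_affine hr one_pos n) (h0.comp hr (posCr_affine hr one_pos _) hm)
    (fun x hx => ⟨F.monotone (by linarith [hx.1]), F.monotone (by linarith [hx.2])⟩)
  have e : (F : ℝ → ℝ) = fun x => 1 * F (1 * x + -(n : ℝ)) + n := by
    funext x
    rw [one_mul, ← h.degOne.add_int]
    congr 1; ring
  rw [e]
  exact h1

theorem BreakLift.posCr_pow (h : BreakLift r c F p) (hr : 2 < r)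
    (hc : Clean F p N u v) : PosCr r (fun x => (F ^ N) x) u v := by
  induction N with
  | zero => simpa using posCr_affine (u := u) (v := v) hr one_pos 0
  | succ N ih =>
    obtain ⟨i, n, h1, h2⟩ := hc N (Nat.lt_succ_self N)
    have h3 := h.posCr hr h1.1 h2
    have h4 := h3.comp hr (ih fun j hj => hc j (hj.trans (Nat.lt_succ_self N)))
      (fun x hx => ⟨(F ^ N).monotone hx.1, (F ^ N).monotone hx.2⟩)
    simp only [pow_succ', RelIso.mul_apply]
    exact h4

/-- By `xr_pow`, a sum over the levels: each term is at most `C * D ^ δ` times the length of its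
level, and the lengths sum to at most `1`. -/
theorem abs_xr_pow_le {C D : ℝ} (hC : 0 ≤ C) (hD0 : 0 ≤ D)
    (hxr : ∀ (i : Fin k) (n : ℤ) (x y : ℝ), x < y →
      x - n ∈ Ico (p i.castSucc) (p i.succ) → y - n ∈ Ico (p i.castSucc) (p i.succ) →
      |xr F (logD F) x y| ≤ C * (y - x) ^ (1 + min 1 (r - 2))) (hr : 2 < r)
    (hc : Clean F p N u v) (hD : ∀ j < N, (F ^ j) v - (F ^ j) u ≤ D)
    (hsum : bsum F (fun x => x) N v - bsum F (fun x => x) N u ≤ 1) {y : ℝ} (hy : y ∈ Ioo u v) :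
    |xr (fun x => (F ^ N) x) (bsum F (logD F) N) u y| ≤ C * D ^ min 1 (r - 2) := by
  have hδ : 0 < min 1 (r - 2) := lt_min one_pos (by linarith)
  set δ := min 1 (r - 2)
  rw [xr_pow F _ N hy.1]
  have hterm : ∀ j ∈ Finset.range N, |xr F (logD F) ((F ^ j) u) ((F ^ j) y)| ≤
      C * D ^ δ * ((F ^ j) v - (F ^ j) u) := by
    intro j hj
    obtain ⟨i, n, h1, h2⟩ := hc j (Finset.mem_range.1 hj)
    have h3 := (F ^ j).strictMono hy.1
    have h4 := (F ^ j).strictMono hy.2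
    refine (hxr i n _ _ h3 h1 ⟨by linarith [h1.1], by linarith⟩).trans ?_
    rw [Real.rpow_add (by linarith), Real.rpow_one, mul_assoc, mul_comm (D ^ δ)]
    refine mul_le_mul_of_nonneg_left (mul_le_mul (by linarith) ?_ ?_ (by linarith)) hC
    · exact Real.rpow_le_rpow (by linarith) (by linarith [hD j (Finset.mem_range.1 hj)]) hδ.le
    · exact Real.rpow_nonneg (by linarith) _
  refine (Finset.abs_sum_le_sum_abs _ _).trans ((Finset.sum_le_sum hterm).trans ?_)
  rw [← Finset.mul_sum, Finset.sum_sub_distrib]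
  exact mul_le_of_le_one_right (mul_nonneg hC (Real.rpow_nonneg hD0 _)) hsum

theorem hasDerivAt_of_Ici {f : ℝ → ℝ} {d d' x : ℝ} (h : HasDerivAt f d x)
    (h' : HasDerivWithinAt f d' (Ici x) x) : HasDerivAt f d' x := by
  rwa [← (uniqueDiffOn_Ici x x self_mem_Ici).eq_deriv _ h.hasDerivWithinAt h']

theorem BreakLift.hasDerivAt_pow (h : BreakLift r c F p) (hr : 2 < r)
    (hc : Clean F p N u v) {x : ℝ} (hx : x ∈ Ioo u v) :
    HasDerivAt (fun x => (F ^ N) x) (Real.exp (bsum F (logD F) N x)) x := by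
  obtain ⟨d, _, h1⟩ := (h.posCr_pow hr hc).pos x (Ioo_subset_Icc_self hx)
  exact hasDerivAt_of_Ici (h1.hasDerivAt (Icc_mem_nhds hx.1 hx.2)) ((h.logDeriv hr).pow N x)

end Clean

/-! ## Moebius approximation of a rescaled branch -/

section Branch

variable {r : ℝ} {k : ℕ} {c : Fin k → ℝ} {F : ℝ ≃o ℝ} {p : Fin (k + 1) → ℝ} {N : ℕ}

/-- The `N`-th iterate of `F`, rescaled. -/
noncomputable def branch (F : ℝ ≃o ℝ) (N : ℕ) (m l x : ℝ) : ℝ := ((F ^ N) (l * x) - m) / l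

theorem branch_strictMono (F : ℝ ≃o ℝ) (N : ℕ) (m : ℝ) {l : ℝ} (hl : 0 < l) :
    StrictMono (branch F N m l) := fun x y hxy => by
  have h1 := (F ^ N).strictMono (mul_lt_mul_of_pos_left hxy hl)
  exact div_lt_div_of_pos_right (by linarith) hl

theorem branch_continuous (F : ℝ ≃o ℝ) (N : ℕ) (m l : ℝ) : Continuous (branch F N m l) := by
  have := (F ^ N).continuous
  unfold branch
  fun_prop

theorem branch_image (F : ℝ ≃o ℝ) (N : ℕ) (m : ℝ) {l : ℝ} (hl : 0 < l) {x y : ℝ} (hxy : x ≤ y) :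
    branch F N m l '' Ico x y = Ico (branch F N m l x) (branch F N m l y) := by
  refine Subset.antisymm ?_ (intermediate_value_Ico hxy (branch_continuous F N m l).continuousOn)
  rintro _ ⟨t, ht, rfl⟩
  exact ⟨(branch_strictMono F N m hl).monotone ht.1, branch_strictMono F N m hl ht.2⟩

theorem BreakLift.posCr_branch (h : BreakLift r c F p) (hr : 2 < r) {l x y : ℝ} (hl : 0 < l)
    (hc : Clean F p N (l * x) (l * y)) (m : ℝ) :
    PosCr r (branch F N m l) x y := by
  have h1 := (h.posCr_pow hr hc).comp hr
    (posCr_affine (u := x) (v := y) hr hl 0)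
    (fun t ht => ⟨by simpa using mul_le_mul_of_nonneg_left ht.1 hl.le,
      by simpa using mul_le_mul_of_nonneg_left ht.2 hl.le⟩)
  have h2 := PosCr.comp hr (posCr_affine (u := (F ^ N) (l * x)) (v := (F ^ N) (l * y)) hr
    (inv_pos.2 hl) (-m / l)) h1 (fun t ht =>
    ⟨(F ^ N).monotone (by nlinarith [ht.1]), (F ^ N).monotone (by nlinarith [ht.2])⟩)
  convert h2 using 1
  funext t
  rw [branch, add_zero]
  field_simp
  ring

theorem BreakLift.hasDerivAt_branch (h : BreakLift r c F p) (hr : 2 < r) {l x y t : ℝ}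
    (hl : 0 < l) (hc : Clean F p N (l * x) (l * y)) (m : ℝ) (ht : t ∈ Ioo x y) :
    HasDerivAt (branch F N m l) (Real.exp (bsum F (logD F) N (l * t))) t := by
  have h1 := h.hasDerivAt_pow hr hc (x := l * t)
    ⟨mul_lt_mul_of_pos_left ht.1 hl, mul_lt_mul_of_pos_left ht.2 hl⟩
  have h2 := ((h1.comp t ((hasDerivAt_id t).const_mul l)).sub_const m).div_const l
  simp only [mul_one, mul_div_cancel_right₀ _ hl.ne'] at h2
  exact h2

theorem xr_branch (φ : ℝ → ℝ) (F : ℝ ≃o ℝ) (N : ℕ) (m l x y : ℝ) :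
    xr (branch F N m l) (fun t => bsum F φ N (l * t)) x y =
      xr (fun z => (F ^ N) z) (bsum F φ N) (l * x) (l * y) := by
  rw [xr, xr]
  congr 4
  rw [branch, branch, ← mul_sub, ← sub_div, sub_sub_sub_cancel_right, div_div, mul_comm]

/-- The Moebius map with the same end points as the branch and the same derivative at the left
end point. -/
noncomputable def branchMob (F : ℝ ≃o ℝ) (φ : ℝ → ℝ) (N : ℕ) (m l x y : ℝ) : ℝ → ℝ :=
  mob x (branch F N m l x) (y - x) (branch F N m l y - branch F N m l x)
    (Real.exp (bsum F φ N (l * x)))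

theorem branchMob_close (h : BreakLift r c F p) (hr : 2 < r) {l x y t m ε M : ℝ}
    (hl : 0 < l) (hc : Clean F p N (l * x) (l * y))
    (h0 : 0 ≤ branch F N m l x) (h1 : branch F N m l y ≤ 1)
    (hε : ∀ z ∈ Ioo (l * x) (l * y),
      |xr (fun x => (F ^ N) x) (bsum F (logD F) N) (l * x) z| ≤ ε)
    (hM : ∀ z, bsum F (logD F) N z ≤ M) (ht : t ∈ Ioo x y) :
    |branch F N m l t - branchMob F (logD F) N m l x y t| ≤
      (Real.exp (3 * ε) - 1) * max 1 (Real.exp M) ∧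
    |deriv (branch F N m l) t - deriv (branchMob F (logD F) N m l x y) t| ≤
      (Real.exp (3 * ε) - 1) * max 1 (Real.exp M) := by
  have hxy : x < y := ht.1.trans ht.2
  have hmono := branch_strictMono F N m hl
  have hε0 : 0 ≤ ε := (abs_nonneg _).trans (hε (l * t) ⟨mul_lt_mul_of_pos_left ht.1 hl,
    mul_lt_mul_of_pos_left ht.2 hl⟩)
  have he : 0 ≤ Real.exp (3 * ε) - 1 := sub_nonneg.2 (Real.one_le_exp (by positivity))
  have key := mob_close (x₀ := x) (y₀ := branch F N m l x) (X := y - x)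
    (Y := branch F N m l y - branch F N m l x) (x := t) (H := branch F N m l)
    (L := fun t => bsum F (logD F) N (l * t)) (ε := ε) (sub_pos.2 hxy) (sub_pos.2 (hmono hxy))
    (branch_continuous F N m l).continuousOn rfl (by rw [add_sub_cancel, add_sub_cancel])
    (hmono.strictMonoOn _) (by
      rw [add_sub_cancel]
      exact fun z hz => h.hasDerivAt_branch hr hl hc m hz) (by
      rw [add_sub_cancel]
      intro z hz
      rw [xr_branch _ F N m l]
      exact hε _ ⟨mul_lt_mul_of_pos_left hz.1 hl, mul_lt_mul_of_pos_left hz.2 hl⟩)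
    (by rw [add_sub_cancel]; exact ht)
  rw [(h.hasDerivAt_branch hr hl hc m ht).deriv]
  refine ⟨key.1.trans (mul_le_mul_of_nonneg_left ?_ he),
    key.2.trans (mul_le_mul_of_nonneg_left ?_ he)⟩
  · have := hmono ht.2
    exact le_max_of_le_left (by linarith)
  · exact le_max_of_le_right (Real.exp_le_exp.2 (hM _))

end Branch

/-! ## Exchanges with a circular permutation -/

section RotGIET

variable {r : ℝ} {k m : ℕ} {z w : ℕ → ℝ}

theorem isSubdivision_of_strictMono (hz : StrictMono z) (hz0 : z 0 = 0) (hz1 : z (k + 1) = 1) :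
    IsSubdivision (fun i : Fin (k + 2) => z i) :=
  ⟨hz0, hz1, fun _ _ hij => hz hij⟩

/-- The data of an exchange with a circular permutation. -/
structure RotData (r : ℝ) (k m : ℕ) (z w : ℕ → ℝ) (f : ℝ → ℝ) : Prop where
  top : StrictMono z
  top_zero : z 0 = 0
  top_last : z (k + 1) = 1
  bot : StrictMono w
  bot_zero : w 0 = 0
  bot_last : w (k + 1) = 1
  image : ∀ i < k + 1, f '' Ico (z i) (z (i + 1)) =
    Ico (w ((i + m) % (k + 1))) (w ((i + m) % (k + 1) + 1))
  regular : ∀ i < k + 1, ∃ g : ℝ → ℝ, EqOn f g (Ico (z i) (z (i + 1))) ∧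
    PosCr r g (z i) (z (i + 1))

theorem addRight_val (i : Fin (k + 1)) :
    (Equiv.addRight (Fin.ofNat (k + 1) m) i : ℕ) = (i + m) % (k + 1) := by
  simp [Fin.val_add]

/-- The exchange with a circular permutation. -/
noncomputable def RotData.giet {f : ℝ → ℝ} (h : RotData r k m z w f) (hr : 2 < r) :
    GIET r (k + 1) where
  perm := Equiv.addRight (Fin.ofNat (k + 1) m)
  top := fun i => z i
  bot := fun i => w i
  toFun := f
  top_subdivision := isSubdivision_of_strictMono h.top h.top_zero h.top_last
  bot_subdivision := isSubdivision_of_strictMono h.bot h.bot_zero h.bot_last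
  image_branch := fun i => by
    simp only [Fin.val_castSucc, Fin.val_succ, addRight_val]
    exact h.image i i.2
  regular_branch := fun i => by
    obtain ⟨g, h1, h2⟩ := h.regular i i.2
    exact ⟨g, h1, h2.isCrOn hr (h.top (Nat.lt_succ_self i)), fun x hx =>
      h2.derivWithin_pos (h.top (Nat.lt_succ_self i)) hx⟩

theorem RotData.d1_le {f g : ℝ → ℝ} (hf : RotData r k m z w f) (hg : RotData r k m z w g)
    (hr : 2 < r) {B : ℝ} (hB : 0 ≤ B)
    (h : ∀ i < k + 1, ∀ x ∈ Ioo (z i) (z (i + 1)), |f x - g x| ≤ B ∧ |deriv f x - deriv g x| ≤ B) :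
    d1 (hf.giet hr) (hg.giet hr) ≤ ENNReal.ofReal B := by
  have hp : (hf.giet hr).perm = (hg.giet hr).perm := rfl
  rw [d1, if_pos hp]
  refine iSup_le fun i => iSup_le fun t => iSup_le fun ht => ENNReal.ofReal_le_ofReal ?_
  have hz : z i < z (i + 1) := hf.top (Nat.lt_succ_self i)
  have e : (hg.giet hr).point i t = (hf.giet hr).point i t := rfl
  have hmem : (hf.giet hr).point i t ∈ Ioo (z i) (z (i + 1)) := by
    have e2 : (hf.giet hr).point i t = z i + t * (z (i + 1) - z i) := rfl
    rw [e2]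
    constructor <;> nlinarith [ht.1, ht.2]
  obtain ⟨h1, h2⟩ := h i i.2 _ hmem
  rw [e, sub_self, abs_zero]
  exact max_le hB (max_le h1 h2)

theorem RotData.mem_moebiusGIET {f : ℝ → ℝ} (h : RotData r k m z w f) (hr : 2 < r) (hm : 0 < m)
    (hmk : m < k + 1)
    (hf : ∀ i < k + 1, ∃ a b c e : ℝ, 0 < a * e - b * c ∧ ∀ x ∈ Ico (z i) (z (i + 1)),
      c * x + e ≠ 0 ∧ f x = (a * x + b) / (c * x + e)) :
    h.giet hr ∈ moebiusGIET r (k + 1) :=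
  ⟨⟨m, hm, hmk, fun i => addRight_val i⟩, fun i => hf i i.2⟩

theorem exists_piecewise (hz : StrictMono z) (M : ℕ → ℝ → ℝ) :
    ∃ g : ℝ → ℝ, ∀ i, ∀ x ∈ Ico (z i) (z (i + 1)), g x = M i x := by
  classical
  refine ⟨fun x => if h : ∃ i, x ∈ Ico (z i) (z (i + 1)) then M h.choose x else 0,
    fun i x hx => ?_⟩
  have h : ∃ i, x ∈ Ico (z i) (z (i + 1)) := ⟨i, hx⟩
  have h1 := h.choose_spec
  have h2 : h.choose = i := by
    refine le_antisymm ?_ ?_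
    · exact Nat.lt_succ_iff.1 (hz.lt_iff_lt.1 (h1.1.trans_lt hx.2))
    · exact Nat.lt_succ_iff.1 (hz.lt_iff_lt.1 (hx.1.trans_lt h1.2))
  simp only [dif_pos h, h2]

theorem exists_enum {Z : Finset ℝ} {l : ℝ} (hZ : ∀ y ∈ Z, y ∈ Ico 0 l) (h0 : (0 : ℝ) ∈ Z)
    (hc : Z.card = k + 1) : ∃ z : ℕ → ℝ, StrictMono z ∧ z 0 = 0 ∧ z (k + 1) = l ∧
      ∀ y ∈ Z, ∃ i < k + 1, z i = y := by
  set o := Z.orderEmbOfFin hc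
  -- Continuing by `l`, `l + 1`, … keeps the sequence strictly increasing on all of `ℕ`.
  set z : ℕ → ℝ := fun n => if h : n < k + 1 then o ⟨n, h⟩ else l + (n - (k + 1 : ℕ) : ℝ) with hz
  have hlt : ∀ n (h : n < k + 1), z n = o ⟨n, h⟩ := fun n h => dif_pos h
  have hge : ∀ n, k + 1 ≤ n → z n = l + (n - (k + 1 : ℕ) : ℝ) := fun n h => dif_neg (not_lt.2 h)
  have hmem : ∀ n, n < k + 1 → z n ∈ Z := fun n h => by
    rw [hlt n h]; exact Z.orderEmbOfFin_mem hc _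
  have hex : ∀ y ∈ Z, ∃ i < k + 1, z i = y := fun y hy => by
    have : y ∈ Set.range o := by rw [Finset.range_orderEmbOfFin]; exact hy
    obtain ⟨i, hi⟩ := this
    exact ⟨i, i.2, by rw [hlt i i.2]; exact hi⟩
  have hmono : StrictMono z := by
    refine strictMono_nat_of_lt_succ fun n => ?_
    rcases lt_trichotomy (n + 1) (k + 1) with h | h | h
    · rw [hlt n (by omega), hlt _ h]
      exact o.strictMono (Fin.mk_lt_mk.2 (Nat.lt_succ_self n))
    · rw [hge (n + 1) h.ge, h, sub_self, add_zero]
      exact (hZ _ (hmem n (by omega))).2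
    · rw [hge n (by omega), hge (n + 1) (by omega)]
      push_cast; linarith
  refine ⟨z, hmono, ?_, by rw [hge _ le_rfl, sub_self, add_zero], hex⟩
  obtain ⟨i, hi, hi0⟩ := hex 0 h0
  refine le_antisymm ?_ (hZ _ (hmem 0 (Nat.succ_pos k))).1
  rw [← hi0]
  exact hmono.monotone (Nat.zero_le i)

end RotGIET

/-! ## The branches of a return map -/

section Partition

variable {r θ : ℝ} {k : ℕ} {c : Fin k → ℝ} {F : ℝ ≃o ℝ} {p : Fin (k + 1) → ℝ} {s : St}

/-- The level `i` of the towers over `[0, P 0)` and `[P 0, Q (P 0))` contains an iterate of `w`. -/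
def St.InTower (F : ℝ ≃o ℝ) (s : St) (i : ℕ) (w : ℝ) : Prop :=
  (i < s.a ∧ w ∈ Ico 0 (s.P F 0)) ∨ (i < s.b ∧ w ∈ Ico (s.P F 0) (s.Q F (s.P F 0)))

theorem exists_break_eq (hp : IsSubdivision p) (i : Fin k) (n : ℤ) :
    ∃ (l : Fin k) (n' : ℤ), p i.succ + n = p l.castSucc + n' := by
  rcases Nat.lt_or_ge (i + 1) k with h | h
  · exact ⟨⟨i + 1, h⟩, n, rfl⟩
  · have hk : i.succ = Fin.last k := Fin.ext (by simp; omega)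
    refine ⟨⟨0, i.pos⟩, n + 1, ?_⟩
    have h0 : p (Fin.castSucc ⟨0, i.pos⟩) = 0 := hp.zero
    rw [hk, hp.last, h0]
    push_cast; ring

/-- A break inside an iterate of `(u, v)` would lie over a point `w` of `(u, v)`. The towers contain
that break over a single base point, so `w = x l`, which is excluded. -/
theorem clean_of_forall (h : BreakLift r c F p) (ho : RotOrder F θ) (hs : s.Valid θ)
    (ht : s.Tower F) {x : Fin k → ℝ}
    (hx : ∀ l, ∃ (i : ℕ) (n : ℤ), s.InTower F i (x l) ∧ (F ^ i) (x l) = p l.castSucc + n)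
    {u v : ℝ} {N : ℕ} (huv : ∀ l, x l ∉ Ioo u v)
    (hN : ∀ j < N, ∀ w ∈ Ioo u v, s.InTower F j w) : Clean F p N u v := by
  intro j hj
  obtain ⟨i, n, hi⟩ := exists_floor_mem h.sub ((F ^ j) u)
  refine ⟨i, n, hi, ?_⟩
  by_contra! hcon
  obtain ⟨l, n', hl⟩ := exists_break_eq h.sub i n
  set w := (F ^ j).symm (p i.succ + n) with hw
  have hFw : (F ^ j) w = p i.succ + n := (F ^ j).apply_symm_apply _
  have hwm : w ∈ Ioo u v := by
    constructor
    · rw [← (F ^ j).lt_iff_lt, hFw]; linarith [hi.2]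
    · rw [← (F ^ j).lt_iff_lt, hFw]; linarith
  obtain ⟨i', n'', h1, h2⟩ := hx l
  have := ht.unique hs ho (hN j hj w hwm) h1 (hFw.trans hl) h2
  exact huv l (this ▸ hwm)

/-- Each break is traced down its tower to the base. The break `0` is already on the ground level at
`0`, so together with `P 0` the return map has at most `k` interior singularities. -/
theorem exists_singularities (hk : 1 ≤ k) (h : BreakLift r c F p) (ho : RotOrder F θ)
    (hs : s.Valid θ) (ht : s.Tower F) : ∃ x : Fin k → ℝ, x ⟨0, hk⟩ = 0 ∧
      (∀ l, x l ∈ Ico 0 (s.len F)) ∧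
      ∀ l, ∃ (i : ℕ) (n : ℤ), s.InTower F i (x l) ∧ (F ^ i) (x l) = p l.castSucc + n := by
  have hex : ∀ l : Fin k, ∃ x, ∃ (i : ℕ) (n : ℤ), s.InTower F i x ∧
      (F ^ i) x = p l.castSucc + n := fun l => by
    obtain ⟨i, n, w, h1, h2⟩ := ht.exists_pow_eq 0 (p l.castSucc)
    exact ⟨w, i, n, h2, h1⟩
  choose x hx using hex
  refine ⟨x, ?_, fun l => ?_, hx⟩
  · obtain ⟨i, n, h1, h2⟩ := hx ⟨0, hk⟩
    have h0 : p (Fin.castSucc ⟨0, hk⟩) = 0 := h.sub.zero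
    rw [h0] at h2
    exact ht.unique hs ho (n' := 0) h1 (Or.inl ⟨hs.a_pos, le_rfl, hs.P_pos ho⟩) h2 (by simp)
  · obtain ⟨i, n, h1, h2⟩ := hx l
    rcases h1 with ⟨_, h1⟩ | ⟨_, h1⟩
    · exact ⟨h1.1, h1.2.trans (hs.P_lt_len ho)⟩
    · exact ⟨(hs.P_pos ho).le.trans h1.1, h1.2⟩

/-- The interval `[u, v]` is the domain of a branch `F ^ N - m` of the return map. -/
structure St.IsBranch (F : ℝ ≃o ℝ) (p : Fin (k + 1) → ℝ) (s : St) (D u v : ℝ) (N : ℕ) (m : ℤ) :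
    Prop where
  time : N = s.a ∨ N = s.b
  clean : Clean F p N u v
  map : ∀ y ∈ Ico u v, s.map F y = (F ^ N) y - m
  disp : ∀ j < N, (F ^ j) v - (F ^ j) u ≤ D
  sum : bsum F (fun x => x) N v - bsum F (fun x => x) N u ≤ 1

theorem isBranch_left (h : BreakLift r c F p) (ho : RotOrder F θ) (hs : s.Valid θ)
    (ht : s.Tower F) {D : ℝ} (hD : s.DispP F D) {x : Fin k → ℝ}
    (hx : ∀ l, ∃ (i : ℕ) (n : ℤ), s.InTower F i (x l) ∧ (F ^ i) (x l) = p l.castSucc + n)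
    {u v : ℝ} (huv : u ≤ v) (hxuv : ∀ l, x l ∉ Ioo u v) (h0 : 0 ≤ u) (h1 : v ≤ s.P F 0) :
    s.IsBranch F p D u v s.a s.m := by
  refine ⟨Or.inl rfl, ?_, fun y hy => ?_, fun j _ => ?_, ?_⟩
  · exact clean_of_forall h ho hs ht hx hxuv fun j hj w hw =>
      Or.inl ⟨hj, h0.trans hw.1.le, hw.2.trans_le h1⟩
  · rw [St.map_of_lt (hy.2.trans_le h1), pow_a]; ring
  · have e1 := (F ^ j).monotone h1
    have e2 := (F ^ j).monotone h0
    rw [pow_P h.degOne] at e1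
    linarith [hD ((F ^ j) 0)]
  · exact ht.bsum_sub_le_P hs ho monotone_id (fun _ => rfl) le_rfl h0 huv h1

theorem isBranch_right (h : BreakLift r c F p) (ho : RotOrder F θ) (hs : s.Valid θ)
    (ht : s.Tower F) {D : ℝ} (hD : s.DispQ F D) {x : Fin k → ℝ}
    (hx : ∀ l, ∃ (i : ℕ) (n : ℤ), s.InTower F i (x l) ∧ (F ^ i) (x l) = p l.castSucc + n)
    {u v : ℝ} (huv : u ≤ v) (hxuv : ∀ l, x l ∉ Ioo u v) (h0 : s.P F 0 ≤ u) (h1 : v ≤ s.len F) :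
    s.IsBranch F p D u v s.b s.n := by
  refine ⟨Or.inr rfl, ?_, fun y hy => ?_, fun j _ => ?_, ?_⟩
  · exact clean_of_forall h ho hs ht hx hxuv fun j hj w hw =>
      Or.inr ⟨hj, h0.trans hw.1.le, hw.2.trans_le h1⟩
  · rw [St.map_of_le (h0.trans hy.1), pow_b]; ring
  · have e1 := (F ^ j).monotone h1
    have e2 := (F ^ j).monotone h0
    rw [St.len, pow_Q h.degOne] at e1
    linarith [hD ((F ^ j) (s.P F 0))]
  · exact ht.bsum_sub_le_Q hs ho monotone_id (fun _ => rfl) le_rfl h0 huv h1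

theorem exists_partition (hk : 1 ≤ k) (h : BreakLift r c F p) (ho : RotOrder F θ)
    (hs : s.Valid θ) (ht : s.Tower F) {D : ℝ} (hP : s.DispP F D) (hQ : s.DispQ F D) :
    ∃ (m : ℕ) (z w : ℕ → ℝ), 0 < m ∧ m < k + 1 ∧ StrictMono z ∧ z 0 = 0 ∧
      z (k + 1) = s.len F ∧ StrictMono w ∧ w 0 = 0 ∧ w (k + 1) = s.len F ∧
      ∀ i < k + 1, ∃ (N : ℕ) (m' : ℤ), s.IsBranch F p D (z i) (z (i + 1)) N m' ∧
        w ((i + m) % (k + 1)) = (F ^ N) (z i) - m' ∧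
        w ((i + m) % (k + 1) + 1) = (F ^ N) (z (i + 1)) - m' := by
  classical
  obtain ⟨x, hx0, hxl, hx⟩ := exists_singularities hk h ho hs ht
  have hlen := hs.len_pos ho
  set Z₀ : Finset ℝ := insert (s.P F 0) (Finset.univ.image x) with hZ₀
  have hZ₀c : (Z₀ : Set ℝ).ncard ≤ k + 1 := by
    rw [Set.ncard_coe_finset]
    refine (Finset.card_insert_le _ _).trans (Nat.succ_le_succ ?_)
    exact Finset.card_image_le.trans (by simp)
  have hZ₀s : (Z₀ : Set ℝ) ⊆ Ico 0 (s.len F) := by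
    intro y hy
    rcases Finset.mem_insert.1 (Finset.mem_coe.1 hy) with hy | hy
    · rw [hy]; exact ⟨(hs.P_pos ho).le, hs.P_lt_len ho⟩
    · obtain ⟨l, _, rfl⟩ := Finset.mem_image.1 hy
      exact hxl l
  -- If some of these points coincide, arbitrary subdivision points are added to reach `k + 1`.
  obtain ⟨Z', h1, h2, h3⟩ := (Set.Ico_infinite hlen).exists_superset_ncard_eq hZ₀s
    Z₀.finite_toSet hZ₀c
  have hfin : Z'.Finite := Set.finite_of_ncard_ne_zero (by omega)
  have hmemx : ∀ l, x l ∈ Z' := fun l => h1 (Finset.mem_coe.2 (Finset.mem_insert_of_mem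
    (Finset.mem_image_of_mem x (Finset.mem_univ l))))
  obtain ⟨z, hz, hz0, hz1, hzex⟩ := exists_enum (Z := hfin.toFinset) (l := s.len F) (k := k)
    (fun y hy => h2 (hfin.mem_toFinset.1 hy))
    (hfin.mem_toFinset.2 (hx0 ▸ hmemx _))
    (by rw [← Set.ncard_eq_toFinset_card _ hfin, h3])
  obtain ⟨e, hek, he⟩ := hzex (s.P F 0) (hfin.mem_toFinset.2 (h1 (Finset.mem_coe.2
    (Finset.mem_insert_self _ _))))
  have he0 : 0 < e := by
    rcases Nat.eq_zero_or_pos e with h0 | h0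
    · rw [h0, hz0] at he
      exact absurd he (hs.P_pos ho).ne
    · exact h0
  have hgap : ∀ i l, x l ∉ Ioo (z i) (z (i + 1)) := fun i l hl => by
    obtain ⟨i', _, hi'⟩ := hzex (x l) (hfin.mem_toFinset.2 (hmemx l))
    rw [← hi'] at hl
    have e1 := hz.lt_iff_lt.1 hl.1
    have e2 := hz.lt_iff_lt.1 hl.2
    omega
  -- The singularity `P 0` is the point of index `e`: `R` moves the intervals from there on to the
  -- front and `Q` the first `e` ones to the back, so the indices rotate by `k + 1 - e`.
  set m := k + 1 - e with hm
  set w : ℕ → ℝ := fun n => if n ≤ m then s.R F (z (n + e)) else s.Q F (z (n - m)) with hw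
  have hwle : ∀ n ≤ m, w n = s.R F (z (n + e)) := fun n hn => if_pos hn
  -- The two formulas for `w` agree at the junction `n = m`.
  have hRQ : s.R F (s.len F) = s.Q F 0 := by
    rw [St.len, s.Q_P h.degOne, s.R_P h.degOne]
  have hwge : ∀ n, m ≤ n → w n = s.Q F (z (n - m)) := fun n hn => by
    rcases hn.eq_or_lt with hn | hn
    · rw [← hn, hwle _ le_rfl, show m + e = k + 1 by omega, hz1, hRQ, Nat.sub_self, hz0]
    · exact if_neg (not_le.2 hn)
  refine ⟨m, z, w, by omega, by omega, hz, hz0, hz1, ?_, ?_, ?_, fun i hi => ?_⟩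
  · refine strictMono_nat_of_lt_succ fun n => ?_
    rcases Nat.lt_or_ge n m with hn | hn
    · rw [hwle n hn.le, hwle (n + 1) hn]
      exact gm_strictMono F _ _ (hz (by omega))
    · rw [hwge n hn, hwge (n + 1) (by omega)]
      exact gm_strictMono F _ _ (hz (by omega))
  · rw [hwle 0 (Nat.zero_le _), zero_add, he]
    exact s.R_P h.degOne 0
  · rw [hwge _ (by omega), show k + 1 - m = e by omega, he]
    rfl
  · have hzi := (hz (Nat.lt_succ_self i)).le
    have hz0i : 0 ≤ z i := hz0 ▸ hz.monotone (Nat.zero_le i)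
    have hzik : z (i + 1) ≤ s.len F := hz1 ▸ hz.monotone (by omega)
    rcases Nat.lt_or_ge i e with hie | hie
    · refine ⟨s.a, s.m, isBranch_left h ho hs ht hP hx hzi (hgap i) hz0i
        (he ▸ hz.monotone hie), ?_, ?_⟩
      · rw [Nat.mod_eq_of_lt (by omega), hwge _ (by omega), pow_a, Nat.add_sub_cancel]; ring
      · rw [Nat.mod_eq_of_lt (by omega), hwge _ (by omega), pow_a,
          show i + m + 1 - m = i + 1 by omega]; ring
    · have hmod : (i + m) % (k + 1) = i - e := by
        rw [show i + m = (i - e) + (k + 1) by omega, Nat.add_mod_right,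
          Nat.mod_eq_of_lt (by omega)]
      refine ⟨s.b, s.n, isBranch_right h ho hs ht hQ hx hzi (hgap i)
        (he ▸ hz.monotone hie) hzik, ?_, ?_⟩
      · rw [hmod, hwle _ (by omega), pow_b, show i - e + e = i by omega]; ring
      · rw [hmod, hwle _ (by omega), pow_b, show i - e + 1 + e = i + 1 by omega]; ring

end Partition

/-! ## Renormalisations are close to Moebius exchanges -/

section Final

variable {r θ : ℝ} {k : ℕ} {c : Fin k → ℝ} {F : ℝ ≃o ℝ} {p : Fin (k + 1) → ℝ} {s : St}

/-- Each branch is replaced by its Möbius map with the same end points. The new exchange has the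
same subdivisions at the top and at the bottom, so `d1` compares both maps at identical points. -/
theorem exists_giet (hr : 2 < r) (hk : 1 ≤ k) (h : BreakLift r c F p) (ho : RotOrder F θ)
    (hs : s.Valid θ) (ht : s.Tower F) {C D M : ℝ} (hC : 0 ≤ C)
    (hxr : ∀ (i : Fin k) (n : ℤ) (x y : ℝ), x < y →
      x - n ∈ Ico (p i.castSucc) (p i.succ) → y - n ∈ Ico (p i.castSucc) (p i.succ) →
      |xr F (logD F) x y| ≤ C * (y - x) ^ (1 + min 1 (r - 2)))
    (hD : 0 ≤ D) (hP : s.DispP F D) (hQ : s.DispQ F D)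
    (hM : ∀ x, bsum F (logD F) s.a x ≤ M ∧ bsum F (logD F) s.b x ≤ M) :
    ∃ G : GIET r (k + 1), G.toFun = s.scaled F ∧ d1ToSet G (moebiusGIET r (k + 1)) ≤
      ENNReal.ofReal ((Real.exp (3 * (C * D ^ min 1 (r - 2))) - 1) * max 1 (Real.exp M)) := by
  obtain ⟨m, z, w, hm0, hmk, hz, hz0, hz1, hw, hw0, hw1, hb⟩ := exists_partition hk h ho hs ht hP hQ
  set l := s.len F with hl
  have hl0 : 0 < l := hs.len_pos ho
  have hmul : ∀ a, l * (a / l) = a := fun a => mul_div_cancel₀ a hl0.ne'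
  choose! N m' hbr hwl hwr using hb
  set ε := C * D ^ min 1 (r - 2) with hε
  have hε0 : 0 ≤ ε := mul_nonneg hC (Real.rpow_nonneg hD _)
  set B : ℕ → ℝ → ℝ := fun i => branch F (N i) (m' i) l with hB
  set g : ℕ → ℝ → ℝ := fun i =>
    branchMob F (logD F) (N i) (m' i) l (z i / l) (z (i + 1) / l) with hg
  have hzl : StrictMono fun i => z i / l := fun i j hij => div_lt_div_of_pos_right (hz hij) hl0
  have hwl' : StrictMono fun i => w i / l := fun i j hij => div_lt_div_of_pos_right (hw hij) hl0
  obtain ⟨G, hG⟩ := exists_piecewise hzl g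
  have hBl : ∀ i < k + 1, B i (z i / l) = w ((i + m) % (k + 1)) / l := fun i hi => by
    simp only [hB]; rw [branch, hmul, hwl i hi]
  have hBr : ∀ i < k + 1, B i (z (i + 1) / l) = w ((i + m) % (k + 1) + 1) / l := fun i hi => by
    simp only [hB]; rw [branch, hmul, hwr i hi]
  have hfB : ∀ i < k + 1, EqOn (s.scaled F) (B i) (Ico (z i / l) (z (i + 1) / l)) := by
    intro i hi x hx
    have hx' : l * x ∈ Ico (z i) (z (i + 1)) := by
      constructor
      · rw [← hmul (z i)]; exact mul_le_mul_of_nonneg_left hx.1 hl0.le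
      · rw [← hmul (z (i + 1))]; exact mul_lt_mul_of_pos_left hx.2 hl0
    rw [St.scaled, ← hl, (hbr i hi).map _ hx']
    rfl
  have hclean : ∀ i < k + 1, Clean F p (N i) (l * (z i / l)) (l * (z (i + 1) / l)) :=
    fun i hi => by
      rw [hmul, hmul]
      exact (hbr i hi).clean
  have hpos : ∀ i, 0 < z (i + 1) / l - z i / l := fun i => sub_pos.2 (hzl (Nat.lt_succ_self i))
  have hYpos : ∀ i, 0 < B i (z (i + 1) / l) - B i (z i / l) := fun i =>
    sub_pos.2 (branch_strictMono F (N i) (m' i) hl0 (hzl (Nat.lt_succ_self i)))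
  have hf : RotData r k m (fun i => z i / l) (fun i => w i / l) (s.scaled F) := by
    refine ⟨hzl, by simp [hz0], by simp [hz1, hl0.ne'], hwl', by simp [hw0],
      by simp [hw1, hl0.ne'], fun i hi => ?_, fun i hi => ⟨B i, hfB i hi, ?_⟩⟩
    · rw [(hfB i hi).image_eq, branch_image F _ _ hl0 (hzl (Nat.lt_succ_self i)).le]
      exact congr_arg₂ Ico (hBl i hi) (hBr i hi)
    · exact h.posCr_branch hr hl0 (hclean i hi) _
  have hGd : RotData r k m (fun i => z i / l) (fun i => w i / l) G := by
    refine ⟨hzl, by simp [hz0], by simp [hz1, hl0.ne'], hwl', by simp [hw0],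
      by simp [hw1, hl0.ne'], fun i hi => ?_, fun i hi => ⟨g i, hG i, ?_⟩⟩
    · have h1 := mob_image_Ico (x₀ := z i / l) (y₀ := B i (z i / l))
        (h := Real.exp (bsum F (logD F) (N i) (l * (z i / l)))) (hpos i) (hYpos i) (Real.exp_pos _)
      rw [add_sub_cancel, add_sub_cancel] at h1
      rw [EqOn.image_eq (hG i)]
      exact h1.trans (congr_arg₂ Ico (hBl i hi) (hBr i hi))
    · have h1 := posCr_mob hr (x₀ := z i / l) (y₀ := B i (z i / l))
        (h := Real.exp (bsum F (logD F) (N i) (l * (z i / l)))) (hpos i) (hYpos i) (Real.exp_pos _)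
      rw [add_sub_cancel] at h1
      exact h1
  refine ⟨hf.giet hr, rfl, ?_⟩
  have hmem : hGd.giet hr ∈ moebiusGIET r (k + 1) := by
    refine hGd.mem_moebiusGIET hr hm0 hmk fun i hi => ?_
    set X := z (i + 1) / l - z i / l
    set Y := B i (z (i + 1) / l) - B i (z i / l)
    set x₀ := z i / l with hx₀
    set y₀ := B i (z i / l)
    set e := Real.exp (bsum F (logD F) (N i) (l * (z i / l))) with he
    have he0 : 0 < e := Real.exp_pos _
    have hX : 0 < X := hpos i
    have hY : 0 < Y := hYpos i
    refine ⟨y₀ * (e * X - Y) + e * X * Y, y₀ * (X * Y - x₀ * (e * X - Y)) - e * X * Y * x₀,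
      e * X - Y, X * Y - x₀ * (e * X - Y), ?_, fun x hx => ?_⟩
    · have : 0 < e * X ^ 2 * Y ^ 2 := by positivity
      convert this using 1
      ring
    · have hx' : x ∈ Icc x₀ (x₀ + X) := by
        rw [add_sub_cancel]; exact Ico_subset_Icc_self hx
      have h1 := mobDen_pos hX hY he0 hx'
      refine ⟨?_, ?_⟩
      · have e1 : mobDen x₀ X Y e x = (e * X - Y) * x + (X * Y - x₀ * (e * X - Y)) := by
          rw [mobDen]; ring
        rw [← e1]; exact h1.ne'
      · rw [hG i x hx]
        exact mob_eq (y₀ := y₀) h1.ne'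
  have hB0 : 0 ≤ (Real.exp (3 * ε) - 1) * max 1 (Real.exp M) :=
    mul_nonneg (sub_nonneg.2 (Real.one_le_exp (by positivity))) (le_max_of_le_left zero_le_one)
  refine (iInf₂_le _ hmem).trans (hf.d1_le hGd hr hB0 fun i hi x hx => ?_)
  have hnhds : Ico (z i / l) (z (i + 1) / l) ∈ nhds x := Ico_mem_nhds hx.1 hx.2
  have hx' := Ioo_subset_Ico_self hx
  rw [hfB i hi hx', hG i x hx', (Filter.eventuallyEq_of_mem hnhds (hfB i hi)).deriv_eq,
    (Filter.eventuallyEq_of_mem hnhds (hG i)).deriv_eq]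
  refine branchMob_close h hr hl0 (hclean i hi) ?_ ?_ (fun y hy => ?_) (fun y => ?_) hx
  · have h1 := hBl i hi
    simp only [hB] at h1
    rw [h1]
    exact div_nonneg (hw0 ▸ hw.monotone (Nat.zero_le _)) hl0.le
  · have h1 := hBr i hi
    simp only [hB] at h1
    rw [h1, div_le_one hl0, ← hw1]
    exact hw.monotone (Nat.succ_le_of_lt (Nat.mod_lt _ (Nat.succ_pos k)))
  · rw [hmul, hmul] at hy
    rw [hmul]
    exact abs_xr_pow_le hC hD hxr hr (hbr i hi).clean (hbr i hi).disp (hbr i hi).sum hy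
  · rcases (hbr i hi).time with e | e
    · rw [e]; exact (hM y).1
    · rw [e]; exact (hM y).2

theorem abs_bsum_le {φ : ℝ → ℝ} {B : ℝ} (hB : ∀ x, |φ x| ≤ B) (N : ℕ) (x : ℝ) :
    |bsum F φ N x| ≤ N * B := by
  unfold bsum
  refine (Finset.abs_sum_le_sum_abs _ _).trans ((Finset.sum_le_sum fun j _ => hB _).trans ?_)
  simp

/-- `exists_deriv_bound` covers large `n`; the finitely many other times receive a crude bound. `M`
may depend on the map, as it only enters the multiplicative constant. -/
theorem exists_uniform_deriv_bound (h : BreakLift r c F p) (hr : 2 < r) (ho : RotOrder F θ)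
    (hv : ∀ s, (rst θ s).Valid θ) {τ : ℕ → ℕ} (hτ : IsTimes θ τ) :
    ∃ M, ∀ n x, bsum F (logD F) (rst θ (τ n)).a x ≤ M ∧ bsum F (logD F) (rst θ (τ n)).b x ≤ M := by
  obtain ⟨V, hV⟩ := h.exists_dist hr ho hv
  obtain ⟨t₁, h1⟩ := exists_deriv_bound (h.logDeriv hr) ho hv hV hτ
  obtain ⟨B, hB⟩ := (h.isBddPeriodic_logD hr).bdd
  have hB0 : 0 ≤ B := (abs_nonneg _).trans (hB 0)
  set W : ℕ → ℝ := fun n => ((rst θ (τ n)).a + (rst θ (τ n)).b : ℕ) * B with hW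
  have hW0 : ∀ n, 0 ≤ W n := fun n => mul_nonneg (Nat.cast_nonneg _) hB0
  have hS0 : 0 ≤ ∑ n ∈ Finset.range t₁, W n := Finset.sum_nonneg fun n _ => hW0 n
  have hV0 : 0 ≤ 6 * V := (abs_nonneg _).trans (h1 t₁ le_rfl 0).1
  refine ⟨6 * V + ∑ n ∈ Finset.range t₁, W n, fun n x => ?_⟩
  rcases Nat.lt_or_ge n t₁ with hn | hn
  · have h2 := Finset.single_le_sum (f := W) (fun n _ => hW0 n) (Finset.mem_range.2 hn)
    have h3 : W n = (rst θ (τ n)).a * B + (rst θ (τ n)).b * B := by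
      simp only [hW]; push_cast; ring
    have h4 := abs_bsum_le (F := F) hB (rst θ (τ n)).a x
    have h5 := abs_bsum_le (F := F) hB (rst θ (τ n)).b x
    have h6 : (0 : ℝ) ≤ (rst θ (τ n)).a * B := by positivity
    have h7 : (0 : ℝ) ≤ (rst θ (τ n)).b * B := by positivity
    constructor
    · linarith [le_abs_self (bsum F (logD F) (rst θ (τ n)).a x)]
    · linarith [le_abs_self (bsum F (logD F) (rst θ (τ n)).b x)]
  · have h2 := h1 n hn x
    exact ⟨by linarith [le_abs_self (bsum F (logD F) (rst θ (τ n)).a x)],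
      by linarith [le_abs_self (bsum F (logD F) (rst θ (τ n)).b x)]⟩

theorem exp_sub_one_le {t A : ℝ} (htA : t ≤ A) (ht : 0 ≤ t) :
    Real.exp t - 1 ≤ t * Real.exp A := by
  have h1 := Real.add_one_le_exp (-t)
  have h2 : Real.exp (-t) * Real.exp t = 1 := by rw [← Real.exp_add]; simp
  have h3 := Real.exp_pos t
  have h4 := mul_le_mul_of_nonneg_left (Real.exp_le_exp.2 htA) ht
  nlinarith

end Final

end BreakRenorm

theorem mainTheorem3 (r : ℝ) (hr : 2 < r) (k : ℕ) (hk : 1 ≤ k) (c : Fin k → ℝ)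
    (hc : ∀ i, 0 < c i) :
    ∃ ρ : ℝ, 0 < ρ ∧ ρ < 1 ∧
      ∀ T : UnitAddCircle ≃ₜ UnitAddCircle,
        IsBreakDiffeo r c T → HasIrrationalRotationNumber T →
        (∀ n : ℕ, IsRenormalisable (renorm^[n] (cutMap T))) ∧
        ∃ C : ℝ, 0 < C ∧ ∀ n : ℕ, ∃ G : GIET r (k + 1),
          Set.EqOn G.toFun (renorm^[n] (cutMap T)) (Set.Ico 0 1) ∧
          d1ToSet G (moebiusGIET r (k + 1)) ≤ ENNReal.ofReal (C * ρ ^ n) := by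
  open BreakRenorm in
  -- The rate is fixed before the map is given, from `r` and the break sizes alone.
  set V := 2 * ∑ i, |Real.log (c i)| + 1 with hV
  set δ := min 1 (r - 2) with hδ
  have hδ0 : 0 < δ := lt_min one_pos (by linarith)
  set μ := Real.sqrt (ratio V) with hμ
  have hμ0 : 0 < μ := Real.sqrt_pos.2 (ratio_pos V)
  have hμ1 : μ < 1 := by
    rw [hμ, Real.sqrt_lt' one_pos]
    simpa using ratio_lt_one V
  refine ⟨μ ^ δ, Real.rpow_pos_of_pos hμ0 _, Real.rpow_lt_one hμ0.le hμ1 hδ0, fun T hT hI => ?_⟩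
  obtain ⟨F, p, θ, h, ho, hθ0, hθ1, hFT, hF0, hF1⟩ := exists_breakLift hr hT hI
  have hv : ∀ s, (rst θ s).Valid θ := rst_valid ho.irrational hθ0 hθ1
  obtain ⟨hren, τ, hτ, heq⟩ := exists_times ho hv (cutMap_eqOn (θ := θ) h.degOne hFT hF0 hF1)
  refine ⟨hren, ?_⟩
  obtain ⟨t₀, hd⟩ := h.exists_dist_universal hr ho hv hτ
  obtain ⟨C₁, hC₁, hdisp⟩ := disp_decay (h.logDeriv hr) ho hv hτ hd
  obtain ⟨C, hC, hxr⟩ := h.xr_le hr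
  obtain ⟨M, hM⟩ := exists_uniform_deriv_bound h hr ho hv hτ
  set A := 3 * (C * C₁ ^ δ) with hA
  have hA0 : 0 ≤ A := by positivity
  set K := max 1 (Real.exp M) with hK
  have hK0 : 0 ≤ K := le_max_of_le_left zero_le_one
  -- The bound `exp t - 1 ≤ t * exp A` for `0 ≤ t ≤ A` makes the estimate linear in `ρ ^ n`; the
  -- added `1` keeps the constant positive when `A = 0`.
  refine ⟨A * Real.exp A * K + 1, by positivity, fun n => ?_⟩
  obtain ⟨G, hG, hGd⟩ := exists_giet hr hk h ho (hv (τ n)) (rst_tower (θ := θ) ho.degOne (τ n))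
    hC hxr (by positivity) (hdisp n).1 (hdisp n).2 (hM n)
  refine ⟨G, fun x hx => by rw [hG]; exact (heq n hx).symm, hGd.trans
    (ENNReal.ofReal_le_ofReal ?_)⟩
  have hρn : 0 ≤ (μ ^ δ) ^ n := by positivity
  have hρ1 : (μ ^ δ) ^ n ≤ 1 := pow_le_one₀ (by positivity) (Real.rpow_le_one hμ0.le hμ1.le hδ0.le)
  have e1 : 3 * (C * (C₁ * μ ^ n) ^ δ) = A * (μ ^ δ) ^ n := by
    rw [Real.mul_rpow hC₁.le (by positivity), ← Real.rpow_natCast μ n, ← Real.rpow_mul hμ0.le,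
      mul_comm (n : ℝ) δ, Real.rpow_mul hμ0.le, Real.rpow_natCast]
    ring
  have e2 := exp_sub_one_le (t := A * (μ ^ δ) ^ n) (mul_le_of_le_one_right hA0 hρ1)
    (mul_nonneg hA0 hρn)
  have e3 := mul_le_mul_of_nonneg_right e2 hK0
  rw [← e1] at e3
  refine e3.trans ?_
  rw [e1]
  nlinarith
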